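/- **Proposition 4.6.** Let $k$ be a field and let $A$ be a finite-dimensional associative (not necessarily unital) $k$-algebra with basis $\{e_i\}$ and structure constants $e_ie_j=c_{ij}{}^a e_a$ (repeated indices are summed). Let $A$ be a *braided algebra*: it carries an invertible linear map $\Psi:A\otimes A\to A\otimes A$ that obeys the braid relation and is functorial with respect to the product, $$\Psi(ab\otimes c)=(\mathrm{id}\otimes\cdot)(\Psi\otimes\mathrm{id})(\mathrm{id}\otimes\Psi)(a\otimes b\otimes c),\qquad \Psi(a\otimes bc)=(\cdot\otimes\mathrm{id})(\mathrm{id}\otimes\Psi)(\Psi\otimes\mathrm{id})(a\otimes b\otimes c).$$ Assume $\Psi(e_i\otimes e_j)=e_b\otimes e_a\,R^a{}_i{}^b{}_j$, where $R\in M_n\otimes M_n$ is bi-invertible, i.e. $R^{-1}$ and $\tilde R=((R^{t_2})^{-1})^{t_2}$ exist, with $t_2$ the transposition in the second matrix factor. A *braided comeasuring* of $A$ is an associative algebra $B$ with invertible linear braidings $B\otimes B\to B\otimes B$, $A\otimes B\to B\otimes A$, $B\otimes A\to A\otimes B$, all denoted $\Psi$, which together with $\Psi$ on $A\otimes A$ satisfy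 all braid relations on triples formed from $A$ and $B$ and are functorial with respect to the products of $A$ and $B$, and with a linear map $\beta:A\to A\otimes B$ that commutes with the braidings with $A$ and with $B$ (on both sides) and is an algebra map to the braided tensor product algebra, whose product is $(a\otimes b)(c\otimes d)=a\,\Psi(b\otimes c)\,d$. It is *unital* if $B$ is unital and the braidings of $1_B$ with $A$ and $B$ are trivial; no unit of $A$ is involved. A comeasuring $(M,\beta_U)$ is *universal* if for every comeasuring $(B,\beta)$ there is a unique algebra map $\pi:M\to B$ with $\beta=(\mathrm{id}\otimes\pi)\beta_U$, and $\pi$ commutes with the braidings (of $M$, resp. $B$, with itself and with $A$). Universality among unital comeasurings is meant with unital $\pi$. Let $\underline M_1(R,A)$ be the algebra generated by $1$ and elements $u^i{}_j$ with the relations $$c_{ij}{}^a u^k{}_a=c_{ab}{}^k\,R^{-1}{}^a{}_c{}^b{}_d\,u^c{}_e\,R^e{}_i{}^d{}_f\,u^f{}_j .$$ Then $\underline M_1(R,A)$ has invertible braidings with itself and with $A$ and a map $\beta_U:A\to A\otimes \underline M_1(R,A)$ which make it the universal unital braided comeasuring of $A$. It is the extension by a unit, $\underline M_1(R,A)=k1\oplus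 M^+$, of the nonunital algebra $M^+$ generated by the $u^i{}_j$, which, with the restricted braidings and the same $\beta_U$, is universal among all (not necessarily unital) braided comeasurings of $A$. Moreover $\underline M_1(R,A)$ is a braided group, i.e. a bialgebra in the braided sense: product, unit, coproduct and counit commute with the braidings (the coproduct and counit also with those with $A$), the coproduct is a unital algebra map to the braided tensor product algebra $\underline M_1(R,A)\,\underline\otimes\,\underline M_1(R,A)$, and the counit is a unital algebra map. The map $\beta_U$ is a right coaction of it on $A$. Explicitly, $$\Delta u^i{}_j=u^i{}_a\otimes u^a{}_j,\quad \epsilon(u^i{}_j)=\delta^i{}_j,\quad \beta_U(e_j)=e_a\otimes u^a{}_j,$$ $$\Psi(u^i{}_j\otimes u^k{}_l)=u^m{}_n\otimes u^r{}_s\,R^i{}_a{}^d{}_m\,R^{-1}{}^a{}_r{}^n{}_b\,R^s{}_c{}^b{}_l\,\tilde R^c{}_j{}^k{}_d,$$ $$\Psi(u^i{}_j\otimes e_k)=e_m\otimes u^a{}_b\,R^{-1}{}^i{}_a{}^m{}_n\,R^b{}_j{}^n{}_k,\qquad \Psi(e_k\otimes u^i{}_j)=u^a{}_b\otimes e_m\,\tilde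 R^n{}_k{}^i{}_a\,R^m{}_n{}^b{}_j .$$ The braiding of the generators also has the compact form $\Psi(R_{12}^{-1}\mathbf u_1\otimes R_{12}\mathbf u_2)=\mathbf u_2R_{12}^{-1}\otimes\mathbf u_1R_{12}$, i.e. $$R^{-1}{}^i{}_a{}^k{}_b\,R^c{}_j{}^b{}_d\,\Psi(u^a{}_c\otimes u^d{}_l)=R^{-1}{}^i{}_a{}^b{}_d\,R^c{}_j{}^d{}_l\;u^k{}_b\otimes u^a{}_c .$$ -/

import Mathlib

open scoped TensorProduct

universe u v w x

noncomputable section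

namespace BraidedComeas

section Braidings

variable {k : Type u} [Field k]
  {X Y Z V W : Type*} [AddCommGroup X] [Module k X] [AddCommGroup Y] [Module k Y]
  [AddCommGroup Z] [Module k Z] [AddCommGroup V] [Module k V] [AddCommGroup W] [Module k W]

/-- The braiding of `X ⊗ Y` past `Z`, i.e. `Ψ_{X⊗Y,Z} = (Ψ_{X,Z} ⊗ id) (id ⊗ Ψ_{Y,Z})`. -/
def braidLeft (ΨXZ : X ⊗[k] Z →ₗ[k] Z ⊗[k] X) (ΨYZ : Y ⊗[k] Z →ₗ[k] Z ⊗[k] Y) :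
    (X ⊗[k] Y) ⊗[k] Z →ₗ[k] Z ⊗[k] (X ⊗[k] Y) :=
  (TensorProduct.assoc k Z X Y).toLinearMap ∘ₗ ΨXZ.rTensor Y ∘ₗ
    (TensorProduct.assoc k X Z Y).symm.toLinearMap ∘ₗ ΨYZ.lTensor X ∘ₗ
    (TensorProduct.assoc k X Y Z).toLinearMap

/-- The braiding of `X` past `Y ⊗ Z`, i.e. `Ψ_{X,Y⊗Z} = (id ⊗ Ψ_{X,Z}) (Ψ_{X,Y} ⊗ id)`. -/
def braidRight (ΨXY : X ⊗[k] Y →ₗ[k] Y ⊗[k] X) (ΨXZ : X ⊗[k] Z →ₗ[k] Z ⊗[k] X) :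
    X ⊗[k] (Y ⊗[k] Z) →ₗ[k] (Y ⊗[k] Z) ⊗[k] X :=
  (TensorProduct.assoc k Y Z X).symm.toLinearMap ∘ₗ ΨXZ.lTensor Y ∘ₗ
    (TensorProduct.assoc k Y X Z).toLinearMap ∘ₗ ΨXY.rTensor Z ∘ₗ
    (TensorProduct.assoc k X Y Z).symm.toLinearMap

/-- The braid relation (Yang–Baxter equation) on `X ⊗ Y ⊗ Z`:
`(Ψ_{Y,Z} ⊗ id)(id ⊗ Ψ_{X,Z})(Ψ_{X,Y} ⊗ id) = (id ⊗ Ψ_{X,Y})(Ψ_{X,Z} ⊗ id)(id ⊗ Ψ_{Y,Z})`. -/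
def BraidRelation (ΨXY : X ⊗[k] Y →ₗ[k] Y ⊗[k] X) (ΨXZ : X ⊗[k] Z →ₗ[k] Z ⊗[k] X)
    (ΨYZ : Y ⊗[k] Z →ₗ[k] Z ⊗[k] Y) : Prop :=
  braidLeft ΨYZ ΨXZ ∘ₗ ΨXY.rTensor Z = ΨXY.lTensor Z ∘ₗ braidLeft ΨXZ ΨYZ

/-- A linear map `f : V → W` commutes with the braidings with `Z`, on both sides: computing the
braiding before or after applying `f` gives the same result. -/
def NaturalWith (f : V →ₗ[k] W) (ΨVZ : V ⊗[k] Z →ₗ[k] Z ⊗[k] V) (ΨWZ : W ⊗[k] Z →ₗ[k] Z ⊗[k] W)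
    (ΨZV : Z ⊗[k] V →ₗ[k] V ⊗[k] Z) (ΨZW : Z ⊗[k] W →ₗ[k] W ⊗[k] Z) : Prop :=
  ΨWZ ∘ₗ f.rTensor Z = f.lTensor Z ∘ₗ ΨVZ ∧ ΨZW ∘ₗ f.lTensor Z = f.rTensor Z ∘ₗ ΨZV

/-- The trivial braidings with the unit object `k`. -/
abbrev unitBraidLeft (k : Type u) [Field k] (Z : Type*) [AddCommGroup Z] [Module k Z] :
    k ⊗[k] Z →ₗ[k] Z ⊗[k] k :=
  (TensorProduct.comm k k Z).toLinearMap

/-- The trivial braidings with the unit object `k`. -/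
abbrev unitBraidRight (k : Type u) [Field k] (Z : Type*) [AddCommGroup Z] [Module k Z] :
    Z ⊗[k] k →ₗ[k] k ⊗[k] Z :=
  (TensorProduct.comm k Z k).toLinearMap

end Braidings

section Algebras

/-- The product of `X` commutes with the braidings between `X` and `Z`. For `X = Z` and
`Ψ = ΨXZ = ΨZX` these are the functoriality conditions
`Ψ (ab ⊗ c) = (id ⊗ ·)(Ψ ⊗ id)(id ⊗ Ψ)(a ⊗ b ⊗ c)` and
`Ψ (a ⊗ bc) = (· ⊗ id)(id ⊗ Ψ)(Ψ ⊗ id)(a ⊗ b ⊗ c)`. -/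
def MulNatural {k : Type u} [Field k] {X Z : Type*} [NonUnitalRing X] [Module k X]
    [IsScalarTower k X X] [SMulCommClass k X X] [AddCommGroup Z] [Module k Z]
    (ΨXZ : X ⊗[k] Z →ₗ[k] Z ⊗[k] X) (ΨZX : Z ⊗[k] X →ₗ[k] X ⊗[k] Z) : Prop :=
  NaturalWith (LinearMap.mul' k X) (braidLeft ΨXZ ΨXZ) ΨXZ (braidRight ΨZX ΨZX) ΨZX

/-- The unit map `k → X` commutes with the braidings between `X` and `Z`. -/
def UnitNatural {k : Type u} [Field k] {X Z : Type*} [Ring X] [Algebra k X]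
    [AddCommGroup Z] [Module k Z]
    (ΨXZ : X ⊗[k] Z →ₗ[k] Z ⊗[k] X) (ΨZX : Z ⊗[k] X →ₗ[k] X ⊗[k] Z) : Prop :=
  NaturalWith (Algebra.linearMap k X) (unitBraidLeft k Z) ΨXZ (unitBraidRight k Z) ΨZX

/-- The product `(a ⊗ b)(c ⊗ d) = a Ψ(b ⊗ c) d` of the braided tensor product algebra
of `X` and `Y`. -/
def braidedMul {k : Type u} [Field k] {X Y : Type*} [NonUnitalRing X] [Module k X]
    [IsScalarTower k X X] [SMulCommClass k X X] [NonUnitalRing Y] [Module k Y]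
    [IsScalarTower k Y Y] [SMulCommClass k Y Y] (ΨYX : Y ⊗[k] X →ₗ[k] X ⊗[k] Y) :
    (X ⊗[k] Y) ⊗[k] (X ⊗[k] Y) →ₗ[k] X ⊗[k] Y :=
  TensorProduct.map (LinearMap.mul' k X) (LinearMap.mul' k Y) ∘ₗ
    (TensorProduct.assoc k X X (Y ⊗[k] Y)).symm.toLinearMap ∘ₗ
    LinearMap.lTensor X ((TensorProduct.assoc k X Y Y).toLinearMap ∘ₗ ΨYX.rTensor Y ∘ₗ
      (TensorProduct.assoc k Y X Y).symm.toLinearMap) ∘ₗ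
    (TensorProduct.assoc k X Y (X ⊗[k] Y)).toLinearMap

/-- A braided algebra: an associative (not necessarily unital) algebra `A` with an invertible
operator `Ψ` on `A ⊗ A` that obeys the braid relation and is functorial with respect to the
product. -/
structure IsBraidedAlgebra {k : Type u} [Field k] {A : Type*} [NonUnitalRing A] [Module k A]
    [IsScalarTower k A A] [SMulCommClass k A A] (Ψ : A ⊗[k] A ≃ₗ[k] A ⊗[k] A) : Prop where
  braid : BraidRelation Ψ.toLinearMap Ψ.toLinearMap Ψ.toLinearMap
  mul_natural : MulNatural Ψ.toLinearMap Ψ.toLinearMap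

/-- A braided comeasuring of the braided algebra `(A, Ψ)`: an associative algebra `B` (not
necessarily unital) which is an object of a common braided category with `A`, that is, there are
invertible braidings among `A` and `B` which extend `Ψ`, satisfy all braid relations and commute
with the products of `A` and `B`; and a linear map `β : A → A ⊗ B` that is a morphism (it commutes
with all these braidings) and an algebra map into the braided tensor product algebra. -/
structure Comeasuring (k : Type u) [Field k] {A : Type v} [NonUnitalRing A] [Module k A]
    [IsScalarTower k A A] [SMulCommClass k A A] (Ψ : A ⊗[k] A ≃ₗ[k] A ⊗[k] A)
    (B : Type w) [NonUnitalRing B] [Module k B] [IsScalarTower k B B] [SMulCommClass k B B] where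
  /-- The braiding of `B` with itself. -/
  ΨBB : B ⊗[k] B ≃ₗ[k] B ⊗[k] B
  /-- The braiding of `A` past `B`. -/
  ΨAB : A ⊗[k] B ≃ₗ[k] B ⊗[k] A
  /-- The braiding of `B` past `A`. -/
  ΨBA : B ⊗[k] A ≃ₗ[k] A ⊗[k] B
  /-- The comeasuring map. -/
  β : A →ₗ[k] A ⊗[k] B
  braid_AAB : BraidRelation Ψ.toLinearMap ΨAB.toLinearMap ΨAB.toLinearMap
  braid_ABA : BraidRelation ΨAB.toLinearMap Ψ.toLinearMap ΨBA.toLinearMap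
  braid_BAA : BraidRelation ΨBA.toLinearMap ΨBA.toLinearMap Ψ.toLinearMap
  braid_ABB : BraidRelation ΨAB.toLinearMap ΨAB.toLinearMap ΨBB.toLinearMap
  braid_BAB : BraidRelation ΨBA.toLinearMap ΨBB.toLinearMap ΨAB.toLinearMap
  braid_BBA : BraidRelation ΨBB.toLinearMap ΨBA.toLinearMap ΨBA.toLinearMap
  braid_BBB : BraidRelation ΨBB.toLinearMap ΨBB.toLinearMap ΨBB.toLinearMap
  mul_natural_AB : MulNatural ΨAB.toLinearMap ΨBA.toLinearMap
  mul_natural_BA : MulNatural ΨBA.toLinearMap ΨAB.toLinearMap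
  mul_natural_BB : MulNatural ΨBB.toLinearMap ΨBB.toLinearMap
  β_natural_A : NaturalWith β Ψ.toLinearMap (braidLeft Ψ.toLinearMap ΨBA.toLinearMap)
    Ψ.toLinearMap (braidRight Ψ.toLinearMap ΨAB.toLinearMap)
  β_natural_B : NaturalWith β ΨAB.toLinearMap (braidLeft ΨAB.toLinearMap ΨBB.toLinearMap)
    ΨBA.toLinearMap (braidRight ΨBA.toLinearMap ΨBB.toLinearMap)
  β_mul : β ∘ₗ LinearMap.mul' k A =
    braidedMul ΨBA.toLinearMap ∘ₗ TensorProduct.map β β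

end Algebras

section Universal

variable {k : Type u} [Field k] {A : Type v} [NonUnitalRing A] [Module k A]
  [IsScalarTower k A A] [SMulCommClass k A A] {Ψ : A ⊗[k] A ≃ₗ[k] A ⊗[k] A}

/-- A linear map `f : B → C` between the algebras of two comeasurings is compatible with the
braidings. -/
structure IsBraidedMap {B : Type*} [NonUnitalRing B] [Module k B] [IsScalarTower k B B]
    [SMulCommClass k B B] {C : Type*} [NonUnitalRing C] [Module k C] [IsScalarTower k C C]
    [SMulCommClass k C C] (S : Comeasuring k Ψ B) (T : Comeasuring k Ψ C) (f : B →ₗ[k] C) :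
    Prop where
  map_BB : T.ΨBB.toLinearMap ∘ₗ TensorProduct.map f f = TensorProduct.map f f ∘ₗ S.ΨBB.toLinearMap
  map_AB : T.ΨAB.toLinearMap ∘ₗ f.lTensor A = f.rTensor A ∘ₗ S.ΨAB.toLinearMap
  map_BA : T.ΨBA.toLinearMap ∘ₗ f.rTensor A = f.lTensor A ∘ₗ S.ΨBA.toLinearMap

/-- A linear map `f : B → C` intertwines the comeasuring maps: `β_C = (id ⊗ f) β_B`. -/
def Intertwines {B : Type*} [NonUnitalRing B] [Module k B] [IsScalarTower k B B]
    [SMulCommClass k B B] {C : Type*} [NonUnitalRing C] [Module k C] [IsScalarTower k C C]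
    [SMulCommClass k C C] (S : Comeasuring k Ψ B) (T : Comeasuring k Ψ C) (f : B →ₗ[k] C) :
    Prop :=
  T.β = f.lTensor A ∘ₗ S.β

/-- A comeasuring by a unital algebra is unital when the unit map of `B` is a morphism. (The
comeasuring map is not required to respect any unit of `A`.) -/
structure Comeasuring.IsUnital {B : Type*} [Ring B] [Algebra k B] (S : Comeasuring k Ψ B) :
    Prop where
  unit_A : UnitNatural S.ΨBA.toLinearMap S.ΨAB.toLinearMap
  unit_B : UnitNatural S.ΨBB.toLinearMap S.ΨBB.toLinearMap

/-- Universality among all, not necessarily unital, comeasurings: there is a unique algebra map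
`π` with `β = (id ⊗ π) β_U`, and it is compatible with the braidings. -/
def Comeasuring.IsUniversal {M : Type*} [NonUnitalRing M] [Module k M] [IsScalarTower k M M]
    [SMulCommClass k M M] (S : Comeasuring k Ψ M) : Prop :=
  ∀ (B : Type w) [NonUnitalRing B] [Module k B] [IsScalarTower k B B] [SMulCommClass k B B]
    (T : Comeasuring k Ψ B), ∃ π : M →ₙₐ[k] B,
      Intertwines S T (π : M →ₗ[k] B) ∧ IsBraidedMap S T (π : M →ₗ[k] B) ∧
      ∀ π' : M →ₙₐ[k] B, Intertwines S T (π' : M →ₗ[k] B) → π' = π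

/-- Universality among unital comeasurings, with unital algebra maps `π`. -/
def Comeasuring.IsUnitalUniversal {M : Type*} [Ring M] [Algebra k M] (S : Comeasuring k Ψ M) :
    Prop :=
  S.IsUnital ∧ ∀ (B : Type w) [Ring B] [Algebra k B] (T : Comeasuring k Ψ B), T.IsUnital →
    ∃ π : M →ₐ[k] B,
      Intertwines S T π.toLinearMap ∧ IsBraidedMap S T π.toLinearMap ∧
      ∀ π' : M →ₐ[k] B, Intertwines S T π'.toLinearMap → π' = π

/-- A bialgebra in a braided category ("braided group"): an algebra and coalgebra `M` with a
braiding for which product, unit, coproduct and counit are morphisms, such that the coproduct is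
a unital algebra map to the braided tensor product algebra of `M` with itself and the counit is a
unital algebra map. -/
structure IsBraidedBialgebra {M : Type*} [Ring M] [Algebra k M] [Coalgebra k M]
    (ΨM : M ⊗[k] M ≃ₗ[k] M ⊗[k] M) : Prop where
  braid : BraidRelation ΨM.toLinearMap ΨM.toLinearMap ΨM.toLinearMap
  mul_natural : MulNatural ΨM.toLinearMap ΨM.toLinearMap
  unit_natural : UnitNatural ΨM.toLinearMap ΨM.toLinearMap
  comul_natural : NaturalWith (Coalgebra.comul (R := k) (A := M)) ΨM.toLinearMap
    (braidLeft ΨM.toLinearMap ΨM.toLinearMap) ΨM.toLinearMap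
    (braidRight ΨM.toLinearMap ΨM.toLinearMap)
  counit_natural : NaturalWith (Coalgebra.counit (R := k) (A := M)) ΨM.toLinearMap
    (unitBraidLeft k M) ΨM.toLinearMap (unitBraidRight k M)
  comul_mul : Coalgebra.comul (R := k) (A := M) ∘ₗ LinearMap.mul' k M =
    braidedMul ΨM.toLinearMap ∘ₗ
      TensorProduct.map (Coalgebra.comul (R := k) (A := M)) (Coalgebra.comul (R := k) (A := M))
  comul_one : Coalgebra.comul (R := k) (1 : M) = 1 ⊗ₜ[k] 1
  counit_mul : ∀ a b : M, Coalgebra.counit (R := k) (a * b) =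
    Coalgebra.counit (R := k) a * Coalgebra.counit (R := k) b
  counit_one : Coalgebra.counit (R := k) (1 : M) = 1

/-- `β : V → V ⊗ M` is a right coaction of the coalgebra `M`. -/
structure IsRightCoaction {V : Type*} [AddCommGroup V] [Module k V] {M : Type*} [AddCommGroup M]
    [Module k M] [Coalgebra k M] (β : V →ₗ[k] V ⊗[k] M) : Prop where
  coassoc : (TensorProduct.assoc k V M M).toLinearMap ∘ₗ β.rTensor M ∘ₗ β =
    (Coalgebra.comul (R := k) (A := M)).lTensor V ∘ₗ β
  counit : (TensorProduct.rid k V).toLinearMap ∘ₗ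
    (Coalgebra.counit (R := k) (A := M)).lTensor V ∘ₗ β = LinearMap.id

end Universal

section RMatrix

variable {k : Type u} [Field k] {ι : Type x} [Fintype ι] [DecidableEq ι]

/-- Transposition in the second matrix factor of `M_n ⊗ M_n`. An element with components
`R^i_j^k_l` is the matrix with entries `R (i, k) (j, l)`. -/
def transpose₂ (R : Matrix (ι × ι) (ι × ι) k) : Matrix (ι × ι) (ι × ι) k :=
  Matrix.of fun p q => R (p.1, q.2) (q.1, p.2)

/-- `R̃ = ((R^{t₂})⁻¹)^{t₂}`. -/
def secondInverse (R : Matrix (ι × ι) (ι × ι) k) : Matrix (ι × ι) (ι × ι) k :=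
  transpose₂ (transpose₂ R)⁻¹

/-- Bi-invertibility: both `R⁻¹` and `R̃` exist. -/
def IsBiinvertible (R : Matrix (ι × ι) (ι × ι) k) : Prop :=
  IsUnit R ∧ IsUnit (transpose₂ R)

variable {A : Type v} [NonUnitalRing A] [Module k A]
  [IsScalarTower k A A] [SMulCommClass k A A]

/-- The braiding `Ψ` is determined by the matrix `R` in the basis `e`:
`Ψ (e_i ⊗ e_j) = e_b ⊗ e_a R^a_i^b_j`. -/
def IsBraidingOf (e : Module.Basis ι k A) (R : Matrix (ι × ι) (ι × ι) k)
    (Ψ : A ⊗[k] A ≃ₗ[k] A ⊗[k] A) : Prop :=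
  ∀ i j, Ψ (e i ⊗ₜ[k] e j) = ∑ a, ∑ b, R (a, b) (i, j) • (e b ⊗ₜ[k] e a)

/-- The structure constants `c_{ij}^l` of `A`, where `e_i e_j = c_{ij}^l e_l`. -/
def structConst (e : Module.Basis ι k A) (i j l : ι) : k :=
  e.repr (e i * e j) l

/-- The relations
`c_{ij}^a u^l_a = c_{ab}^l (R⁻¹)^a_c^b_d u^c_p R^p_i^d_f u^f_j`
in the free unital algebra on generators `u^i_j`. -/
inductive Rel (e : Module.Basis ι k A) (R : Matrix (ι × ι) (ι × ι) k) :
    FreeAlgebra k (ι × ι) → FreeAlgebra k (ι × ι) → Prop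
  | mk (i j l : ι) : Rel e R
      (∑ a, structConst e i j a • FreeAlgebra.ι k (l, a))
      (∑ a, ∑ b, ∑ c, ∑ d, ∑ p, ∑ f,
        (structConst e a b l * R⁻¹ (a, b) (c, d) * R (p, d) (i, f)) •
          (FreeAlgebra.ι k (c, p) * FreeAlgebra.ι k (f, j)))

/-- The unital algebra with generators `u^i_j` and the relations `Rel`. -/
abbrev M₁ (e : Module.Basis ι k A) (R : Matrix (ι × ι) (ι × ι) k) : Type (max u x) :=
  RingQuot (Rel e R)

/-- The generators `u^i_j`. -/
def gen (e : Module.Basis ι k A) (R : Matrix (ι × ι) (ι × ι) k) (i j : ι) : M₁ e R :=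
  RingQuot.mkAlgHom k (Rel e R) (FreeAlgebra.ι k (i, j))

/-- The nonunital algebra generated by the `u^i_j`. -/
abbrev MPlus (e : Module.Basis ι k A) (R : Matrix (ι × ι) (ι × ι) k) :
    NonUnitalSubalgebra k (M₁ e R) :=
  NonUnitalAlgebra.adjoin k (Set.range fun p : ι × ι => gen e R p.1 p.2)

end RMatrix

end BraidedComeas

end

/-! Expanded in the basis of `A`, an invertible braiding `l : A ⊗ X → X ⊗ A` is a matrix `Q` with
entries in `End X`, whose inverse `P` is read off from `l⁻¹`. If `l` satisfies the braid relation
with `Ψ` and is functorial for the product of `A`, then `R Q₁ Q₂ = Q₂ Q₁ R` and `Q` is compatible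
with the structure constants `C`. Naturality of `β_U` leaves one candidate for the braiding of the
generators past `X`, namely `u ↦ P u Q`. By `IsSolution.conj` this conjugation preserves the
defining relations `u C = C R⁻¹ u₁ R u₂`, so `l` extends to a braiding of `M₁` past `X`
(`exists_extension`).

With `X = A`, the braidings `Ψ` and `Ψ⁻¹` give two braidings of `M₁` past `A`. They are bijective by
a dimension count on a filtration by degree (`bijective_of_generators`), given that a partially
transposed matrix is invertible. For `Ψ⁻¹` this is the existence of `R̃`; for `Ψ` it is the
invertibility of `(R⁻¹)^{t₂}`, which follows from bi-invertibility and the braid relation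
(`isUnit_transpose₂_inv`). The inverse of the second braiding is the braiding of `A` past `M₁`, and
a further extension with `X = M₁` braids `M₁` with itself.

The axioms rest on a uniqueness principle, `UnitalMover.natural`: naturality of the coactions forces
compatibility with braidings on generators, and functoriality carries it to products. Hence what
commutes with the braidings of `A` past other objects also commutes with those of `M₁`. The braid
relations follow from that of `Ψ` by replacing copies of `A` with `M₁` one at a time, and the
universal map `π` is braided for the same reason.

For universality, naturality of `β` determines the braiding of the matrix elements past `A`, and
then multiplicativity of `β` is equivalent to the defining relations (`coact_mul_iff`). The identity
matrix is a solution and gives the counit. The product of two solutions with braided cross relations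
is a solution (`IsSolution.mul`) and gives the coproduct. The zero matrix gives a character with
kernel `M⁺`; the projection onto this kernel commutes with the braidings, so everything restricts to
`M⁺`. -/

set_option linter.unusedSectionVars false

noncomputable section

namespace BraidedComeas

/-! ### Naturality of maps and crossings, one side at a time -/

section Naturality

variable {k : Type u} [Field k]
  {X Y Z V W V' W' U : Type*} [AddCommGroup X] [Module k X] [AddCommGroup Y] [Module k Y]
  [AddCommGroup Z] [Module k Z] [AddCommGroup V] [Module k V] [AddCommGroup W] [Module k W]
  [AddCommGroup V'] [Module k V'] [AddCommGroup W'] [Module k W'] [AddCommGroup U] [Module k U]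

/-- `f` can be applied before or after its source and target are braided past `Z`. -/
def NatL (f : V →ₗ[k] W) (ΨVZ : V ⊗[k] Z →ₗ[k] Z ⊗[k] V) (ΨWZ : W ⊗[k] Z →ₗ[k] Z ⊗[k] W) :
    Prop :=
  ΨWZ ∘ₗ f.rTensor Z = f.lTensor Z ∘ₗ ΨVZ

/-- `f` can be applied before or after `Z` is braided past its source and target. -/
def NatR (f : V →ₗ[k] W) (ΨZV : Z ⊗[k] V →ₗ[k] V ⊗[k] Z) (ΨZW : Z ⊗[k] W →ₗ[k] W ⊗[k] Z) :
    Prop :=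
  ΨZW ∘ₗ f.lTensor Z = f.rTensor Z ∘ₗ ΨZV

theorem NatL.apply {f : V →ₗ[k] W} {ΨVZ : V ⊗[k] Z →ₗ[k] Z ⊗[k] V}
    {ΨWZ : W ⊗[k] Z →ₗ[k] Z ⊗[k] W} (h : NatL f ΨVZ ΨWZ) (v : V) (z : Z) :
    ΨWZ (f v ⊗ₜ z) = f.lTensor Z (ΨVZ (v ⊗ₜ z)) :=
  LinearMap.congr_fun h (v ⊗ₜ z)

theorem NatR.apply {f : V →ₗ[k] W} {ΨZV : Z ⊗[k] V →ₗ[k] V ⊗[k] Z}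
    {ΨZW : Z ⊗[k] W →ₗ[k] W ⊗[k] Z} (h : NatR f ΨZV ΨZW) (z : Z) (v : V) :
    ΨZW (z ⊗ₜ f v) = f.rTensor Z (ΨZV (z ⊗ₜ v)) :=
  LinearMap.congr_fun h (z ⊗ₜ v)

theorem NatR.apply' {f : V →ₗ[k] W} {ΨZV : Z ⊗[k] V →ₗ[k] V ⊗[k] Z}
    {ΨZW : Z ⊗[k] W →ₗ[k] W ⊗[k] Z} (h : NatR f ΨZV ΨZW) (t : Z ⊗[k] V) :
    ΨZW (f.lTensor Z t) = f.rTensor Z (ΨZV t) :=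
  LinearMap.congr_fun h t

theorem natL_of_apply {f : V →ₗ[k] W} {ΨVZ : V ⊗[k] Z →ₗ[k] Z ⊗[k] V}
    {ΨWZ : W ⊗[k] Z →ₗ[k] Z ⊗[k] W}
    (h : ∀ v z, ΨWZ (f v ⊗ₜ z) = f.lTensor Z (ΨVZ (v ⊗ₜ z))) : NatL f ΨVZ ΨWZ :=
  TensorProduct.ext' h

theorem natR_of_apply {f : V →ₗ[k] W} {ΨZV : Z ⊗[k] V →ₗ[k] V ⊗[k] Z}
    {ΨZW : Z ⊗[k] W →ₗ[k] W ⊗[k] Z}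
    (h : ∀ z v, ΨZW (z ⊗ₜ f v) = f.rTensor Z (ΨZV (z ⊗ₜ v))) : NatR f ΨZV ΨZW :=
  TensorProduct.ext' h

/-- Braiding `x` past the first factor of an element of `Z ⊗ Y`. -/
def passLeft (a : X ⊗[k] Z →ₗ[k] Z ⊗[k] X) (Y : Type*) [AddCommGroup Y] [Module k Y] (x : X) :
    Z ⊗[k] Y →ₗ[k] Z ⊗[k] (X ⊗[k] Y) :=
  (TensorProduct.assoc k Z X Y).toLinearMap ∘ₗ a.rTensor Y ∘ₗ
    (TensorProduct.assoc k X Z Y).symm.toLinearMap ∘ₗ TensorProduct.mk k X (Z ⊗[k] Y) x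

theorem passLeft_tmul (a : X ⊗[k] Z →ₗ[k] Z ⊗[k] X) (x : X) (z : Z) (y : Y) :
    passLeft a Y x (z ⊗ₜ y) = TensorProduct.assoc k Z X Y (a (x ⊗ₜ z) ⊗ₜ y) := rfl

theorem braidLeft_tmul (a : X ⊗[k] Z →ₗ[k] Z ⊗[k] X) (b : Y ⊗[k] Z →ₗ[k] Z ⊗[k] Y)
    (x : X) (y : Y) (z : Z) :
    braidLeft a b ((x ⊗ₜ y) ⊗ₜ z) = passLeft a Y x (b (y ⊗ₜ z)) := rfl

/-- Braiding the last factor of an element of `Y ⊗ X` past `z`. -/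
def passRight (b : X ⊗[k] Z →ₗ[k] Z ⊗[k] X) (Y : Type*) [AddCommGroup Y] [Module k Y] (z : Z) :
    Y ⊗[k] X →ₗ[k] (Y ⊗[k] Z) ⊗[k] X :=
  (TensorProduct.assoc k Y Z X).symm.toLinearMap ∘ₗ b.lTensor Y ∘ₗ
    (TensorProduct.assoc k Y X Z).toLinearMap ∘ₗ (TensorProduct.mk k (Y ⊗[k] X) Z).flip z

theorem passRight_tmul (b : X ⊗[k] Z →ₗ[k] Z ⊗[k] X) (x : X) (z : Z) (y : Y) :
    passRight b Y z (y ⊗ₜ x) = (TensorProduct.assoc k Y Z X).symm (y ⊗ₜ b (x ⊗ₜ z)) := rfl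

theorem braidRight_tmul (a : X ⊗[k] Y →ₗ[k] Y ⊗[k] X) (b : X ⊗[k] Z →ₗ[k] Z ⊗[k] X)
    (x : X) (y : Y) (z : Z) :
    braidRight a b (x ⊗ₜ (y ⊗ₜ z)) = passRight b Y z (a (x ⊗ₜ y)) := rfl

theorem natL_id (a : V ⊗[k] Z →ₗ[k] Z ⊗[k] V) : NatL LinearMap.id a a := by
  simp [NatL]

theorem natR_id (a : Z ⊗[k] V →ₗ[k] V ⊗[k] Z) : NatR LinearMap.id a a := by
  simp [NatR]

theorem NatL.comp {f : V →ₗ[k] W} {g : W →ₗ[k] U} {a : V ⊗[k] Z →ₗ[k] Z ⊗[k] V}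
    {b : W ⊗[k] Z →ₗ[k] Z ⊗[k] W} {c : U ⊗[k] Z →ₗ[k] Z ⊗[k] U}
    (hg : NatL g b c) (hf : NatL f a b) : NatL (g ∘ₗ f) a c := by
  unfold NatL at *
  rw [LinearMap.rTensor_comp, LinearMap.lTensor_comp, ← LinearMap.comp_assoc, hg,
    LinearMap.comp_assoc, hf, LinearMap.comp_assoc]

theorem NatL.map {f : V →ₗ[k] V'} {g : W →ₗ[k] W'} {a : V ⊗[k] Z →ₗ[k] Z ⊗[k] V}
    {a' : V' ⊗[k] Z →ₗ[k] Z ⊗[k] V'} {b : W ⊗[k] Z →ₗ[k] Z ⊗[k] W}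
    {b' : W' ⊗[k] Z →ₗ[k] Z ⊗[k] W'} (hf : NatL f a a') (hg : NatL g b b') :
    NatL (TensorProduct.map f g) (braidLeft a b) (braidLeft a' b') := by
  refine natL_of_apply fun t z ↦ ?_
  induction t with
  | zero => simp
  | add s t hs ht => simp only [map_add, TensorProduct.add_tmul, hs, ht]
  | tmul x y =>
    rw [TensorProduct.map_tmul, braidLeft_tmul, braidLeft_tmul, hg.apply]
    generalize b (y ⊗ₜ z) = t
    induction t with
    | zero => simp
    | add s t hs ht => simp only [map_add, hs, ht]
    | tmul z y =>
      rw [LinearMap.lTensor_tmul, passLeft_tmul, passLeft_tmul, hf.apply]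
      generalize a (x ⊗ₜ z) = t
      induction t with
      | zero => simp
      | add s t hs ht => simp only [map_add, TensorProduct.add_tmul, hs, ht]
      | tmul z x => simp

theorem natL_assoc (a : X ⊗[k] Z →ₗ[k] Z ⊗[k] X) (b : Y ⊗[k] Z →ₗ[k] Z ⊗[k] Y)
    (c : W ⊗[k] Z →ₗ[k] Z ⊗[k] W) :
    NatL (TensorProduct.assoc k X Y W).toLinearMap (braidLeft (braidLeft a b) c)
      (braidLeft a (braidLeft b c)) := by
  refine TensorProduct.ext_fourfold fun x y w z ↦ ?_
  simp only [LinearMap.comp_apply, LinearMap.rTensor_tmul, LinearEquiv.coe_coe,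
    TensorProduct.assoc_tmul, braidLeft_tmul]
  generalize c (w ⊗ₜ z) = t
  induction t with
  | zero => simp
  | add s t hs ht => simp only [map_add, hs, ht]
  | tmul z w =>
    rw [passLeft_tmul, passLeft_tmul, braidLeft_tmul]
    generalize b (y ⊗ₜ z) = t
    induction t with
    | zero => simp
    | add s t hs ht => simp only [map_add, TensorProduct.add_tmul, hs, ht]
    | tmul z y =>
      rw [passLeft_tmul, TensorProduct.assoc_tmul, passLeft_tmul]
      generalize a (x ⊗ₜ z) = t
      induction t with
      | zero => simp
      | add s t hs ht => simp only [map_add, TensorProduct.add_tmul, hs, ht]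
      | tmul z x => simp

theorem natL_assoc_symm (a : X ⊗[k] Z →ₗ[k] Z ⊗[k] X) (b : Y ⊗[k] Z →ₗ[k] Z ⊗[k] Y)
    (c : W ⊗[k] Z →ₗ[k] Z ⊗[k] W) :
    NatL (TensorProduct.assoc k X Y W).symm.toLinearMap (braidLeft a (braidLeft b c))
      (braidLeft (braidLeft a b) c) := by
  refine natL_of_apply fun t z ↦ ?_
  obtain ⟨t, rfl⟩ := (TensorProduct.assoc k X Y W).surjective t
  have h := (natL_assoc a b c).apply t z
  simp only [LinearEquiv.coe_coe, LinearEquiv.symm_apply_apply] at h ⊢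
  rw [h, ← LinearMap.comp_apply, ← LinearMap.lTensor_comp, ← LinearEquiv.coe_trans,
    LinearEquiv.self_trans_symm]
  simp

theorem NatL.braidRight {f : V →ₗ[k] W} {a : V ⊗[k] X →ₗ[k] X ⊗[k] V}
    {a' : W ⊗[k] X →ₗ[k] X ⊗[k] W} {b : V ⊗[k] Y →ₗ[k] Y ⊗[k] V}
    {b' : W ⊗[k] Y →ₗ[k] Y ⊗[k] W} (ha : NatL f a a') (hb : NatL f b b') :
    NatL f (braidRight a b) (braidRight a' b') := by
  refine natL_of_apply fun v t ↦ ?_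
  induction t with
  | zero => simp
  | add s t hs ht => simp only [map_add, TensorProduct.tmul_add, hs, ht]
  | tmul x y =>
    rw [braidRight_tmul, braidRight_tmul, ha.apply]
    generalize a (v ⊗ₜ x) = t
    induction t with
    | zero => simp
    | add s t hs ht => simp only [map_add, hs, ht]
    | tmul x v =>
      rw [LinearMap.lTensor_tmul, passRight_tmul, passRight_tmul, hb.apply]
      generalize b (v ⊗ₜ y) = t
      induction t with
      | zero => simp
      | add s t hs ht => simp only [map_add, TensorProduct.tmul_add, hs, ht]
      | tmul y v => simp

/-- Braiding `V ⊗ W` past `X ⊗ Y` does not depend on which tensor product is resolved first. -/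
theorem braidLeft_braidRight (a : V ⊗[k] X →ₗ[k] X ⊗[k] V) (b : V ⊗[k] Y →ₗ[k] Y ⊗[k] V)
    (c : W ⊗[k] X →ₗ[k] X ⊗[k] W) (d : W ⊗[k] Y →ₗ[k] Y ⊗[k] W) :
    braidLeft (braidRight a b) (braidRight c d) = braidRight (braidLeft a c) (braidLeft b d) := by
  refine TensorProduct.ext' fun s t ↦ ?_
  induction s with
  | zero => simp
  | add s s' hs hs' => simp only [map_add, TensorProduct.add_tmul, hs, hs']
  | tmul v w =>
    induction t with
    | zero => simp
    | add s t hs ht => simp only [map_add, TensorProduct.tmul_add, hs, ht]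
    | tmul x y =>
      rw [braidLeft_tmul, braidRight_tmul, braidRight_tmul, braidLeft_tmul]
      generalize c (w ⊗ₜ x) = t
      induction t with
      | zero => simp
      | add s t hs ht => simp only [map_add, hs, ht]
      | tmul x w =>
        rw [passRight_tmul, passLeft_tmul]
        -- The crossings `a` and `d` act on disjoint strands. With `p` standing for the outcome of
        -- `a`, the right-hand side is rewritten so that `d (w ⊗ y)` appears as a block and can be
        -- expanded on both sides at once.
        have key (p : X ⊗[k] V) :
            passRight (braidLeft b d) X y (TensorProduct.assoc k X V W (p ⊗ₜ w)) =
              (TensorProduct.assoc k X Y (V ⊗[k] W)).symm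
                (LinearMap.lTensor X ((TensorProduct.assoc k Y V W).toLinearMap ∘ₗ
                  b.rTensor W ∘ₗ (TensorProduct.assoc k V Y W).symm.toLinearMap)
                  (TensorProduct.assoc k X V (Y ⊗[k] W) (p ⊗ₜ d (w ⊗ₜ y)))) := by
          induction p with
          | zero => simp
          | add s t hs ht => simp only [map_add, TensorProduct.add_tmul, hs, ht]
          | tmul x v =>
            rw [TensorProduct.assoc_tmul, passRight_tmul, braidLeft_tmul]
            rfl
        rw [key]
        generalize d (w ⊗ₜ y) = q
        induction q with
        | zero => simp
        | add s t hs ht => simp only [map_add, TensorProduct.tmul_add, hs, ht]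
        | tmul y w =>
          rw [TensorProduct.assoc_symm_tmul, passLeft_tmul, braidRight_tmul]
          generalize a (v ⊗ₜ x) = p
          induction p with
          | zero => simp
          | add s t hs ht => simp only [map_add, TensorProduct.add_tmul, hs, ht]
          | tmul x v =>
            rw [passRight_tmul]
            simp only [TensorProduct.assoc_tmul, LinearMap.lTensor_tmul, LinearMap.comp_apply,
              LinearEquiv.coe_coe, TensorProduct.assoc_symm_tmul, LinearMap.rTensor_tmul]
            generalize b (v ⊗ₜ y) = r
            induction r with
            | zero => simp
            | add s t hs ht =>
              simp only [map_add, TensorProduct.tmul_add, TensorProduct.add_tmul, hs, ht]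
            | tmul y v => simp

/-- Transferring naturality to inverse braidings. -/
theorem NatL.inverse {f : V →ₗ[k] W} {a : V ⊗[k] Z →ₗ[k] Z ⊗[k] V}
    {b : W ⊗[k] Z →ₗ[k] Z ⊗[k] W} {a' : Z ⊗[k] V →ₗ[k] V ⊗[k] Z}
    {b' : Z ⊗[k] W →ₗ[k] W ⊗[k] Z} (h : NatL f a b) (ha : a ∘ₗ a' = LinearMap.id)
    (hb : b' ∘ₗ b = LinearMap.id) : NatR f a' b' := by
  unfold NatL at h
  unfold NatR
  calc b' ∘ₗ f.lTensor Z = b' ∘ₗ (f.lTensor Z ∘ₗ a) ∘ₗ a' := by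
        rw [LinearMap.comp_assoc, ha, LinearMap.comp_id]
    _ = (b' ∘ₗ b) ∘ₗ f.rTensor Z ∘ₗ a' := by rw [← h]; rfl
    _ = _ := by rw [hb, LinearMap.id_comp]

theorem NatR.inverse {f : V →ₗ[k] W} {a : Z ⊗[k] V →ₗ[k] V ⊗[k] Z}
    {b : Z ⊗[k] W →ₗ[k] W ⊗[k] Z} {a' : V ⊗[k] Z →ₗ[k] Z ⊗[k] V}
    {b' : W ⊗[k] Z →ₗ[k] Z ⊗[k] W} (h : NatR f a b) (ha : a ∘ₗ a' = LinearMap.id)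
    (hb : b' ∘ₗ b = LinearMap.id) : NatL f a' b' := by
  unfold NatR at h
  unfold NatL
  calc b' ∘ₗ f.rTensor Z = b' ∘ₗ (f.rTensor Z ∘ₗ a) ∘ₗ a' := by
        rw [LinearMap.comp_assoc, ha, LinearMap.comp_id]
    _ = (b' ∘ₗ b) ∘ₗ f.lTensor Z ∘ₗ a' := by rw [← h]; rfl
    _ = _ := by rw [hb, LinearMap.id_comp]

theorem braidLeft_comp_braidRight {a : X ⊗[k] Z →ₗ[k] Z ⊗[k] X} {b : Y ⊗[k] Z →ₗ[k] Z ⊗[k] Y}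
    {a' : Z ⊗[k] X →ₗ[k] X ⊗[k] Z} {b' : Z ⊗[k] Y →ₗ[k] Y ⊗[k] Z}
    (ha : a ∘ₗ a' = LinearMap.id) (hb : b ∘ₗ b' = LinearMap.id) :
    braidLeft a b ∘ₗ braidRight a' b' = LinearMap.id := by
  have ha' : a.rTensor Y ∘ₗ a'.rTensor Y = LinearMap.id := by
    rw [← LinearMap.rTensor_comp, ha, LinearMap.rTensor_id]
  have hb' : b.lTensor X ∘ₗ b'.lTensor X = LinearMap.id := by
    rw [← LinearMap.lTensor_comp, hb, LinearMap.lTensor_id]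
  refine LinearMap.ext fun t ↦ ?_
  have ha'' (t) := LinearMap.congr_fun ha' t
  have hb'' (t) := LinearMap.congr_fun hb' t
  simp only [LinearMap.comp_apply, LinearMap.id_apply] at ha'' hb''
  simp [braidLeft, braidRight, ha'', hb'']

theorem braidRight_comp_braidLeft {a : X ⊗[k] Z →ₗ[k] Z ⊗[k] X} {b : Y ⊗[k] Z →ₗ[k] Z ⊗[k] Y}
    {a' : Z ⊗[k] X →ₗ[k] X ⊗[k] Z} {b' : Z ⊗[k] Y →ₗ[k] Y ⊗[k] Z}
    (ha : a' ∘ₗ a = LinearMap.id) (hb : b' ∘ₗ b = LinearMap.id) :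
    braidRight a' b' ∘ₗ braidLeft a b = LinearMap.id := by
  have ha' : a'.rTensor Y ∘ₗ a.rTensor Y = LinearMap.id := by
    rw [← LinearMap.rTensor_comp, ha, LinearMap.rTensor_id]
  have hb' : b'.lTensor X ∘ₗ b.lTensor X = LinearMap.id := by
    rw [← LinearMap.lTensor_comp, hb, LinearMap.lTensor_id]
  refine LinearMap.ext fun t ↦ ?_
  have ha'' (t) := LinearMap.congr_fun ha' t
  have hb'' (t) := LinearMap.congr_fun hb' t
  simp only [LinearMap.comp_apply, LinearMap.id_apply] at ha'' hb''
  simp [braidLeft, braidRight, ha'', hb'']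

/-- The braidings of two factors past `Z` combine to an invertible braiding. -/
def braidLeftEquiv (a : X ⊗[k] Z ≃ₗ[k] Z ⊗[k] X) (b : Y ⊗[k] Z ≃ₗ[k] Z ⊗[k] Y) :
    (X ⊗[k] Y) ⊗[k] Z ≃ₗ[k] Z ⊗[k] (X ⊗[k] Y) :=
  LinearEquiv.ofLinearMap (braidLeft a.toLinearMap b.toLinearMap)
    (braidRight a.symm.toLinearMap b.symm.toLinearMap)
    (braidLeft_comp_braidRight a.comp_symm b.comp_symm)
    (braidRight_comp_braidLeft a.symm_comp b.symm_comp)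

/-- The braid relation says that one of its crossings is natural with respect to the third object.
In this form, or the mirror image below, braid relations can be treated like any other naturality
statement. -/
theorem braidRelation_iff_natL {a : X ⊗[k] Y →ₗ[k] Y ⊗[k] X} {b : X ⊗[k] Z →ₗ[k] Z ⊗[k] X}
    {c : Y ⊗[k] Z →ₗ[k] Z ⊗[k] Y} :
    BraidRelation a b c ↔ NatL a (braidLeft b c) (braidLeft c b) := Iff.rfl

theorem braidRelation_iff_natR {a : X ⊗[k] Y →ₗ[k] Y ⊗[k] X} {b : X ⊗[k] Z →ₗ[k] Z ⊗[k] X}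
    {c : Y ⊗[k] Z →ₗ[k] Z ⊗[k] Y} :
    BraidRelation a b c ↔ NatR c (braidRight a b) (braidRight b a) := by
  unfold BraidRelation NatR braidLeft braidRight
  constructor
  · intro h
    refine LinearMap.ext fun t ↦ ?_
    obtain ⟨t, rfl⟩ := (TensorProduct.assoc k X Y Z).surjective t
    have := LinearMap.congr_fun h t
    simp only [LinearMap.comp_apply, LinearEquiv.coe_coe, LinearEquiv.symm_apply_apply] at this ⊢
    rw [← this, LinearEquiv.symm_apply_apply]
  · intro h
    refine LinearMap.ext fun t ↦ ?_
    obtain ⟨t, rfl⟩ := (TensorProduct.assoc k X Y Z).symm.surjective t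
    have := LinearMap.congr_fun h t
    simp only [LinearMap.comp_apply, LinearEquiv.coe_coe, LinearEquiv.apply_symm_apply] at this ⊢
    rw [← this, LinearEquiv.apply_symm_apply]

/-- Cancel `a` at both ends of the relation. The objects `X` and `Y` trade places, and with them `b`
and `c`. Relations that mix crossings and inverse crossings arise this way. -/
theorem BraidRelation.symm_left {a : X ⊗[k] Y ≃ₗ[k] Y ⊗[k] X} {b : X ⊗[k] Z →ₗ[k] Z ⊗[k] X}
    {c : Y ⊗[k] Z →ₗ[k] Z ⊗[k] Y} (h : BraidRelation a.toLinearMap b c) :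
    BraidRelation a.symm.toLinearMap c b := by
  unfold BraidRelation at *
  calc braidLeft b c ∘ₗ a.symm.toLinearMap.rTensor Z
      = (a.symm.toLinearMap ∘ₗ a.toLinearMap).lTensor Z ∘ₗ braidLeft b c ∘ₗ
          a.symm.toLinearMap.rTensor Z := by simp
    _ = a.symm.toLinearMap.lTensor Z ∘ₗ (a.toLinearMap.lTensor Z ∘ₗ braidLeft b c) ∘ₗ
          a.symm.toLinearMap.rTensor Z := by rw [LinearMap.lTensor_comp]; rfl
    _ = a.symm.toLinearMap.lTensor Z ∘ₗ braidLeft c b ∘ₗ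
          (a.toLinearMap ∘ₗ a.symm.toLinearMap).rTensor Z := by
        rw [← h, LinearMap.rTensor_comp]; rfl
    _ = _ := by simp

theorem BraidRelation.symm_right {a : X ⊗[k] Y →ₗ[k] Y ⊗[k] X} {b : X ⊗[k] Z →ₗ[k] Z ⊗[k] X}
    {c : Y ⊗[k] Z ≃ₗ[k] Z ⊗[k] Y} (h : BraidRelation a b c.toLinearMap) :
    BraidRelation b a c.symm.toLinearMap := by
  rw [braidRelation_iff_natR] at *
  unfold NatR at *
  calc braidRight a b ∘ₗ c.symm.toLinearMap.lTensor X
      = (c.symm.toLinearMap ∘ₗ c.toLinearMap).rTensor X ∘ₗ braidRight a b ∘ₗ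
          c.symm.toLinearMap.lTensor X := by simp
    _ = c.symm.toLinearMap.rTensor X ∘ₗ (c.toLinearMap.rTensor X ∘ₗ braidRight a b) ∘ₗ
          c.symm.toLinearMap.lTensor X := by rw [LinearMap.rTensor_comp]; rfl
    _ = c.symm.toLinearMap.rTensor X ∘ₗ braidRight b a ∘ₗ
          (c.toLinearMap ∘ₗ c.symm.toLinearMap).lTensor X := by
        rw [← h, LinearMap.lTensor_comp]; rfl
    _ = _ := by simp

end Naturality

/-! ### Braided tensor products of products -/

section BraidedProducts

variable {k : Type u} [Field k]
  {X Y Z W : Type*} [AddCommGroup X] [Module k X] [AddCommGroup Y] [Module k Y]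
  [AddCommGroup Z] [Module k Z] [AddCommGroup W] [Module k W]

/-- The product of the braided tensor product of two (bilinear) products. -/
def bmul (mX : X ⊗[k] X →ₗ[k] X) (mY : Y ⊗[k] Y →ₗ[k] Y) (ΨYX : Y ⊗[k] X →ₗ[k] X ⊗[k] Y) :
    (X ⊗[k] Y) ⊗[k] (X ⊗[k] Y) →ₗ[k] X ⊗[k] Y :=
  TensorProduct.map mX mY ∘ₗ
    (TensorProduct.assoc k X X (Y ⊗[k] Y)).symm.toLinearMap ∘ₗ
    LinearMap.lTensor X ((TensorProduct.assoc k X Y Y).toLinearMap ∘ₗ ΨYX.rTensor Y ∘ₗ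
      (TensorProduct.assoc k Y X Y).symm.toLinearMap) ∘ₗ
    (TensorProduct.assoc k X Y (X ⊗[k] Y)).toLinearMap

/-- Multiplication by `x` from the left and by `y` from the right. -/
def sandwich (mX : X ⊗[k] X →ₗ[k] X) (mY : Y ⊗[k] Y →ₗ[k] Y) (x : X) (y : Y) :
    X ⊗[k] Y →ₗ[k] X ⊗[k] Y :=
  TensorProduct.map (mX ∘ₗ TensorProduct.mk k X X x) (mY ∘ₗ (TensorProduct.mk k Y Y).flip y)

@[simp]
theorem sandwich_tmul (mX : X ⊗[k] X →ₗ[k] X) (mY : Y ⊗[k] Y →ₗ[k] Y) (x x' : X) (y y' : Y) :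
    sandwich mX mY x y (x' ⊗ₜ y') = mX (x ⊗ₜ x') ⊗ₜ mY (y' ⊗ₜ y) := rfl

theorem bmul_tmul (mX : X ⊗[k] X →ₗ[k] X) (mY : Y ⊗[k] Y →ₗ[k] Y)
    (Ψ : Y ⊗[k] X →ₗ[k] X ⊗[k] Y) (x x' : X) (y y' : Y) :
    bmul mX mY Ψ ((x ⊗ₜ y) ⊗ₜ (x' ⊗ₜ y')) = sandwich mX mY x y' (Ψ (y ⊗ₜ x')) := by
  simp only [bmul, LinearMap.comp_apply, LinearEquiv.coe_coe, TensorProduct.assoc_tmul,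
    LinearMap.lTensor_tmul, TensorProduct.assoc_symm_tmul, LinearMap.rTensor_tmul]
  generalize Ψ (y ⊗ₜ x') = t
  induction t with
  | zero => simp
  | add s t hs ht => simp only [map_add, TensorProduct.add_tmul, TensorProduct.tmul_add, hs, ht]
  | tmul x y => simp

/-- Both bracketings involve the same three crossings: `y₁` past `x₂`, `y₂` past `x₃`, and what is
left of `y₁` past what is left of `x₃`. On the left, functoriality in `mY` splits off the third one;
on the right, functoriality in `mX` does. -/
theorem bmul_assoc {mX : X ⊗[k] X →ₗ[k] X} {mY : Y ⊗[k] Y →ₗ[k] Y}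
    {Ψ : Y ⊗[k] X →ₗ[k] X ⊗[k] Y}
    (hX : ∀ a b c, mX (mX (a ⊗ₜ b) ⊗ₜ c) = mX (a ⊗ₜ mX (b ⊗ₜ c)))
    (hY : ∀ a b c, mY (mY (a ⊗ₜ b) ⊗ₜ c) = mY (a ⊗ₜ mY (b ⊗ₜ c)))
    (hl : NatL mY (braidLeft Ψ Ψ) Ψ) (hr : NatR mX (braidRight Ψ Ψ) Ψ) (s t r : X ⊗[k] Y) :
    bmul mX mY Ψ (bmul mX mY Ψ (s ⊗ₜ t) ⊗ₜ r) = bmul mX mY Ψ (s ⊗ₜ bmul mX mY Ψ (t ⊗ₜ r)) := by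
  induction s with
  | zero => simp
  | add s s' h h' => simp only [TensorProduct.add_tmul, map_add, h, h']
  | tmul x₁ y₁ =>
    induction t with
    | zero => simp
    | add s s' h h' => simp only [TensorProduct.add_tmul, TensorProduct.tmul_add, map_add, h, h']
    | tmul x₂ y₂ =>
      induction r with
      | zero => simp
      | add s s' h h' =>
        simp only [TensorProduct.tmul_add, map_add, h, h']
      | tmul x₃ y₃ =>
        rw [bmul_tmul, bmul_tmul]
        obtain ⟨S, hS⟩ := TensorProduct.exists_finset (Ψ (y₁ ⊗ₜ x₂))
        rw [hS]
        simp only [map_sum, sandwich_tmul, TensorProduct.sum_tmul, bmul_tmul, hl.apply,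
          braidLeft_tmul]
        generalize Ψ (y₂ ⊗ₜ x₃) = q
        induction q with
        | zero => simp
        | add s t hs ht =>
          simp only [map_add, TensorProduct.tmul_add, Finset.sum_add_distrib, hs, ht]
        | tmul x y =>
          rw [sandwich_tmul, bmul_tmul, hr.apply, braidRight_tmul, hS]
          simp only [map_sum]
          refine Finset.sum_congr rfl fun i _ ↦ ?_
          rw [passLeft_tmul, passRight_tmul]
          generalize Ψ (i.2 ⊗ₜ x) = p
          induction p with
          | zero => simp
          | add s t hs ht =>
            simp only [map_add, TensorProduct.tmul_add, TensorProduct.add_tmul, hs, ht]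
          | tmul x y => simp [hX, hY]

/-- The braided product is built from rebracketings, the crossing `Ψ` and the two products. Each
slides past `Z`, the crossing by the braid relation. -/
theorem NatL.bmul {mX : X ⊗[k] X →ₗ[k] X} {mY : Y ⊗[k] Y →ₗ[k] Y}
    {Ψ : Y ⊗[k] X →ₗ[k] X ⊗[k] Y} {a : X ⊗[k] Z →ₗ[k] Z ⊗[k] X} {b : Y ⊗[k] Z →ₗ[k] Z ⊗[k] Y}
    (hX : NatL mX (braidLeft a a) a) (hY : NatL mY (braidLeft b b) b)
    (hΨ : BraidRelation Ψ b a) :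
    NatL (bmul mX mY Ψ) (braidLeft (braidLeft a b) (braidLeft a b)) (braidLeft a b) := by
  refine (hX.map hY).comp ((natL_assoc_symm a a (braidLeft b b)).comp
    (NatL.comp (b := braidLeft a (braidLeft b (braidLeft a b))) ?_
      (natL_assoc a b (braidLeft a b))))
  exact (natL_id a).map ((natL_assoc a b b).comp
    (NatL.comp (NatL.map hΨ (natL_id b)) (natL_assoc_symm b a b)))

/-- The braided tensor product of multiplicative maps is multiplicative. -/
theorem map_bmul {X' Y' : Type*} [AddCommGroup X'] [Module k X'] [AddCommGroup Y'] [Module k Y']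
    {mX : X ⊗[k] X →ₗ[k] X} {mY : Y ⊗[k] Y →ₗ[k] Y} {Ψ : Y ⊗[k] X →ₗ[k] X ⊗[k] Y}
    {mX' : X' ⊗[k] X' →ₗ[k] X'} {mY' : Y' ⊗[k] Y' →ₗ[k] Y'} {Ψ' : Y' ⊗[k] X' →ₗ[k] X' ⊗[k] Y'}
    {f : X →ₗ[k] X'} {g : Y →ₗ[k] Y'} (hf : f ∘ₗ mX = mX' ∘ₗ TensorProduct.map f f)
    (hg : g ∘ₗ mY = mY' ∘ₗ TensorProduct.map g g)
    (h : Ψ' ∘ₗ TensorProduct.map g f = TensorProduct.map f g ∘ₗ Ψ) :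
    TensorProduct.map f g ∘ₗ bmul mX mY Ψ =
      bmul mX' mY' Ψ' ∘ₗ TensorProduct.map (TensorProduct.map f g) (TensorProduct.map f g) := by
  have hf' (a b) : f (mX (a ⊗ₜ b)) = mX' (f a ⊗ₜ f b) := LinearMap.congr_fun hf (a ⊗ₜ b)
  have hg' (a b) : g (mY (a ⊗ₜ b)) = mY' (g a ⊗ₜ g b) := LinearMap.congr_fun hg (a ⊗ₜ b)
  have h' (a b) : Ψ' (g a ⊗ₜ f b) = TensorProduct.map f g (Ψ (a ⊗ₜ b)) :=
    LinearMap.congr_fun h (a ⊗ₜ b)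
  refine TensorProduct.ext (TensorProduct.ext' fun x y ↦ TensorProduct.ext' fun x' y' ↦ ?_)
  simp only [LinearMap.compr₂ₛₗ_apply, TensorProduct.mk_apply, LinearMap.comp_apply,
    TensorProduct.map_tmul, bmul_tmul, h']
  generalize Ψ (y ⊗ₜ x') = t
  induction t with
  | zero => simp
  | add s t hs ht => simp only [map_add, hs, ht]
  | tmul x y => simp [hf', hg']

/-- In both bracketings `z` first crosses `x'`; the two remaining crossings use disjoint strands and
may be performed in either order. This gives the threefold product in which coassociativity is
checked. -/
theorem assoc_bmul (m₁ : X ⊗[k] X →ₗ[k] X) (m₂ : Y ⊗[k] Y →ₗ[k] Y) (m₃ : Z ⊗[k] Z →ₗ[k] Z)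
    (Ψ₂₁ : Y ⊗[k] X →ₗ[k] X ⊗[k] Y) (Ψ₃₁ : Z ⊗[k] X →ₗ[k] X ⊗[k] Z)
    (Ψ₃₂ : Z ⊗[k] Y →ₗ[k] Y ⊗[k] Z) :
    (TensorProduct.assoc k X Y Z).toLinearMap ∘ₗ bmul (bmul m₁ m₂ Ψ₂₁) m₃ (braidRight Ψ₃₁ Ψ₃₂) =
      bmul m₁ (bmul m₂ m₃ Ψ₃₂) (braidLeft Ψ₂₁ Ψ₃₁) ∘ₗ
        TensorProduct.map (TensorProduct.assoc k X Y Z).toLinearMap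
          (TensorProduct.assoc k X Y Z).toLinearMap := by
  refine TensorProduct.ext (TensorProduct.ext_threefold fun x y z ↦
    TensorProduct.ext_threefold fun x' y' z' ↦ ?_)
  simp only [LinearMap.compr₂ₛₗ_apply, TensorProduct.mk_apply, LinearMap.comp_apply,
    TensorProduct.map_tmul, bmul_tmul, LinearEquiv.coe_coe, TensorProduct.assoc_tmul,
    braidLeft_tmul, braidRight_tmul]
  generalize Ψ₃₁ (z ⊗ₜ x') = t
  induction t with
  | zero => simp
  | add s t hs ht => simp only [map_add, hs, ht]
  | tmul x₁ z₁ =>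
    rw [passRight_tmul, passLeft_tmul]
    obtain ⟨S, hS⟩ := TensorProduct.exists_finset (Ψ₂₁ (y ⊗ₜ x₁))
    obtain ⟨T, hT⟩ := TensorProduct.exists_finset (Ψ₃₂ (z₁ ⊗ₜ y'))
    rw [hS, hT]
    simp only [TensorProduct.tmul_sum, TensorProduct.sum_tmul, map_sum,
      TensorProduct.assoc_symm_tmul, TensorProduct.assoc_tmul, sandwich_tmul, bmul_tmul, hS, hT]
    rw [Finset.sum_comm]

end BraidedProducts

/-! ### Braidings compatible with a product and a coaction -/

section Movers

variable {k : Type u} [Field k] {ι : Type*} [Fintype ι]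
  {V X Y M B : Type*} [AddCommGroup V] [Module k V] [AddCommGroup X] [Module k X]
  [AddCommGroup Y] [Module k Y] [AddCommGroup M] [Module k M] [AddCommGroup B] [Module k B]

/-- A braiding `B ⊗ X → X ⊗ B` compatible with a product on `B` and with a comeasuring
`V → V ⊗ B`, where `V` is braided past `X` by `λV`. -/
structure Mover (mB : B ⊗[k] B →ₗ[k] B) (βB : V →ₗ[k] V ⊗[k] B)
    (lV : V ⊗[k] X →ₗ[k] X ⊗[k] V) (lB : B ⊗[k] X →ₗ[k] X ⊗[k] B) : Prop where
  mul : NatL mB (braidLeft lB lB) lB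
  coact : NatL βB lV (braidLeft lV lB)

/-- Closure under tensor products matters because a crossing `X ⊗ Y → Y ⊗ X` is then itself a map
between objects past which `B` can be braided. -/
theorem Mover.braidRight {mB : B ⊗[k] B →ₗ[k] B} {βB : V →ₗ[k] V ⊗[k] B}
    {lV : V ⊗[k] X →ₗ[k] X ⊗[k] V} {lB : B ⊗[k] X →ₗ[k] X ⊗[k] B}
    {lV' : V ⊗[k] Y →ₗ[k] Y ⊗[k] V} {lB' : B ⊗[k] Y →ₗ[k] Y ⊗[k] B}
    (h : Mover mB βB lV lB) (h' : Mover mB βB lV' lB') :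
    Mover mB βB (braidRight lV lV') (braidRight lB lB') where
  mul := by
    rw [braidLeft_braidRight]
    exact h.mul.braidRight h'.mul
  coact := by
    rw [braidLeft_braidRight]
    exact h.coact.braidRight h'.coact

theorem sum_basis_tmul_injective (e : Module.Basis ι k V) {y y' : ι → Y}
    (h : ∑ a, e a ⊗ₜ[k] y a = ∑ a, e a ⊗ₜ[k] y' a) : y = y' := by
  classical
  funext b
  have := congrArg (fun t ↦ TensorProduct.lid k Y ((e.coord b).rTensor Y t)) h
  simpa [Finsupp.single_apply, ite_smul] using this

theorem passLeft_injective {a : X ⊗[k] Y →ₗ[k] Y ⊗[k] X} (ha : Function.Injective a) :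
    Function.Injective ((TensorProduct.assoc k Y X B).toLinearMap ∘ₗ a.rTensor B ∘ₗ
      (TensorProduct.assoc k X Y B).symm.toLinearMap) :=
  (TensorProduct.assoc k Y X B).injective.comp
    ((Module.Flat.rTensor_preserves_injective_linearMap a ha).comp
      (TensorProduct.assoc k X Y B).symm.injective)

/-- Compatibility of a multiplicative map with the braidings holds on the generators `u`. -/
theorem mover_natural_gen {βM : V →ₗ[k] V ⊗[k] M} {βB : V →ₗ[k] V ⊗[k] B}
    {lVX : V ⊗[k] X →ₗ[k] X ⊗[k] V} {lMX : M ⊗[k] X →ₗ[k] X ⊗[k] M}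
    {lVY : V ⊗[k] Y →ₗ[k] Y ⊗[k] V} {lBY : B ⊗[k] Y →ₗ[k] Y ⊗[k] B}
    (hM : NatL βM lVX (braidLeft lVX lMX)) (hB : NatL βB lVY (braidLeft lVY lBY))
    (hinj : Function.Injective lVY) {π : M →ₗ[k] B} (hπ : βB = π.lTensor V ∘ₗ βM)
    {f : X →ₗ[k] Y} (hf : NatR f lVX lVY) (e : Module.Basis ι k V) {u : ι → ι → M}
    (hu : ∀ j, βM (e j) = ∑ a, e a ⊗ₜ u a j) (a j : ι) (x : X) :
    lBY (π (u a j) ⊗ₜ f x) = TensorProduct.map f π (lMX (u a j ⊗ₜ x)) := by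
  -- Comparing coefficients of the basis and braiding it past `Y` loses nothing, as `lVY` is
  -- injective. The claim becomes an identity between the full braidings of `V ⊗ B`, which
  -- naturality of both coactions provides.
  refine congrFun (sum_basis_tmul_injective e (y := fun a ↦ lBY (π (u a j) ⊗ₜ f x))
    (y' := fun a ↦ TensorProduct.map f π (lMX (u a j ⊗ₜ x)))
    (passLeft_injective (B := B) hinj ?_)) a
  have h₁ := hB.apply (e j) (f x)
  have h₂ := hM.apply (e j) x
  rw [hπ, LinearMap.comp_apply, hu, hf.apply, LinearMap.lTensor_comp, LinearMap.comp_apply] at h₁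
  have h₃ : ((π.lTensor V).lTensor Y) ((βM.lTensor Y) (f.rTensor V (lVX (e j ⊗ₜ x)))) =
      TensorProduct.map f (π.lTensor V) ((βM.lTensor X) (lVX (e j ⊗ₜ x))) := by
    generalize lVX (e j ⊗ₜ x) = t
    induction t with
    | zero => simp
    | add s t hs ht => simp only [map_add, hs, ht]
    | tmul x v => simp
  rw [h₃, ← h₂, hu] at h₁
  simp only [map_sum, LinearMap.lTensor_tmul, TensorProduct.sum_tmul, braidLeft_tmul] at h₁
  have h₄ (a : ι) (t : X ⊗[k] M) : passLeft lVY B (e a) (TensorProduct.map f π t) =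
      TensorProduct.map f (π.lTensor V) (passLeft lVX M (e a) t) := by
    induction t with
    | zero => simp
    | add s t hs ht => simp only [map_add, hs, ht]
    | tmul x m =>
      rw [TensorProduct.map_tmul, passLeft_tmul, passLeft_tmul, hf.apply]
      generalize lVX (e a ⊗ₜ x) = t
      induction t with
      | zero => simp
      | add s t hs ht => simp only [map_add, TensorProduct.add_tmul, hs, ht]
      | tmul x m => simp
  simp only [← h₄] at h₁
  rw [map_sum, map_sum]
  exact h₁

/-- Compatibility of a multiplicative map with the braidings passes to products. -/
theorem mover_natural_mul {mM : M ⊗[k] M →ₗ[k] M} {mB : B ⊗[k] B →ₗ[k] B}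
    {lMX : M ⊗[k] X →ₗ[k] X ⊗[k] M} {lBY : B ⊗[k] Y →ₗ[k] Y ⊗[k] B}
    (hM : NatL mM (braidLeft lMX lMX) lMX) (hB : NatL mB (braidLeft lBY lBY) lBY)
    {π : M →ₗ[k] B} (hπ : ∀ a b, π (mM (a ⊗ₜ b)) = mB (π a ⊗ₜ π b)) {f : X →ₗ[k] Y} {a b : M}
    (ha : ∀ x, lBY (π a ⊗ₜ f x) = TensorProduct.map f π (lMX (a ⊗ₜ x)))
    (hb : ∀ x, lBY (π b ⊗ₜ f x) = TensorProduct.map f π (lMX (b ⊗ₜ x))) (x : X) :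
    lBY (π (mM (a ⊗ₜ b)) ⊗ₜ f x) = TensorProduct.map f π (lMX (mM (a ⊗ₜ b) ⊗ₜ x)) := by
  rw [hπ, hM.apply, hB.apply, braidLeft_tmul, braidLeft_tmul, hb]
  generalize lMX (b ⊗ₜ x) = t
  induction t with
  | zero => simp
  | add s t hs ht => simp only [map_add, hs, ht]
  | tmul x b =>
    rw [TensorProduct.map_tmul, passLeft_tmul, passLeft_tmul, ha]
    generalize lMX (a ⊗ₜ x) = t
    induction t with
    | zero => simp
    | add s t hs ht => simp only [map_add, TensorProduct.add_tmul, hs, ht]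
    | tmul x a => simp [hπ]

/-- A braiding of `B` past `X` is inverted on generators by a braiding of `X` past `B`. -/
theorem mover_inverse_gen {βB : V →ₗ[k] V ⊗[k] B} {lV : V ⊗[k] X ≃ₗ[k] X ⊗[k] V}
    {l : B ⊗[k] X →ₗ[k] X ⊗[k] B} {h : X ⊗[k] B →ₗ[k] B ⊗[k] X}
    (hl : NatL βB lV.toLinearMap (braidLeft lV.toLinearMap l))
    (hr : NatR βB lV.symm.toLinearMap (braidRight lV.symm.toLinearMap h))
    (e : Module.Basis ι k V) {u : ι → ι → B} (hu : ∀ j, βB (e j) = ∑ a, e a ⊗ₜ u a j)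
    (a j : ι) (x : X) : h (l (u a j ⊗ₜ x)) = u a j ⊗ₜ x := by
  refine congrFun (sum_basis_tmul_injective e (y := fun a ↦ h (l (u a j ⊗ₜ x)))
    (y' := fun a ↦ u a j ⊗ₜ x) ?_) a
  have h₁ := hr.apply' (lV (e j ⊗ₜ x))
  have h₂ := hl.apply (e j) x
  simp only [LinearEquiv.coe_coe, LinearEquiv.symm_apply_apply] at h₁ h₂
  rw [← h₂, LinearMap.rTensor_tmul, hu] at h₁
  -- The crossing of `v` past `X` and its inverse meet and cancel, leaving `h` alone on the second
  -- factor.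
  have h₃ (v : V) (t : X ⊗[k] B) :
      TensorProduct.assoc k V B X (BraidedComeas.braidRight lV.symm.toLinearMap h
        (passLeft lV.toLinearMap B v t)) = v ⊗ₜ h t := by
    induction t with
    | zero => simp
    | add s t hs ht => simp only [map_add, TensorProduct.tmul_add, hs, ht]
    | tmul x b =>
      rw [passLeft_tmul]
      have h₄ (s : X ⊗[k] V) : BraidedComeas.braidRight lV.symm.toLinearMap h
          (TensorProduct.assoc k X V B (s ⊗ₜ b)) = passRight h V b (lV.symm s) := by
        induction s with
        | zero => simp
        | add s t hs ht => simp only [map_add, TensorProduct.add_tmul, hs, ht]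
        | tmul x v => rfl
      rw [h₄, LinearEquiv.coe_coe, LinearEquiv.symm_apply_apply, passRight_tmul,
        LinearEquiv.apply_symm_apply]
  simpa [TensorProduct.sum_tmul, braidLeft_tmul, h₃] using congrArg (TensorProduct.assoc k V B X) h₁

/-- The crossings cancel from the inside out: `l` moves `b` and then `a`, while `h` undoes `a` first
and then `b`. -/
theorem mover_inverse_mul {mB : B ⊗[k] B →ₗ[k] B} {l : B ⊗[k] X →ₗ[k] X ⊗[k] B}
    {h : X ⊗[k] B →ₗ[k] B ⊗[k] X} (hl : NatL mB (braidLeft l l) l)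
    (hr : NatR mB (braidRight h h) h) {a b : B} (ha : ∀ x, h (l (a ⊗ₜ x)) = a ⊗ₜ x)
    (hb : ∀ x, h (l (b ⊗ₜ x)) = b ⊗ₜ x) (x : X) :
    h (l (mB (a ⊗ₜ b) ⊗ₜ x)) = mB (a ⊗ₜ b) ⊗ₜ x := by
  have key (t : X ⊗[k] B) : h (mB.lTensor X (passLeft l B a t)) =
      mB.rTensor X ((TensorProduct.assoc k B B X).symm (a ⊗ₜ h t)) := by
    induction t with
    | zero => simp
    | add s t hs ht => simp only [map_add, TensorProduct.tmul_add, hs, ht]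
    | tmul x b =>
      rw [hr.apply', passLeft_tmul]
      have (s : X ⊗[k] B) : BraidedComeas.braidRight h h (TensorProduct.assoc k X B B (s ⊗ₜ b)) =
          passRight h B b (h s) := by
        induction s with
        | zero => simp
        | add s t hs ht => simp only [map_add, TensorProduct.add_tmul, hs, ht]
        | tmul x v => rfl
      rw [this, ha, passRight_tmul]
  rw [hl.apply, braidLeft_tmul, key, hb]
  simp

end Movers

/-! ### Matrices acting in one tensor leg -/

section Legs

variable {ι : Type*} [Fintype ι] [DecidableEq ι] {W : Type*} [Ring W]

/-- A matrix acting in the first tensor factor. -/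
def leg₁ (Q : Matrix ι ι W) : Matrix (ι × ι) (ι × ι) W :=
  Matrix.of fun p q ↦ if p.2 = q.2 then Q p.1 q.1 else 0

/-- A matrix acting in the second tensor factor. -/
def leg₂ (Q : Matrix ι ι W) : Matrix (ι × ι) (ι × ι) W :=
  Matrix.of fun p q ↦ if p.1 = q.1 then Q p.2 q.2 else 0

theorem leg₁_mul (P Q : Matrix ι ι W) : leg₁ (P * Q) = leg₁ P * leg₁ Q := by
  ext ⟨a, b⟩ ⟨c, d⟩
  simp [leg₁, Matrix.mul_apply, Fintype.sum_prod_type]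

theorem leg₂_mul (P Q : Matrix ι ι W) : leg₂ (P * Q) = leg₂ P * leg₂ Q := by
  ext ⟨a, b⟩ ⟨c, d⟩
  simp [leg₂, Matrix.mul_apply, Fintype.sum_prod_type]

theorem leg₁_one : leg₁ (1 : Matrix ι ι W) = 1 := by
  ext ⟨a, b⟩ ⟨c, d⟩
  simp only [leg₁, Matrix.of_apply, Matrix.one_apply, Prod.mk.injEq]
  split_ifs <;> simp_all

theorem leg₂_one : leg₂ (1 : Matrix ι ι W) = 1 := by
  ext ⟨a, b⟩ ⟨c, d⟩
  simp only [leg₂, Matrix.of_apply, Matrix.one_apply, Prod.mk.injEq]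
  split_ifs <;> simp_all

theorem leg₁_mul_leg₂_apply (P Q : Matrix ι ι W) (a b c d : ι) :
    (leg₁ P * leg₂ Q) (a, b) (c, d) = P a c * Q b d := by
  simp [leg₁, leg₂, Matrix.mul_apply, Fintype.sum_prod_type]

theorem leg₂_mul_leg₁_apply (P Q : Matrix ι ι W) (a b c d : ι) :
    (leg₂ P * leg₁ Q) (a, b) (c, d) = P b d * Q a c := by
  simp [leg₁, leg₂, Matrix.mul_apply, Fintype.sum_prod_type]

theorem leg₁_commute_leg₂ {P Q : Matrix ι ι W} (h : ∀ a b c d, Commute (P a b) (Q c d)) :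
    Commute (leg₁ P) (leg₂ Q) := by
  ext ⟨a, b⟩ ⟨c, d⟩
  rw [leg₁_mul_leg₂_apply, leg₂_mul_leg₁_apply, (h _ _ _ _).eq]

end Legs

/-! ### Matrix solutions of the defining relations -/

section Solutions

variable {k : Type u} [Field k] {ι : Type x} [Fintype ι] [DecidableEq ι]
  {A : Type v} [NonUnitalRing A] [Module k A]
  [IsScalarTower k A A] [SMulCommClass k A A] {W : Type*} [Ring W] [Algebra k W]

/-- A matrix over `W` whose entries satisfy the defining relations of `M₁`. -/
def IsSolution (e : Module.Basis ι k A) (R : Matrix (ι × ι) (ι × ι) k) (w : Matrix ι ι W) :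
    Prop :=
  ∀ i j l, ∑ a, structConst e i j a • w l a =
    ∑ a, ∑ b, ∑ c, ∑ d, ∑ p, ∑ f,
      (structConst e a b l * R⁻¹ (a, b) (c, d) * R (p, d) (i, f)) • (w c p * w f j)

/-- The structure constants as a matrix with entries in `W`. -/
def structMatrix (W : Type*) [Ring W] [Algebra k W] (e : Module.Basis ι k A) :
    Matrix ι (ι × ι) W :=
  Matrix.of fun l p ↦ algebraMap k W (structConst e p.1 p.2 l)

theorem inv_leg₁_map_leg₂_apply (R : Matrix (ι × ι) (ι × ι) k) (w' w : Matrix ι ι W)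
    (a b i j : ι) :
    (R⁻¹.map (algebraMap k W) * leg₁ w' * R.map (algebraMap k W) * leg₂ w) (a, b) (i, j) =
      ∑ c, ∑ d, ∑ p, ∑ f, (R⁻¹ (a, b) (c, d) * R (p, d) (i, f)) • (w' c p * w f j) := by
  have h (a b p d : ι) : (R⁻¹.map (algebraMap k W) * leg₁ w') (a, b) (p, d) =
      ∑ c, algebraMap k W (R⁻¹ (a, b) (c, d)) * w' c p := by
    simp [Matrix.mul_apply, leg₁, Fintype.sum_prod_type]
  rw [Matrix.mul_apply, Fintype.sum_prod_type]
  simp only [leg₂, Matrix.of_apply, mul_ite, mul_zero]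
  rw [Finset.sum_comm]
  simp only [Finset.sum_ite_eq', Finset.mem_univ, if_true]
  simp only [Matrix.mul_apply (M := _ * leg₁ w'), Fintype.sum_prod_type, h, Matrix.map_apply,
    Finset.sum_mul]
  rw [Finset.sum_congr rfl fun f _ ↦ (Finset.sum_comm.trans (Finset.sum_congr rfl fun d _ ↦
    Finset.sum_comm)).trans Finset.sum_comm]
  rw [Finset.sum_comm]
  refine Finset.sum_congr rfl fun c _ ↦ ?_
  rw [Finset.sum_comm]
  refine Finset.sum_congr rfl fun d _ ↦ ?_
  rw [Finset.sum_comm]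
  refine Finset.sum_congr rfl fun p _ ↦ Finset.sum_congr rfl fun f _ ↦ ?_
  rw [Algebra.smul_def, map_mul, mul_assoc, mul_assoc, mul_assoc]
  congr 1
  rw [← mul_assoc, ← mul_assoc, Algebra.commutes]

theorem leg₂_inv_leg₁_map_apply (R : Matrix (ι × ι) (ι × ι) k) (w' w : Matrix ι ι W)
    (i h j l : ι) :
    (leg₂ w * (R⁻¹.map (algebraMap k W) * leg₁ w' * R.map (algebraMap k W))) (i, h) (j, l) =
      ∑ a, ∑ b, ∑ c, ∑ d, (R⁻¹ (i, b) (a, d) * R (c, d) (j, l)) • (w h b * w' a c) := by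
  have h₁ (a b p d : ι) : (R⁻¹.map (algebraMap k W) * leg₁ w') (a, b) (p, d) =
      ∑ c, algebraMap k W (R⁻¹ (a, b) (c, d)) * w' c p := by
    simp [Matrix.mul_apply, leg₁, Fintype.sum_prod_type]
  rw [Matrix.mul_apply, Fintype.sum_prod_type]
  simp only [leg₂, Matrix.of_apply, ite_mul, zero_mul]
  rw [Finset.sum_comm]
  simp only [Finset.sum_ite_eq, Finset.mem_univ, if_true]
  simp only [Matrix.mul_apply (M := _ * leg₁ w'), Fintype.sum_prod_type, h₁, Matrix.map_apply,
    Finset.sum_mul, Finset.mul_sum]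
  rw [Finset.sum_congr rfl fun b _ ↦ (Finset.sum_congr rfl fun c _ ↦ Finset.sum_comm).trans
    Finset.sum_comm, Finset.sum_comm]
  refine Finset.sum_congr rfl fun a _ ↦ Finset.sum_congr rfl fun b _ ↦
    Finset.sum_congr rfl fun c _ ↦ Finset.sum_congr rfl fun d _ ↦ ?_
  rw [Algebra.smul_def, map_mul, mul_assoc, ← Algebra.commutes (R (c, d) (j, l)),
    Algebra.left_comm, mul_assoc, Algebra.left_comm (w h b)]

/-- The leg form `w C = C R⁻¹ w₁ R w₂` reduces closure under conjugation and under braided products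
to matrix algebra. -/
theorem isSolution_iff (e : Module.Basis ι k A) (R : Matrix (ι × ι) (ι × ι) k)
    (w : Matrix ι ι W) :
    IsSolution e R w ↔ w * structMatrix W e =
      structMatrix W e * (R⁻¹.map (algebraMap k W) * leg₁ w * R.map (algebraMap k W) * leg₂ w) := by
  have h₁ (l i j : ι) : (w * structMatrix W e) l (i, j) = ∑ a, structConst e i j a • w l a := by
    simp [Matrix.mul_apply, structMatrix, Algebra.smul_def, Algebra.commutes]
  have h₂ (l i j : ι) : (structMatrix W e *
      (R⁻¹.map (algebraMap k W) * leg₁ w * R.map (algebraMap k W) * leg₂ w)) l (i, j) =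
      ∑ a, ∑ b, ∑ c, ∑ d, ∑ p, ∑ f,
      (structConst e a b l * R⁻¹ (a, b) (c, d) * R (p, d) (i, f)) • (w c p * w f j) := by
    rw [Matrix.mul_apply, Fintype.sum_prod_type]
    simp only [inv_leg₁_map_leg₂_apply, structMatrix, Matrix.of_apply, Finset.mul_sum]
    simp only [← Algebra.smul_def, smul_smul, mul_assoc]
  constructor
  · intro h
    ext l ⟨i, j⟩
    rw [h₁, h₂, h]
  · intro h i j l
    rw [← h₁, ← h₂, h]

theorem map_inv_mul_map {R : Matrix (ι × ι) (ι × ι) k} (hR : IsUnit R) :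
    R⁻¹.map (algebraMap k W) * R.map (algebraMap k W) = 1 := by
  rw [← Matrix.map_mul, Matrix.nonsing_inv_mul _ ((Matrix.isUnit_iff_isUnit_det _).1 hR)]
  simp

theorem map_mul_map_inv {R : Matrix (ι × ι) (ι × ι) k} (hR : IsUnit R) :
    R.map (algebraMap k W) * R⁻¹.map (algebraMap k W) = 1 := by
  rw [← Matrix.map_mul, Matrix.mul_nonsing_inv _ ((Matrix.isUnit_iff_isUnit_det _).1 hR)]
  simp

/-- Conjugating a solution by an invertible matrix which commutes with it, satisfies the `RTT`
relations and is compatible with the structure constants gives a solution. -/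
theorem IsSolution.conj {e : Module.Basis ι k A} {R : Matrix (ι × ι) (ι × ι) k} (hR : IsUnit R)
    {w Q P : Matrix ι ι W} (hw : IsSolution e R w) (hPQ : P * Q = 1) (hQP : Q * P = 1)
    (hcomm : ∀ a b c d, Commute (Q a b) (w c d))
    (hRTT : R.map (algebraMap k W) * (leg₁ Q * leg₂ Q) =
      leg₂ Q * leg₁ Q * R.map (algebraMap k W))
    (hQ : Q * structMatrix W e = structMatrix W e * (leg₁ Q * leg₂ Q)) :
    IsSolution e R (P * w * Q) := by
  rw [isSolution_iff] at hw ⊢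
  set C := structMatrix W e
  set r := R.map (algebraMap k W)
  set r' := R⁻¹.map (algebraMap k W)
  have hr'r : r' * r = 1 := map_inv_mul_map hR
  have hrr' : r * r' = 1 := map_mul_map_inv hR
  have hP1 : leg₁ P * leg₁ Q = 1 := by rw [← leg₁_mul, hPQ, leg₁_one]
  have hQ1 : leg₁ Q * leg₁ P = 1 := by rw [← leg₁_mul, hQP, leg₁_one]
  have hP2 : leg₂ P * leg₂ Q = 1 := by rw [← leg₂_mul, hPQ, leg₂_one]
  have hQ2 : leg₂ Q * leg₂ P = 1 := by rw [← leg₂_mul, hQP, leg₂_one]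
  have hc1 : leg₁ Q * leg₂ w = leg₂ w * leg₁ Q := (leg₁_commute_leg₂ hcomm).eq
  have hc2 : leg₂ Q * leg₁ w = leg₁ w * leg₂ Q :=
    (leg₁_commute_leg₂ fun a b c d ↦ (hcomm c d a b).symm).eq.symm
  have hc2' : leg₂ P * leg₁ w = leg₁ w * leg₂ P := by
    calc leg₂ P * leg₁ w = leg₂ P * (leg₁ w * leg₂ Q) * leg₂ P := by
          rw [mul_assoc, mul_assoc, hQ2, mul_one]
      _ = leg₁ w * leg₂ P := by rw [← hc2, ← mul_assoc, hP2, one_mul]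
  have hPC : P * C = C * (leg₂ P * leg₁ P) := by
    have h : C * (leg₁ Q * leg₂ Q * (leg₂ P * leg₁ P)) = C := by
      rw [mul_assoc (leg₁ Q), ← mul_assoc (leg₂ Q), hQ2, one_mul, hQ1, Matrix.mul_one]
    calc P * C = P * (Q * C * (leg₂ P * leg₁ P)) := by rw [hQ, Matrix.mul_assoc, h]
      _ = C * (leg₂ P * leg₁ P) := by
        rw [Matrix.mul_assoc Q, ← Matrix.mul_assoc P, hPQ, Matrix.one_mul]
  -- Both sides are inverse to the common value of the two sides of the `RTT` relation.
  have hPr : leg₂ P * leg₁ P * r' = r' * (leg₁ P * leg₂ P) := by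
    refine left_inv_eq_right_inv (a := leg₂ Q * leg₁ Q * r) ?_ ?_
    · rw [← hRTT]
      simp only [mul_assoc]
      rw [← mul_assoc r', hr'r, one_mul, ← mul_assoc (leg₁ P), hP1, one_mul, hP2]
    · simp only [mul_assoc]
      rw [← mul_assoc r, hrr', one_mul, ← mul_assoc (leg₁ Q), hQ1, one_mul, hQ2]
  -- This is the `RTT` relation with the second leg of `Q` cancelled at both ends. It exchanges `P₂`
  -- and `Q₁` across `R`.
  have h5 : leg₂ P * r * leg₁ Q = leg₁ Q * r * leg₂ P := by
    calc leg₂ P * r * leg₁ Q = leg₂ P * (r * (leg₁ Q * leg₂ Q)) * leg₂ P := by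
          simp only [mul_assoc, hQ2, mul_one]
      _ = _ := by
          rw [hRTT]
          simp only [mul_assoc]
          rw [← mul_assoc (leg₂ P), hP2, one_mul]
  calc P * w * Q * C = P * (w * C) * (leg₁ Q * leg₂ Q) := by
        rw [Matrix.mul_assoc, hQ]; simp only [Matrix.mul_assoc]
    _ = P * C * (r' * leg₁ w * r * leg₂ w) * (leg₁ Q * leg₂ Q) := by
        rw [hw]; simp only [Matrix.mul_assoc]
    _ = C * (leg₂ P * leg₁ P * (r' * leg₁ w * r * leg₂ w) * (leg₁ Q * leg₂ Q)) := by
        rw [hPC]; simp only [Matrix.mul_assoc]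
    _ = C * (r' * leg₁ (P * w * Q) * r * leg₂ (P * w * Q)) := by
        congr 1
        -- The outer factors are pushed inwards: `P₂ P₁` passes `R⁻¹` and is reversed, `P₂` passes
        -- `w₁`, and `Q₁` passes `w₂`. They then meet around `R`, where `h5` puts each next to the
        -- matrix it has to conjugate.
        calc leg₂ P * leg₁ P * (r' * leg₁ w * r * leg₂ w) * (leg₁ Q * leg₂ Q)
            = leg₂ P * leg₁ P * r' * leg₁ w * r * (leg₂ w * leg₁ Q) * leg₂ Q := by
              simp only [mul_assoc]
          _ = r' * leg₁ P * (leg₂ P * leg₁ w) * r * (leg₁ Q * leg₂ w) * leg₂ Q := by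
              rw [hPr, hc1]; simp only [mul_assoc]
          _ = r' * leg₁ P * leg₁ w * (leg₂ P * r * leg₁ Q) * leg₂ w * leg₂ Q := by
              rw [hc2']; simp only [mul_assoc]
          _ = _ := by
              rw [h5, leg₁_mul, leg₁_mul, leg₂_mul, leg₂_mul]; simp only [mul_assoc]

/-- The product of two solutions with braided cross relations is a solution. -/
theorem IsSolution.mul {e : Module.Basis ι k A} {R : Matrix (ι × ι) (ι × ι) k} (hR : IsUnit R)
    {w w' : Matrix ι ι W} (hw : IsSolution e R w) (hw' : IsSolution e R w')
    (h : R⁻¹.map (algebraMap k W) * leg₁ w' * R.map (algebraMap k W) * leg₂ w =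
      leg₂ w * (R⁻¹.map (algebraMap k W) * leg₁ w' * R.map (algebraMap k W))) :
    IsSolution e R (w * w') := by
  rw [isSolution_iff] at hw hw' ⊢
  set C := structMatrix W e
  set r := R.map (algebraMap k W)
  set r' := R⁻¹.map (algebraMap k W)
  have hrr' : r * r' = 1 := map_mul_map_inv hR
  calc w * w' * C = w * C * (r' * leg₁ w' * r * leg₂ w') := by
        rw [Matrix.mul_assoc, hw']; simp only [Matrix.mul_assoc]
    _ = C * (r' * leg₁ w * r * (leg₂ w * (r' * leg₁ w' * r)) * leg₂ w') := by
        rw [hw]; simp only [Matrix.mul_assoc]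
    -- The cross relation carries `w₂` to the right of the `w'` block, so that `R R⁻¹` cancels and
    -- `w₁` stands next to `w'₁`.
    _ = C * (r' * leg₁ w * (r * r') * leg₁ w' * r * leg₂ w * leg₂ w') := by
        rw [← h]; simp only [Matrix.mul_assoc]
    _ = _ := by rw [hrr', leg₁_mul, leg₂_mul]; simp only [Matrix.mul_assoc, Matrix.one_mul]

theorem IsSolution.map {W' : Type*} [Ring W'] [Algebra k W'] (φ : W →ₐ[k] W')
    {e : Module.Basis ι k A} {R : Matrix (ι × ι) (ι × ι) k} {w : Matrix ι ι W}
    (hw : IsSolution e R w) : IsSolution e R (w.map φ) := by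
  intro i j l
  simpa using congrArg φ (hw i j l)

end Solutions

/-! ### Maps out of `M₁` -/

section Lift

variable {k : Type u} [Field k] {ι : Type x} [Fintype ι] [DecidableEq ι]
  {A : Type v} [NonUnitalRing A] [Module k A]
  [IsScalarTower k A A] [SMulCommClass k A A] {W : Type*} [Ring W] [Algebra k W]
  (e : Module.Basis ι k A) (R : Matrix (ι × ι) (ι × ι) k)

theorem isSolution_gen : IsSolution e R (Matrix.of (gen e R)) := by
  intro i j l
  simpa [gen] using RingQuot.mkAlgHom_rel k (Rel.mk (e := e) (R := R) i j l)

variable {e R}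

/-- The algebra map out of `M₁` defined by a solution of the relations. -/
def liftM₁ {w : Matrix ι ι W} (hw : IsSolution e R w) : M₁ e R →ₐ[k] W :=
  RingQuot.liftAlgHom k ⟨FreeAlgebra.lift k fun p : ι × ι ↦ w p.1 p.2, by
    rintro _ _ ⟨i, j, l⟩
    simpa using hw i j l⟩

@[simp]
theorem liftM₁_gen {w : Matrix ι ι W} (hw : IsSolution e R w) (i j : ι) :
    liftM₁ hw (gen e R i j) = w i j := by
  simp [liftM₁, gen]

theorem M₁_induction {p : M₁ e R → Prop} (algebraMap : ∀ r, p (algebraMap k _ r))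
    (gen : ∀ i j, p (gen e R i j)) (mul : ∀ a b, p a → p b → p (a * b))
    (add : ∀ a b, p a → p b → p (a + b)) (a : M₁ e R) : p a := by
  obtain ⟨a, rfl⟩ := RingQuot.mkAlgHom_surjective k (Rel e R) a
  induction a with
  | grade0 r => simpa using algebraMap r
  | grade1 x => exact gen x.1 x.2
  | mul a b ha hb => rw [map_mul]; exact mul _ _ ha hb
  | add a b ha hb => rw [map_add]; exact add _ _ ha hb

theorem M₁_algHom_ext {f g : M₁ e R →ₐ[k] W} (h : ∀ i j, f (gen e R i j) = g (gen e R i j)) :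
    f = g := by
  refine AlgHom.ext fun a ↦ ?_
  induction a using M₁_induction with
  | algebraMap r => simp
  | gen i j => exact h i j
  | mul a b ha hb => simp [ha, hb]
  | add a b ha hb => simp [ha, hb]

end Lift

/-! ### Braidings as matrices of operators -/

section Coefficients

variable {k : Type u} [Field k] {ι : Type x} [Fintype ι]
  {V X Y : Type*} [AddCommGroup V] [Module k V] [AddCommGroup X] [Module k X]
  [AddCommGroup Y] [Module k Y]

theorem sum_tmul_basis_injective (e : Module.Basis ι k V) {y y' : ι → Y}
    (h : ∑ a, y a ⊗ₜ[k] e a = ∑ a, y' a ⊗ₜ[k] e a) : y = y' := by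
  refine sum_basis_tmul_injective e ?_
  simpa using congrArg (TensorProduct.comm k Y V) h

/-- The matrix of operators on `X` describing a map `V ⊗ X → X ⊗ V`. -/
def opMatrix (e : Module.Basis ι k V) (l : V ⊗[k] X →ₗ[k] X ⊗[k] V) :
    Matrix ι ι (Module.End k X) :=
  Matrix.of fun a i ↦ (TensorProduct.rid k X).toLinearMap ∘ₗ (e.coord a).lTensor X ∘ₗ l ∘ₗ
    TensorProduct.mk k V X (e i)

theorem apply_basis_tmul (e : Module.Basis ι k V) (l : V ⊗[k] X →ₗ[k] X ⊗[k] V) (i : ι) (x : X) :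
    l (e i ⊗ₜ x) = ∑ a, opMatrix e l a i x ⊗ₜ e a := by
  simp only [opMatrix, Matrix.of_apply, LinearMap.comp_apply, TensorProduct.mk_apply]
  generalize l (e i ⊗ₜ x) = t
  induction t with
  | zero => simp
  | add s t hs ht =>
    simp only [map_add, TensorProduct.add_tmul, Finset.sum_add_distrib, ← hs, ← ht]
  | tmul x v =>
    simp only [LinearMap.lTensor_tmul, LinearEquiv.coe_coe, TensorProduct.rid_tmul,
      TensorProduct.smul_tmul, ← TensorProduct.tmul_sum, Module.Basis.coord_apply,
      e.sum_repr]

/-- The matrix of operators on `X` describing a map `X ⊗ V → V ⊗ X`. -/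
def opMatrix' (e : Module.Basis ι k V) (l : X ⊗[k] V →ₗ[k] V ⊗[k] X) :
    Matrix ι ι (Module.End k X) :=
  Matrix.of fun a i ↦ (TensorProduct.lid k X).toLinearMap ∘ₗ (e.coord a).rTensor X ∘ₗ l ∘ₗ
    (TensorProduct.mk k X V).flip (e i)

theorem apply_tmul_basis (e : Module.Basis ι k V) (l : X ⊗[k] V →ₗ[k] V ⊗[k] X) (i : ι) (x : X) :
    l (x ⊗ₜ e i) = ∑ a, e a ⊗ₜ opMatrix' e l a i x := by
  simp only [opMatrix', Matrix.of_apply, LinearMap.comp_apply, TensorProduct.mk_apply,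
    LinearMap.flip_apply]
  generalize l (x ⊗ₜ e i) = t
  induction t with
  | zero => simp
  | add s t hs ht =>
    simp only [map_add, TensorProduct.tmul_add, Finset.sum_add_distrib, ← hs, ← ht]
  | tmul v x =>
    simp only [LinearMap.rTensor_tmul, LinearEquiv.coe_coe, TensorProduct.lid_tmul,
      ← TensorProduct.smul_tmul, ← TensorProduct.sum_tmul, Module.Basis.coord_apply,
      e.sum_repr]

variable [DecidableEq ι]

theorem opMatrix'_mul_opMatrix (e : Module.Basis ι k V) (l : V ⊗[k] X ≃ₗ[k] X ⊗[k] V) :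
    opMatrix' e l.symm.toLinearMap * opMatrix e l.toLinearMap = 1 := by
  have h (i : ι) (x : X) := l.symm_apply_apply (e i ⊗ₜ x)
  ext b i x
  have h₁ : ∑ b, e b ⊗ₜ[k] ((opMatrix' e l.symm.toLinearMap * opMatrix e l.toLinearMap) b i) x =
      ∑ b, e b ⊗ₜ[k] ((1 : Matrix ι ι (Module.End k X)) b i) x := by
    rw [show ∑ b, e b ⊗ₜ[k] ((1 : Matrix ι ι (Module.End k X)) b i) x = e i ⊗ₜ x by
      rw [Finset.sum_eq_single i] <;> simp +contextual, ← h]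
    rw [← LinearEquiv.coe_coe l, apply_basis_tmul, map_sum]
    simp only [← LinearEquiv.coe_coe l.symm, apply_tmul_basis]
    rw [Finset.sum_comm]
    simp [Matrix.mul_apply, TensorProduct.tmul_sum]
  exact congrFun (sum_basis_tmul_injective e h₁) b

theorem opMatrix_mul_opMatrix' (e : Module.Basis ι k V) (l : V ⊗[k] X ≃ₗ[k] X ⊗[k] V) :
    opMatrix e l.toLinearMap * opMatrix' e l.symm.toLinearMap = 1 := by
  have h (i : ι) (x : X) := l.apply_symm_apply (x ⊗ₜ e i)
  ext b i x
  have h₁ : ∑ b, ((opMatrix e l.toLinearMap * opMatrix' e l.symm.toLinearMap) b i) x ⊗ₜ[k] e b =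
      ∑ b, ((1 : Matrix ι ι (Module.End k X)) b i) x ⊗ₜ[k] e b := by
    rw [show ∑ b, ((1 : Matrix ι ι (Module.End k X)) b i) x ⊗ₜ[k] e b = x ⊗ₜ e i by
      rw [Finset.sum_eq_single i] <;> simp +contextual, ← h]
    rw [← LinearEquiv.coe_coe l.symm, apply_tmul_basis, map_sum]
    simp only [← LinearEquiv.coe_coe l, apply_basis_tmul]
    rw [Finset.sum_comm]
    simp [Matrix.mul_apply, TensorProduct.sum_tmul]
  exact congrFun (sum_tmul_basis_injective e h₁) b

end Coefficients

/-! ### Extending a braiding from `A` to `M₁` -/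

section Extension

variable {k : Type u} [Field k] {ι : Type x} [Fintype ι] [DecidableEq ι]
  {A : Type v} [NonUnitalRing A] [Module k A]
  [IsScalarTower k A A] [SMulCommClass k A A] {e : Module.Basis ι k A}
  {R : Matrix (ι × ι) (ι × ι) k} {X : Type*} [AddCommGroup X] [Module k X]

/-- These are the coordinates of the braid relation on `e i ⊗ e j ⊗ x`. Together with the
coordinates of functoriality in `opMatrix_mul` they are exactly what conjugation of solutions
requires. -/
theorem opMatrix_RTT {Ψ : A ⊗[k] A →ₗ[k] A ⊗[k] A}
    (hΨR : ∀ i j, Ψ (e i ⊗ₜ[k] e j) = ∑ a, ∑ b, R (a, b) (i, j) • (e b ⊗ₜ[k] e a))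
    {l : A ⊗[k] X →ₗ[k] X ⊗[k] A} (h : BraidRelation Ψ l l) (a b i j : ι) :
    ∑ c, ∑ d, R (a, b) (c, d) • (opMatrix e l c i * opMatrix e l d j) =
      ∑ c, ∑ d, R (c, d) (i, j) • (opMatrix e l b d * opMatrix e l a c) := by
  have hb (i j : ι) (x : X) : braidLeft l l ((e i ⊗ₜ e j) ⊗ₜ x) =
      ∑ c, ∑ d, (opMatrix e l c i * opMatrix e l d j) x ⊗ₜ (e c ⊗ₜ e d) := by
    rw [braidLeft_tmul, apply_basis_tmul, map_sum]
    simp only [passLeft_tmul, apply_basis_tmul, TensorProduct.sum_tmul, map_sum,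
      TensorProduct.assoc_tmul]
    rw [Finset.sum_comm]
    rfl
  refine LinearMap.ext fun x ↦ ?_
  have h₁ := (braidRelation_iff_natL.1 h).apply (e i ⊗ₜ e j) x
  rw [hΨR, hb] at h₁
  simp only [TensorProduct.sum_tmul, map_sum, ← TensorProduct.smul_tmul', map_smul, hb,
    LinearMap.lTensor_tmul, hΨR, TensorProduct.tmul_sum, Finset.smul_sum,
    TensorProduct.tmul_smul] at h₁
  -- The coordinates are taken in the order `b`, `a`, because `R (a, b)` is the coefficient of `e b
  -- ⊗ e a`.
  have h₂ := congrArg (fun t ↦ TensorProduct.rid k X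
    (((TensorProduct.lid k k).toLinearMap ∘ₗ
      TensorProduct.map (e.coord b) (e.coord a)).lTensor X t)) h₁
  simpa [Finsupp.single_apply, ite_smul, Finset.sum_ite_eq] using h₂.symm

theorem opMatrix_mul {l : A ⊗[k] X →ₗ[k] X ⊗[k] A}
    (h : NatL (LinearMap.mul' k A) (braidLeft l l) l) (a i j : ι) :
    ∑ c, structConst e i j c • opMatrix e l a c =
      ∑ c, ∑ d, structConst e c d a • (opMatrix e l c i * opMatrix e l d j) := by
  have hmul (i j : ι) : e i * e j = ∑ c, structConst e i j c • e c := (e.sum_repr _).symm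
  refine LinearMap.ext fun x ↦ ?_
  have h₁ := h.apply (e i ⊗ₜ e j) x
  rw [LinearMap.mul'_apply, hmul, braidLeft_tmul, apply_basis_tmul, map_sum] at h₁
  simp only [passLeft_tmul, apply_basis_tmul, TensorProduct.sum_tmul, map_sum,
    TensorProduct.assoc_tmul, LinearMap.lTensor_tmul, LinearMap.mul'_apply, hmul,
    ← TensorProduct.smul_tmul', map_smul, TensorProduct.tmul_sum, Finset.smul_sum,
    TensorProduct.tmul_smul] at h₁
  have h₂ := congrArg (fun t ↦ TensorProduct.rid k X ((e.coord a).lTensor X t)) h₁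
  rw [Finset.sum_comm (γ := ι) (t := Finset.univ)]
  simpa [Finsupp.single_apply, ite_smul] using h₂

theorem IsSolution.conj_of_sum {W : Type*} [Ring W] [Algebra k W] (hR : IsUnit R)
    {w Q P : Matrix ι ι W} (hw : IsSolution e R w) (hPQ : P * Q = 1) (hQP : Q * P = 1)
    (hcomm : ∀ a b c d, Commute (Q a b) (w c d))
    (hRTT : ∀ a b i j, ∑ c, ∑ d, R (a, b) (c, d) • (Q c i * Q d j) =
      ∑ c, ∑ d, R (c, d) (i, j) • (Q b d * Q a c))
    (hQ : ∀ a i j, ∑ c, structConst e i j c • Q a c =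
      ∑ c, ∑ d, structConst e c d a • (Q c i * Q d j)) :
    IsSolution e R (P * w * Q) := by
  refine hw.conj hR hPQ hQP hcomm ?_ ?_
  · ext ⟨a, b⟩ ⟨i, j⟩
    simpa [Matrix.mul_apply (M := Matrix.map R _), Matrix.mul_apply (N := Matrix.map R _),
      Fintype.sum_prod_type, leg₁_mul_leg₂_apply,
      leg₂_mul_leg₁_apply, Algebra.smul_def, Algebra.commutes] using hRTT a b i j
  · ext a ⟨i, j⟩
    rw [Matrix.mul_apply (M := structMatrix W e)]
    simpa [Matrix.mul_apply (M := Q),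
      structMatrix, Fintype.sum_prod_type, leg₁_mul_leg₂_apply,
      Algebra.smul_def, Algebra.commutes] using hQ a i j

variable (e R) in
/-- The universal comeasuring map `e_j ↦ e_a ⊗ u^a_j`. -/
def betaU : A →ₗ[k] A ⊗[k] M₁ e R :=
  e.constr k fun j ↦ ∑ a, e a ⊗ₜ gen e R a j

@[simp]
theorem betaU_basis (j : ι) : betaU e R (e j) = ∑ a, e a ⊗ₜ gen e R a j := by
  simp [betaU]

/-- Left multiplication on the second tensor factor. -/
def mulRightFactor (X M : Type*) [AddCommGroup X] [Module k X] [Ring M] [Algebra k M] :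
    M →ₐ[k] Module.End k (X ⊗[k] M) :=
  (Module.End.lTensorAlgHom k M X).comp (Algebra.lmul k M)

/-- Let `P` and `Q` act on the factor `X` of `X ⊗ M₁`, and `u` by left multiplication on the factor
`M₁`. These actions commute, so `P u Q` is a solution and defines a representation `ρ` of `M₁` on `X
⊗ M₁`. The braiding of `a` past `x` is `ρ a (x ⊗ 1)`. -/
theorem exists_extension (hR : IsUnit R) {Ψ : A ⊗[k] A →ₗ[k] A ⊗[k] A}
    (hΨR : ∀ i j, Ψ (e i ⊗ₜ[k] e j) = ∑ a, ∑ b, R (a, b) (i, j) • (e b ⊗ₜ[k] e a))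
    (l : A ⊗[k] X ≃ₗ[k] X ⊗[k] A)
    (hbr : BraidRelation Ψ l.toLinearMap l.toLinearMap)
    (hmul : NatL (LinearMap.mul' k A) (braidLeft l.toLinearMap l.toLinearMap) l.toLinearMap) :
    ∃ lM : M₁ e R ⊗[k] X →ₗ[k] X ⊗[k] M₁ e R, (∀ x, lM (1 ⊗ₜ x) = x ⊗ₜ 1) ∧
      Mover (LinearMap.mul' k (M₁ e R)) (betaU e R) l.toLinearMap lM ∧
      ∀ i j x, lM (gen e R i j ⊗ₜ x) = ∑ a, ∑ b,
        (opMatrix' e l.symm.toLinearMap i a * opMatrix e l.toLinearMap b j) x ⊗ₜ gen e R a b := by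
  let φ := Module.End.rTensorAlgHom k X (M₁ e R)
  let ψ : M₁ e R →ₐ[k] _ := mulRightFactor (k := k) X (M₁ e R)
  set Q := opMatrix e l.toLinearMap
  set P := opMatrix' e l.symm.toLinearMap
  have hsol : IsSolution e R (P.map φ * (Matrix.of (gen e R)).map ψ * Q.map φ) := by
    refine IsSolution.conj_of_sum hR ((isSolution_gen e R).map ψ) ?_ ?_ ?_ ?_ ?_
    · rw [← Matrix.map_mul, opMatrix'_mul_opMatrix, Matrix.map_one _ (map_zero _) (map_one _)]
    · rw [← Matrix.map_mul, opMatrix_mul_opMatrix', Matrix.map_one _ (map_zero _) (map_one _)]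
    · intro a b c d
      exact (LinearMap.rTensor_comp_lTensor _ _ _).trans
        (LinearMap.lTensor_comp_rTensor _ _ _).symm
    · intro a b i j
      simpa using congrArg φ (opMatrix_RTT hΨR hbr a b i j)
    · intro a i j
      simpa using congrArg φ (opMatrix_mul hmul a i j)
  let ρ := liftM₁ hsol
  have hρgen (i j : ι) (x : X) (m : M₁ e R) : ρ (gen e R i j) (x ⊗ₜ m) =
      ∑ a, ∑ b, (P i a * Q b j) x ⊗ₜ (gen e R a b * m) := by
    simp only [ρ, liftM₁_gen, Matrix.mul_apply, Finset.sum_mul, LinearMap.sum_apply]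
    rw [Finset.sum_comm]
    rfl
  -- Since `ρ` commutes with right multiplications, it is determined by its values on the `x ⊗ 1`.
  -- This turns multiplicativity of `ρ` into functoriality of `lM`.
  have hρ (a m : M₁ e R) (t : X ⊗[k] M₁ e R) :
      ρ a ((LinearMap.mulRight k m).lTensor X t) = (LinearMap.mulRight k m).lTensor X (ρ a t) := by
    induction a using M₁_induction generalizing t with
    | algebraMap r => simp [Algebra.algebraMap_eq_smul_one]
    | gen i j =>
      induction t with
      | zero => simp
      | add s t hs ht => simp only [map_add, hs, ht]
      | tmul x m' => simp [hρgen, mul_assoc]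
    | mul a b ha hb => simp [ha, hb]
    | add a b ha hb => simp [ha, hb]
  let lM : M₁ e R ⊗[k] X →ₗ[k] X ⊗[k] M₁ e R := TensorProduct.lift
    (((TensorProduct.mk k X (M₁ e R)).flip 1).lcomp k _ ∘ₗ ρ.toLinearMap)
  have hlM (a : M₁ e R) (x : X) : lM (a ⊗ₜ x) = ρ a (x ⊗ₜ 1) := rfl
  have hlM' (a : M₁ e R) (x : X) (m : M₁ e R) : ρ a (x ⊗ₜ m) =
      (LinearMap.mulRight k m).lTensor X (lM (a ⊗ₜ x)) := by
    rw [hlM, ← hρ]; simp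
  have hpass (a : M₁ e R) (t : X ⊗[k] M₁ e R) :
      (LinearMap.mul' k (M₁ e R)).lTensor X (passLeft lM (M₁ e R) a t) = ρ a t := by
    induction t with
    | zero => simp
    | add s t hs ht => simp only [map_add, hs, ht]
    | tmul x m =>
      rw [passLeft_tmul, hlM']
      generalize lM (a ⊗ₜ x) = t
      induction t with
      | zero => simp
      | add s t hs ht => simp only [map_add, TensorProduct.add_tmul, hs, ht]
      | tmul x m => simp
  have hlMgen (i j : ι) (x : X) : lM (gen e R i j ⊗ₜ x) =
      ∑ a, ∑ b, (P i a * Q b j) x ⊗ₜ gen e R a b := by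
    simp [hlM, hρgen]
  refine ⟨lM, fun x ↦ by simp [hlM], ⟨?_, ?_⟩, hlMgen⟩
  · refine natL_of_apply fun t x ↦ ?_
    induction t with
    | zero => simp
    | add s t hs ht => simp only [map_add, TensorProduct.add_tmul, hs, ht]
    | tmul a b =>
      rw [braidLeft_tmul, hpass, LinearMap.mul'_apply, hlM, map_mul, Module.End.mul_apply, hlM]
  · refine TensorProduct.ext (e.ext fun j ↦ LinearMap.ext fun x ↦ ?_)
    simp only [LinearMap.compr₂ₛₗ_apply, TensorProduct.mk_apply, LinearMap.comp_apply,
      LinearMap.rTensor_tmul, betaU_basis, TensorProduct.sum_tmul, map_sum, braidLeft_tmul, hlMgen,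
      passLeft_tmul, apply_basis_tmul, TensorProduct.assoc_tmul, LinearMap.lTensor_tmul,
      TensorProduct.tmul_sum]
    -- In the braiding of `β_U (e j)` past `x`, the `Q` that moves the basis vector cancels the `P`
    -- from the generator. The other `Q` remains, which is the crossing followed by `β_U`.
    have hQP (d b : ι) : ∑ a, Q d a * P a b = if d = b then 1 else 0 := by
      rw [← Matrix.mul_apply, opMatrix_mul_opMatrix' e l, Matrix.one_apply]
    calc ∑ a, ∑ b, ∑ c, ∑ d, (Q d a) ((P a b * Q c j) x) ⊗ₜ[k] (e d ⊗ₜ[k] gen e R b c)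
        = ∑ c, ∑ b, ∑ d, ((∑ a, Q d a * P a b) * Q c j) x ⊗ₜ[k] (e d ⊗ₜ[k] gen e R b c) := by
          simp only [Finset.sum_mul, LinearMap.sum_apply, TensorProduct.sum_tmul, mul_assoc]
          rw [Finset.sum_congr rfl fun a _ ↦ Finset.sum_comm, Finset.sum_comm]
          refine Finset.sum_congr rfl fun c _ ↦ ?_
          rw [Finset.sum_comm]
          refine Finset.sum_congr rfl fun b _ ↦ ?_
          rw [Finset.sum_comm]
          rfl
      _ = _ := by
        refine Finset.sum_congr rfl fun c _ ↦ Finset.sum_congr rfl fun b _ ↦ ?_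
        rw [Finset.sum_eq_single b]
        · simp [hQP, Q]
        · intro d _ hd
          simp [hQP, hd]
        · simp

end Extension

theorem sum_rev₃ {ι₁ ι₂ ι₃ M : Type*} [Fintype ι₁] [Fintype ι₂] [Fintype ι₃] [AddCommMonoid M]
    (f : ι₁ → ι₂ → ι₃ → M) : ∑ a, ∑ b, ∑ c, f a b c = ∑ c, ∑ b, ∑ a, f a b c := by
  rw [Finset.sum_comm, Finset.sum_congr rfl fun b _ ↦ Finset.sum_comm, Finset.sum_comm]

theorem sum_rot₃ {ι₁ ι₂ ι₃ M : Type*} [Fintype ι₁] [Fintype ι₂] [Fintype ι₃] [AddCommMonoid M]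
    (f : ι₁ → ι₂ → ι₃ → M) : ∑ a, ∑ b, ∑ c, f a b c = ∑ b, ∑ c, ∑ a, f a b c := by
  rw [Finset.sum_comm, Finset.sum_congr rfl fun b _ ↦ Finset.sum_comm]

/-! ### Invertibility of the partial transpose of `R⁻¹` -/

section RMatrices

variable {k : Type u} [Field k] {ι : Type x} [Fintype ι] [DecidableEq ι]
  {A : Type v} [NonUnitalRing A] [Module k A]
  [IsScalarTower k A A] [SMulCommClass k A A] {e : Module.Basis ι k A}
  {R : Matrix (ι × ι) (ι × ι) k} {Ψ : A ⊗[k] A ≃ₗ[k] A ⊗[k] A}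

theorem IsBraidingOf.symm_apply (hR : IsUnit R) (h : IsBraidingOf e R Ψ) (a b : ι) :
    Ψ.symm (e b ⊗ₜ e a) = ∑ i, ∑ j, R⁻¹ (i, j) (a, b) • (e i ⊗ₜ[k] e j) := by
  rw [LinearEquiv.symm_apply_eq]
  simp only [map_sum, map_smul, h _ _, Finset.smul_sum, smul_smul]
  have h₁ (c d : ι) : ∑ i, ∑ j, R (c, d) (i, j) * R⁻¹ (i, j) (a, b) =
      if c = a ∧ d = b then 1 else 0 := by
    have := Matrix.mul_nonsing_inv R ((Matrix.isUnit_iff_isUnit_det _).1 hR)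
    simpa [Matrix.mul_apply, Fintype.sum_prod_type, Matrix.one_apply] using
      congrFun (congrFun this (c, d)) (a, b)
  calc e b ⊗ₜ[k] e a = ∑ c, ∑ d, (∑ i, ∑ j, R (c, d) (i, j) * R⁻¹ (i, j) (a, b)) •
        (e d ⊗ₜ[k] e c) := by
        simp only [h₁]
        rw [Finset.sum_eq_single a, Finset.sum_eq_single b] <;> simp +contextual
    _ = _ := by
        simp only [Finset.sum_smul, mul_comm (R _ _)]
        rw [Finset.sum_congr rfl fun a _ ↦ (Finset.sum_comm.trans (Finset.sum_congr rfl fun c _ ↦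
          Finset.sum_comm)), Finset.sum_comm]
        refine Finset.sum_congr rfl fun c _ ↦ ?_
        exact Finset.sum_comm

theorem IsBraidingOf.opMatrix_apply (h : IsBraidingOf e R Ψ) (a i j : ι) :
    opMatrix e Ψ.toLinearMap a i (e j) = ∑ b, R (a, b) (i, j) • e b := by
  simp [opMatrix, h _ _, Finsupp.single_apply, ite_smul, smul_ite]

theorem IsBraidingOf.opMatrix'_apply (hR : IsUnit R) (h : IsBraidingOf e R Ψ) (a i j : ι) :
    opMatrix' e Ψ.symm.toLinearMap a i (e j) = ∑ b, R⁻¹ (a, b) (i, j) • e b := by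
  simp [opMatrix', h.symm_apply hR, Finsupp.single_apply, ite_smul, smul_ite]

/-- A matrix which intertwines an invertible matrix with some other matrix also intertwines its
inverse with some other matrix. -/
theorem exists_intertwines_inv {n : Type*} [Fintype n] [DecidableEq n] {v P P' T : Matrix n n k}
    (hP : P' * P = 1) (h : v * P' = T * v) : ∃ T', v * P = T' * v := by
  -- The matrices `Y` for which `v * Y` has the form `T' * v` form a finite-dimensional algebra.
  -- Multiplication by the invertible element `P'` is injective on it, hence surjective, so the
  -- algebra contains the inverse of `P'`. No invertibility of `v` is needed.
  let S : Subalgebra k (Matrix n n k) :=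
    { carrier := {Y | ∃ T', v * Y = T' * v}
      mul_mem' := by
        rintro a b ⟨s, hs⟩ ⟨t, ht⟩
        exact ⟨s * t, by rw [← mul_assoc, hs, mul_assoc, ht, mul_assoc]⟩
      add_mem' := by
        rintro a b ⟨s, hs⟩ ⟨t, ht⟩
        exact ⟨s + t, by rw [mul_add, hs, ht, add_mul]⟩
      algebraMap_mem' := fun r ↦ ⟨algebraMap k _ r, (Algebra.commutes r v).symm⟩ }
  let x : S := ⟨P', T, h⟩
  have hinj : Function.Injective (LinearMap.mulLeft k x) := by
    intro a b hab
    have h₁ : P' * (a : Matrix n n k) = P' * b := congrArg Subtype.val hab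
    have h₂ : P * P' = 1 := mul_eq_one_comm.1 hP
    apply Subtype.ext
    rw [← one_mul (a : Matrix n n k), ← h₂, mul_assoc, h₁, ← mul_assoc, h₂, one_mul]
  obtain ⟨y, hy⟩ := LinearMap.injective_iff_surjective.1 hinj 1
  have h₁ : P' * (y : Matrix n n k) = 1 := congrArg Subtype.val hy
  have h₂ : P = y := by
    rw [← one_mul (y : Matrix n n k), ← mul_eq_one_comm.1 hP, mul_assoc, h₁, mul_one]
  rw [h₂]
  exact y.2

/-- A matrix `v` obtained by contracting the inverse of `p = R^{t₂}` satisfies `v₁ p⁻¹ = (R⁻¹)^{t₂}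
v₁`. It plays the role of the element that implements the square of the antipode. Once `v` is
invertible, `(R⁻¹)^{t₂}` is conjugate to `p⁻¹`. -/
theorem isUnit_transpose₂_inv (hR : IsBiinvertible R) (hΨR : IsBraidingOf e R Ψ)
    (hΨ : BraidRelation Ψ.toLinearMap Ψ.toLinearMap Ψ.toLinearMap) :
    IsUnit (transpose₂ R⁻¹) := by
  set Q := opMatrix e Ψ.toLinearMap with hQdef
  set P := opMatrix' e Ψ.symm.toLinearMap with hPdef
  have hPQ : P * Q = 1 := opMatrix'_mul_opMatrix e Ψ
  have hQP : Q * P = 1 := opMatrix_mul_opMatrix' e Ψ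
  set p := transpose₂ R with hp
  have hpa (a b c d : ι) : p (a, b) (c, d) = R (a, d) (c, b) := rfl
  have hpdet := (Matrix.isUnit_iff_isUnit_det p).1 hR.2
  clear_value p
  have hpu : p * p⁻¹ = 1 := Matrix.mul_nonsing_inv p hpdet
  have hpu' : p⁻¹ * p = 1 := Matrix.nonsing_inv_mul p hpdet
  let f : Matrix (ι × ι) (ι × ι) k →+* Matrix (ι × ι) (ι × ι) (Module.End k A) :=
    (algebraMap k (Module.End k A)).mapMatrix
  have hQ2 : leg₂ Q * leg₂ P = 1 := by rw [← leg₂_mul, hQP, leg₂_one]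
  have hP2 : leg₂ P * leg₂ Q = 1 := by rw [← leg₂_mul, hPQ, leg₂_one]
  have hRTT : f R * (leg₁ Q * leg₂ Q) = leg₂ Q * leg₁ Q * f R := by
    ext1 ⟨a, b⟩ ⟨i, j⟩
    simpa [f, Matrix.mul_apply (M := Matrix.map R _), Matrix.mul_apply (N := Matrix.map R _),
      Fintype.sum_prod_type, leg₁_mul_leg₂_apply,
      leg₂_mul_leg₁_apply, Algebra.smul_def, Algebra.commutes] using opMatrix_RTT hΨR hΨ a b i j
  have h5 : leg₂ P * f R * leg₁ Q = leg₁ Q * f R * leg₂ P := by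
    calc leg₂ P * f R * leg₁ Q = leg₂ P * (f R * (leg₁ Q * leg₂ Q)) * leg₂ P := by
          simp only [mul_assoc, hQ2, mul_one]
      _ = _ := by
          rw [hRTT]
          simp only [mul_assoc]
          rw [← mul_assoc (leg₂ P), hP2, one_mul]
  let F : Matrix (ι × ι) (ι × ι) (Module.End k A) :=
    Matrix.of fun s t ↦ P t.2 s.2 * Q s.1 t.1
  let G : Matrix (ι × ι) (ι × ι) (Module.End k A) :=
    Matrix.of fun s t ↦ Q s.1 t.1 * P t.2 s.2
  -- This is `h5` with the second leg transposed. The order of the operators must be recorded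
  -- separately, whence the two matrices `F` and `G`.
  have hFG : f p * F = G * f p := by
    ext1 ⟨a, j⟩ ⟨i, b⟩
    have h := congrFun (congrFun h5 (a, b)) (i, j)
    simp only [Matrix.mul_apply, leg₁, leg₂, Matrix.of_apply, Fintype.sum_prod_type, ite_mul,
      mul_ite, zero_mul, mul_zero, Finset.sum_ite_eq, Finset.sum_ite_eq', Finset.sum_ite_irrel,
      Finset.sum_const_zero, Finset.mem_univ, if_true, Finset.sum_mul, f,
      RingHom.mapMatrix_apply, Matrix.map_apply] at h
    simp only [f, RingHom.mapMatrix_apply, Matrix.map_apply, F, G, Matrix.mul_apply,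
      Fintype.sum_prod_type, Matrix.of_apply, hpa, ← Algebra.smul_def, ← Algebra.commutes]
    simp only [← Algebra.smul_def, ← Algebra.commutes, Algebra.smul_mul_assoc] at h
    rw [h, Finset.sum_comm]
  have hFG' : F * f p⁻¹ = f p⁻¹ * G := by
    have h₁ : f p * f p⁻¹ = 1 := by rw [← map_mul, hpu, map_one]
    have h₂ : f p⁻¹ * f p = 1 := by rw [← map_mul, hpu', map_one]
    calc F * f p⁻¹ = f p⁻¹ * (f p * F) * f p⁻¹ := by rw [← mul_assoc, h₂, one_mul]
      _ = f p⁻¹ * G := by rw [hFG, mul_assoc, mul_assoc, h₁, mul_one]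
  let v : Matrix ι ι k := Matrix.of fun a z ↦ ∑ i, p⁻¹ (i, i) (z, a)
  have hv (a z : ι) : algebraMap k (Module.End k A) (v a z) =
      ∑ c, ∑ j, v j c • (Q c z * P a j) := by
    -- Contracting the row index pairs a `P` with a `Q` on the left, which cancel by `P * Q = 1`.
    -- The contraction of `p⁻¹` that remains is `v`.
    have h : ∑ x, (F * f p⁻¹) (x, x) (z, a) = ∑ x, (f p⁻¹ * G) (x, x) (z, a) := by rw [hFG']
    simp only [f, RingHom.mapMatrix_apply, Matrix.map_apply, F, G, Matrix.mul_apply,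
      Fintype.sum_prod_type, Matrix.of_apply, ← Algebra.commutes,
      ← Algebra.smul_def] at h
    have hPQ' (b i : ι) : ∑ x, P b x * Q x i = if b = i then 1 else 0 := by
      rw [← Matrix.mul_apply, hPQ, Matrix.one_apply]
    rw [sum_rot₃] at h
    simp only [← Finset.smul_sum, hPQ', smul_ite, smul_zero, Finset.sum_ite_eq',
      Finset.mem_univ, if_true, ← Finset.sum_smul] at h
    rw [sum_rot₃] at h
    simp only [← Finset.sum_smul] at h
    rw [Algebra.algebraMap_eq_smul_one]
    exact h
  -- The entries of `p⁻¹` give operators that invert `Q` with respect to the other index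
  -- contraction. Multiplying `hv` by them removes `Q`.
  let S (z y : ι) : Module.End k A := e.constr k fun b ↦ ∑ l, p⁻¹ (z, b) (y, l) • e l
  have hS (y a : ι) : ∑ z, S z y * Q a z = if a = y then 1 else 0 := by
    refine e.ext fun m ↦ ?_
    have h (l : ι) : ∑ z, ∑ b, R (a, b) (z, m) * p⁻¹ (z, b) (y, l) =
        if a = y ∧ m = l then 1 else 0 := by
      simpa [Matrix.mul_apply, Fintype.sum_prod_type, Matrix.one_apply, hpa] using
        congrFun (congrFun hpu (a, m)) (y, l)
    simp only [LinearMap.sum_apply, Module.End.mul_apply, Q, hΨR.opMatrix_apply, map_sum,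
      map_smul, S, e.constr_basis, Finset.smul_sum, smul_smul]
    rw [(sum_rev₃ _).trans (Finset.sum_congr rfl fun l _ ↦ Finset.sum_comm)]
    simp only [← Finset.sum_smul, h]
    by_cases hay : a = y <;> simp [hay, ite_smul]

  have hvS (a y : ι) : ∑ z, v a z • S z y = ∑ j, v j y • P a j := by
    calc ∑ z, v a z • S z y = ∑ z, S z y * algebraMap k (Module.End k A) (v a z) := by
          simp [Algebra.smul_def, Algebra.commutes]
      _ = ∑ c, ∑ j, v j c • ((∑ z, S z y * Q c z) * P a j) := by
          simp only [hv, Finset.mul_sum, Finset.sum_mul, Finset.smul_sum, mul_smul_comm, mul_assoc]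
          exact sum_rot₃ _
      _ = _ := by
          simp [hS]
  have hint : leg₁ v * p⁻¹ = transpose₂ R⁻¹ * leg₁ v := by
    ext1 ⟨a, b⟩ ⟨y, l⟩
    have h := congrArg (fun E : Module.End k A ↦ e.repr (E (e b)) l) (hvS a y)
    simp [S, P, hΨR.opMatrix'_apply hR.1, Finsupp.single_apply] at h
    simp [leg₁, Matrix.mul_apply, Fintype.sum_prod_type, transpose₂]
    simpa only [mul_comm] using h
  -- Invertibility of `v` is not yet known, so the intertwining relation for `p` itself cannot be
  -- had by conjugation. The matrix `T'` replaces the conjugate, and its contraction is a left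
  -- inverse of `v`.
  obtain ⟨T', hT'⟩ := exists_intertwines_inv hpu' hint
  have hvinv : (Matrix.of fun a m ↦ ∑ b, T' (b, b) (m, a)) * v = 1 := by
    have h (a b y l : ι) : ∑ x, v a x * R (x, l) (y, b) = ∑ x, T' (a, b) (x, l) * v x y := by
      simpa [leg₁, Matrix.mul_apply, Fintype.sum_prod_type, hpa] using
        congrFun (congrFun hT' (a, b)) (y, l)
    ext j y
    have h₂ (i : ι) : ∑ x, ∑ z, p⁻¹ (i, i) (x, z) * R (x, j) (y, z) =
        if i = y ∧ i = j then 1 else 0 := by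
      simpa [Matrix.mul_apply, Fintype.sum_prod_type, Matrix.one_apply, hpa] using
        congrFun (congrFun hpu' (i, i)) (y, j)
    calc ∑ m, (∑ b, T' (b, b) (m, j)) * v m y = ∑ b, ∑ x, v b x * R (x, j) (y, b) := by
          simp only [Finset.sum_mul, h]
          exact Finset.sum_comm
      _ = ∑ i, ∑ x, ∑ z, p⁻¹ (i, i) (x, z) * R (x, j) (y, z) := by
          simp only [v, Matrix.of_apply, Finset.sum_mul]
          exact (sum_rev₃ _)
      _ = _ := by
          simp only [h₂, Matrix.one_apply]
          by_cases hjy : j = y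
          · simp [hjy]
          · rw [if_neg hjy]
            exact Finset.sum_eq_zero fun i _ ↦ if_neg fun hi ↦ hjy (hi.2.symm.trans hi.1)
  have hv1 : leg₁ v * leg₁ (Matrix.of fun a m ↦ ∑ b, T' (b, b) (m, a)) = 1 := by
    rw [← leg₁_mul, mul_eq_one_comm.1 hvinv, leg₁_one]
  refine IsUnit.of_mul_eq_one (leg₁ v * p * leg₁ (Matrix.of fun a m ↦ ∑ b, T' (b, b) (m, a))) ?_
  rw [← mul_assoc, ← mul_assoc, ← hint, mul_assoc (leg₁ v), hpu', mul_one, hv1]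

end RMatrices

/-! ### Bijectivity by filtration and dimension count -/

section Invertibility

variable {k : Type u} [Field k]

/-- A linear endomorphism of a union of finite-dimensional subspaces, each contained in its own
image, is injective. -/
theorem injective_of_exhaustion {N : Type*} [AddCommGroup N] [Module k N] (f : N →ₗ[k] N)
    (W : ℕ → Submodule k N) [∀ d, FiniteDimensional k (W d)] (hW : ∀ x, ∃ d, x ∈ W d)
    (hf : ∀ d, W d ≤ (W d).map f) : Function.Injective f := by
  rw [injective_iff_map_eq_zero]
  intro x hx
  obtain ⟨d, hd⟩ := hW x
  -- An image cannot have larger dimension, so a finite-dimensional space contained in its own image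
  -- equals it. Thus `f` restricts to a surjective, hence injective, endomorphism.
  have heq : W d = (W d).map f :=
    Submodule.eq_of_le_of_finrank_le (hf d) (Submodule.finrank_map_le f (W d))
  let g : W d →ₗ[k] W d := f.restrict fun y hy ↦ heq ▸ Submodule.mem_map_of_mem hy
  have hg : Function.Surjective g := by
    rintro ⟨y, hy⟩
    rw [heq] at hy
    obtain ⟨z, hz, rfl⟩ := hy
    exact ⟨⟨z, hz⟩, rfl⟩
  have h0 : (⟨x, hd⟩ : W d) = 0 := by
    refine LinearMap.injective_iff_surjective.2 hg ?_
    rw [map_zero]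
    exact Subtype.ext hx
  exact congrArg Subtype.val h0

variable {V M : Type*} [AddCommGroup V] [Module k V] [FiniteDimensional k V] [Ring M] [Algebra k M]

/-- A braiding of a finitely generated algebra past a finite-dimensional space is bijective as soon
as its image contains the products of vectors and generators. -/
theorem bijective_of_generators {l : M ⊗[k] V →ₗ[k] V ⊗[k] M} (hone : ∀ v, l (1 ⊗ₜ v) = v ⊗ₜ 1)
    (hmul : NatL (LinearMap.mul' k M) (braidLeft l l) l) {s : Set M} (hs : s.Finite)
    (htop : Algebra.adjoin k s = ⊤)
    (hgen : ∀ v, ∀ a ∈ s, v ⊗ₜ a ∈ (LinearMap.range ((Submodule.span k s).subtype.rTensor V)).map l) :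
    Function.Bijective l := by
  -- Including `1` makes the powers of `N` increase, so that they form an exhaustive filtration by
  -- finite-dimensional subspaces.
  set N : Submodule k M := Submodule.span k (insert 1 s) with hN
  have hfg (d : ℕ) : (N ^ d).FG := (Submodule.fg_span (hs.insert 1)).pow d
  have hfin (d : ℕ) : FiniteDimensional k ↥(N ^ d) := Module.Finite.iff_fg.2 (hfg d)
  have h1N : (1 : Submodule k M) ≤ N := by
    rw [Submodule.one_le]
    exact Submodule.subset_span (Set.mem_insert _ _)
  have hmono : Monotone fun d ↦ N ^ d := monotone_nat_of_le_succ fun d ↦ by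
    change N ^ d ≤ N ^ (d + 1)
    rw [pow_succ]
    exact le_mul_of_one_le_right' h1N
  have hex (a : M) : ∃ d, a ∈ N ^ d := by
    have ha : a ∈ Algebra.adjoin k s := by rw [htop]; trivial
    induction ha using Algebra.adjoin_induction with
    | mem x hx => exact ⟨1, by rw [pow_one]; exact Submodule.subset_span (Set.mem_insert_of_mem _ hx)⟩
    | algebraMap r =>
      exact ⟨0, by rw [pow_zero]; exact Submodule.algebraMap_mem r⟩
    | add x y _ _ hx hy =>
      obtain ⟨m, hm⟩ := hx
      obtain ⟨n, hn⟩ := hy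
      exact ⟨max m n, add_mem (hmono (le_max_left m n) hm) (hmono (le_max_right m n) hn)⟩
    | mul x y _ _ hx hy =>
      obtain ⟨m, hm⟩ := hx
      obtain ⟨n, hn⟩ := hy
      exact ⟨m + n, by rw [pow_add]; exact Submodule.mul_mem_mul hm hn⟩
  let W (d : ℕ) : Submodule k (M ⊗[k] V) := LinearMap.range ((N ^ d).subtype.rTensor V)
  have hfinW (d : ℕ) : FiniteDimensional k (W d) := by
    have := hfin d
    exact Module.Finite.range _
  have hWmem {d : ℕ} {a : M} (ha : a ∈ N ^ d) (v : V) : a ⊗ₜ v ∈ W d :=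
    ⟨(⟨a, ha⟩ : ↥(N ^ d)) ⊗ₜ v, rfl⟩
  have hWmono : Monotone W := by
    intro m n hmn
    rintro _ ⟨t, rfl⟩
    induction t with
    | zero => simp
    | add s t hs ht => rw [map_add]; exact add_mem hs ht
    | tmul a v => exact hWmem (hmono hmn a.2) v
  have hWex (t : M ⊗[k] V) : ∃ d, t ∈ W d := by
    induction t with
    | zero => exact ⟨0, zero_mem _⟩
    | add s t hs ht =>
      obtain ⟨m, hm⟩ := hs
      obtain ⟨n, hn⟩ := ht
      exact ⟨max m n, add_mem (hWmono (le_max_left m n) hm) (hWmono (le_max_right m n) hn)⟩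
    | tmul a v =>
      obtain ⟨d, hd⟩ := hex a
      exact ⟨d, hWmem hd v⟩
  have hWmul {d : ℕ} {a : M} (ha : a ∈ N) {t : M ⊗[k] V} (ht : t ∈ W d) :
      (LinearMap.mulLeft k a).rTensor V t ∈ W (d + 1) := by
    obtain ⟨t, rfl⟩ := ht
    induction t with
    | zero => simp
    | add s t hs ht => simp only [map_add]; exact add_mem hs ht
    | tmul b v =>
      refine hWmem ?_ v
      rw [pow_succ']
      exact Submodule.mul_mem_mul ha b.2
  have hpass (a : M) (t : M ⊗[k] V) : l ((LinearMap.mulLeft k a).rTensor V t) =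
      (LinearMap.mul' k M).lTensor V (passLeft l M a (l t)) := by
    induction t with
    | zero => simp
    | add s t hs ht => simp only [map_add, hs, ht]
    | tmul b v => exact hmul.apply (a ⊗ₜ b) v
  have hpass' (a b : M) (v : V) : (LinearMap.mul' k M).lTensor V (passLeft l M a (v ⊗ₜ b)) =
      (LinearMap.mulRight k b).lTensor V (l (a ⊗ₜ v)) := by
    rw [passLeft_tmul]
    generalize l (a ⊗ₜ v) = t
    induction t with
    | zero => simp
    | add s t hs ht => simp only [map_add, TensorProduct.add_tmul, hs, ht]
    | tmul x m => simp
  -- If `v ⊗ b = l t`, then right multiplication of `l (a ⊗ v)` by `b` gives `l (a t)`, by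
  -- functoriality. So a preimage for a product is assembled from preimages for its factors, and the
  -- degree rises by one.
  have hstep {d : ℕ} {b : M} (hb : ∀ v, v ⊗ₜ b ∈ (W d).map l) (s : N ⊗[k] V) :
      (LinearMap.mulRight k b).lTensor V (l (N.subtype.rTensor V s)) ∈ (W (d + 1)).map l := by
    induction s with
    | zero => simp
    | add s t hs ht => simp only [map_add]; exact add_mem hs ht
    | tmul a v =>
      obtain ⟨t, ht, htv⟩ := hb v
      refine ⟨_, hWmul a.2 ht, ?_⟩
      rw [hpass, htv, hpass']
      rfl
  have hN1 (a : M) (ha : a ∈ N) (v : V) : ∃ s : N ⊗[k] V, l (N.subtype.rTensor V s) = v ⊗ₜ a := by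
    induction ha using Submodule.span_induction with
    | mem x hx =>
      rcases hx with rfl | hx
      · exact ⟨(⟨1, Submodule.subset_span (Set.mem_insert _ _)⟩ : N) ⊗ₜ v, hone v⟩
      · obtain ⟨_, ⟨t, rfl⟩, ht⟩ := hgen v x hx
        refine ⟨(Submodule.inclusion (Submodule.span_mono (Set.subset_insert 1 s))).rTensor V t, ?_⟩
        rw [← ht, ← LinearMap.rTensor_comp_apply, Submodule.subtype_comp_inclusion]
    | zero => exact ⟨0, by simp⟩
    | add x y _ _ hx hy =>
      obtain ⟨s, hs⟩ := hx
      obtain ⟨t, ht⟩ := hy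
      exact ⟨s + t, by simp only [map_add, hs, ht, TensorProduct.tmul_add]⟩
    | smul r x _ hx =>
      obtain ⟨s, hs⟩ := hx
      exact ⟨r • s, by simp only [map_smul, hs, TensorProduct.tmul_smul]⟩
  have hsurj (d : ℕ) : ∀ m ∈ N ^ d, ∀ v, v ⊗ₜ m ∈ (W d).map l := by
    induction d with
    | zero =>
      intro m hm v
      rw [pow_zero] at hm
      obtain ⟨r, rfl⟩ := Submodule.mem_one.1 hm
      refine ⟨r • (1 ⊗ₜ v), Submodule.smul_mem _ _ (hWmem (by rw [pow_zero]; exact Submodule.one_le.1 le_rfl) v), ?_⟩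
      rw [map_smul, hone, Algebra.algebraMap_eq_smul_one, TensorProduct.tmul_smul]
    | succ d ih =>
      intro m hm
      rw [pow_succ'] at hm
      induction hm using Submodule.mul_induction_on' with
      | mem_mul_mem a ha b hb =>
        intro v
        obtain ⟨s, hs⟩ := hN1 a ha v
        have := hstep (ih b hb) s
        rwa [hs] at this
      | add x _ y _ hx hy =>
        intro v
        rw [TensorProduct.tmul_add]
        exact add_mem (hx v) (hy v)
  constructor
  -- The flip turns `l` into an endomorphism of `M ⊗ V`; surjectivity in each degree then says that
  -- each piece lies in its own image.
  · have := injective_of_exhaustion ((TensorProduct.comm k V M).toLinearMap ∘ₗ l) W hWex ?_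
    · exact Function.Injective.of_comp this
    · rintro d _ ⟨t, rfl⟩
      induction t with
      | zero => simp
      | add s t hs ht => rw [map_add]; exact add_mem hs ht
      | tmul a v =>
        obtain ⟨t, ht, htv⟩ := hsurj d a a.2 v
        exact ⟨t, ht, by simp [htv]⟩
  · intro t
    induction t with
    | zero => exact ⟨0, map_zero l⟩
    | add s t hs ht =>
      obtain ⟨a, rfl⟩ := hs
      obtain ⟨b, rfl⟩ := ht
      exact ⟨a + b, map_add l a b⟩
    | tmul v a =>
      obtain ⟨d, hd⟩ := hex a
      obtain ⟨t, _, ht⟩ := hsurj d a hd v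
      exact ⟨t, ht⟩

end Invertibility

/-! ### Bijectivity of the braidings of `M₁` past `A` -/

section RMatrixInvertibility

variable {k : Type u} [Field k] {ι : Type x} [Fintype ι] [DecidableEq ι]
  {A : Type v} [NonUnitalRing A] [Module k A]
  [IsScalarTower k A A] [SMulCommClass k A A] {e : Module.Basis ι k A}
  {R Q : Matrix (ι × ι) (ι × ι) k} {lV : A ⊗[k] A ≃ₗ[k] A ⊗[k] A}

theorem sum_smul_sum_of_mul_eq_one {P N : Type*} [Fintype P] [DecidableEq P] [AddCommGroup N]
    [Module k N] {A B : Matrix P P k} (h : A * B = 1) (Y : P → N) (s : P) :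
    ∑ p, A s p • ∑ q, B p q • Y q = Y s := by
  simp only [Finset.smul_sum, smul_smul]
  rw [Finset.sum_comm]
  simp only [← Finset.sum_smul, ← Matrix.mul_apply, h, Matrix.one_apply, ite_smul, one_smul,
    zero_smul, Finset.sum_ite_eq, Finset.mem_univ, if_true]

theorem adjoin_gen : Algebra.adjoin k (Set.range fun p : ι × ι ↦ gen e R p.1 p.2) = ⊤ := by
  rw [eq_top_iff]
  rintro a -
  induction a using M₁_induction with
  | algebraMap r => exact Subalgebra.algebraMap_mem _ r
  | gen i j => exact Algebra.subset_adjoin ⟨(i, j), rfl⟩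
  | mul a b ha hb => exact mul_mem ha hb
  | add a b ha hb => exact add_mem ha hb

theorem extension_apply (hQ : IsUnit Q) (hlV : IsBraidingOf e Q lV)
    {B : Type*} [AddCommGroup B] [Module k B] {u : ι → ι → B} {lB : B ⊗[k] A →ₗ[k] A ⊗[k] B}
    (hgen : ∀ i j x, lB (u i j ⊗ₜ x) = ∑ a, ∑ b,
      (opMatrix' e lV.symm.toLinearMap i a * opMatrix e lV.toLinearMap b j) x ⊗ₜ u a b)
    (i j h : ι) : lB (u i j ⊗ₜ e h) =
      ∑ m, ∑ a, ∑ b, ∑ n, (Q⁻¹ (i, m) (a, n) * Q (b, n) (j, h)) • (e m ⊗ₜ u a b) := by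
  simp only [hgen, Module.End.mul_apply, hlV.opMatrix_apply, map_sum, map_smul,
    hlV.opMatrix'_apply hQ, Finset.smul_sum, smul_smul, TensorProduct.sum_tmul,
    ← TensorProduct.smul_tmul']
  rw [Finset.sum_congr rfl fun a _ ↦ Finset.sum_congr rfl fun b _ ↦ Finset.sum_comm]
  rw [Finset.sum_congr rfl fun a _ ↦ Finset.sum_comm, Finset.sum_comm]
  simp only [mul_comm]

/-- On generators the braiding is a composite of two matrices: `Q`, acting on the pair of `j` and
the index of the basis vector, and `(Q⁻¹)^{t₂}`, acting on `i` and the contracted index. Inverting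
them in turn shows that every `e m ⊗ u` is reached. -/
theorem bijective_extension (hQ : IsUnit Q) (hQ' : IsUnit (transpose₂ Q⁻¹))
    (hlV : IsBraidingOf e Q lV) {lM : M₁ e R ⊗[k] A →ₗ[k] A ⊗[k] M₁ e R}
    (hone : ∀ v, lM (1 ⊗ₜ v) = v ⊗ₜ 1)
    (hmul : NatL (LinearMap.mul' k (M₁ e R)) (braidLeft lM lM) lM)
    (hgen : ∀ i j x, lM (gen e R i j ⊗ₜ x) = ∑ a, ∑ b,
      (opMatrix' e lV.symm.toLinearMap i a * opMatrix e lV.toLinearMap b j) x ⊗ₜ gen e R a b) :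
    Function.Bijective lM := by
  have : FiniteDimensional k A := e.finiteDimensional_of_finite
  refine bijective_of_generators hone hmul (Set.finite_range fun p : ι × ι ↦ gen e R p.1 p.2)
    adjoin_gen ?_
  set S := (LinearMap.range ((Submodule.span k (Set.range fun p : ι × ι ↦
    gen e R p.1 p.2)).subtype.rTensor A)).map lM with hS
  have hmem (i j h : ι) : lM (gen e R i j ⊗ₜ e h) ∈ S :=
    Submodule.mem_map_of_mem ⟨(⟨gen e R i j, Submodule.subset_span ⟨(i, j), rfl⟩⟩ :
      ↥(Submodule.span k (Set.range fun p : ι × ι ↦ gen e R p.1 p.2))) ⊗ₜ e h, rfl⟩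
  have hlM (i j h : ι) : lM (gen e R i j ⊗ₜ e h) = ∑ q : ι × ι, Q q (j, h) •
      ∑ p : ι × ι, transpose₂ Q⁻¹ (i, q.2) p • (e p.2 ⊗ₜ gen e R p.1 q.1) := by
    rw [extension_apply hQ hlV hgen]
    simp only [Fintype.sum_prod_type, Finset.smul_sum, smul_smul, transpose₂, Matrix.of_apply]
    rw [sum_rev₃]
    refine Finset.sum_congr rfl fun b _ ↦ (sum_rot₃ _).symm.trans ?_
    simp only [mul_comm]
  have h₁ (i c d : ι) : ∑ p : ι × ι, transpose₂ Q⁻¹ (i, d) p • (e p.2 ⊗ₜ gen e R p.1 c) ∈ S := by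
    have h : ∑ p : ι × ι, Q⁻¹ p (c, d) • lM (gen e R i p.1 ⊗ₜ e p.2) ∈ S :=
      sum_mem fun p _ ↦ S.smul_mem _ (hmem i p.1 p.2)
    simp only [hlM] at h
    have h₀ := sum_smul_sum_of_mul_eq_one (A := Q⁻¹.transpose) (B := Q.transpose)
      (by rw [← Matrix.transpose_mul,
        Matrix.mul_nonsing_inv Q ((Matrix.isUnit_iff_isUnit_det _).1 hQ), Matrix.transpose_one])
      (fun q : ι × ι ↦ ∑ p : ι × ι, transpose₂ Q⁻¹ (i, q.2) p • (e p.2 ⊗ₜ[k] gen e R p.1 q.1))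
      (c, d)
    exact h₀ ▸ h
  have h₂ (m a c : ι) : e m ⊗ₜ gen e R a c ∈ S := by
    have h := sum_smul_sum_of_mul_eq_one
      (Matrix.nonsing_inv_mul _ ((Matrix.isUnit_iff_isUnit_det _).1 hQ'))
      (fun p : ι × ι ↦ e p.2 ⊗ₜ[k] gen e R p.1 c) (a, m)
    rw [← h]
    exact sum_mem fun p _ ↦ S.smul_mem _ (h₁ p.1 c p.2)
  rintro v _ ⟨⟨a, c⟩, rfl⟩
  rw [← e.sum_repr v]
  simp only [TensorProduct.sum_tmul, ← TensorProduct.smul_tmul']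
  exact sum_mem fun m _ ↦ S.smul_mem _ (h₂ m a c)

end RMatrixInvertibility

/-! ### Naturality for inverse braidings -/

section InverseMovers

variable {k : Type u} [Field k]
  {V X B : Type*} [AddCommGroup V] [Module k V] [AddCommGroup X] [Module k X]
  [AddCommGroup B] [Module k B]

theorem NatL.symm_braidRight {f : B ⊗[k] V →ₗ[k] X} {Z : Type*} [AddCommGroup Z] [Module k Z]
    {a : B ⊗[k] Z ≃ₗ[k] Z ⊗[k] B} {b : V ⊗[k] Z ≃ₗ[k] Z ⊗[k] V} {c : X ⊗[k] Z ≃ₗ[k] Z ⊗[k] X}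
    (h : NatL f (braidLeft a.toLinearMap b.toLinearMap) c.toLinearMap) :
    NatR f (BraidedComeas.braidRight a.symm.toLinearMap b.symm.toLinearMap) c.symm.toLinearMap :=
  h.inverse (braidLeft_comp_braidRight a.comp_symm b.comp_symm) c.symm_comp

theorem NatR.symm_braidLeft {f : B ⊗[k] V →ₗ[k] X} {Z : Type*} [AddCommGroup Z] [Module k Z]
    {a : Z ⊗[k] B ≃ₗ[k] B ⊗[k] Z} {b : Z ⊗[k] V ≃ₗ[k] V ⊗[k] Z} {c : Z ⊗[k] X ≃ₗ[k] X ⊗[k] Z}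
    (h : NatR f (braidRight a.toLinearMap b.toLinearMap) c.toLinearMap) :
    NatL f (braidLeft a.symm.toLinearMap b.symm.toLinearMap) c.symm.toLinearMap :=
  h.inverse (braidRight_comp_braidLeft a.comp_symm b.comp_symm) c.symm_comp

end InverseMovers

/-! ### Unital movers and the uniqueness principle -/

section UnitalMovers

variable {k : Type u} [Field k] {ι : Type x} [Fintype ι] [DecidableEq ι]
  {A : Type v} [NonUnitalRing A] [Module k A]
  [IsScalarTower k A A] [SMulCommClass k A A] {e : Module.Basis ι k A}
  {R : Matrix (ι × ι) (ι × ι) k}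
  {X Y B : Type*} [AddCommGroup X] [Module k X] [AddCommGroup Y] [Module k Y]
  [AddCommGroup B] [Module k B]

variable (e R) in
/-- A braiding of `M₁` past `X` compatible with its unital algebra structure and comeasuring. -/
structure UnitalMover (lV : A ⊗[k] X →ₗ[k] X ⊗[k] A)
    (lM : M₁ e R ⊗[k] X →ₗ[k] X ⊗[k] M₁ e R) : Prop
    extends Mover (LinearMap.mul' k (M₁ e R)) (betaU e R) lV lM where
  one : ∀ x, lM (1 ⊗ₜ x) = x ⊗ₜ 1

theorem UnitalMover.braidRight {lV : A ⊗[k] X →ₗ[k] X ⊗[k] A}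
    {lM : M₁ e R ⊗[k] X →ₗ[k] X ⊗[k] M₁ e R} {lV' : A ⊗[k] Y →ₗ[k] Y ⊗[k] A}
    {lM' : M₁ e R ⊗[k] Y →ₗ[k] Y ⊗[k] M₁ e R} (h : UnitalMover e R lV lM)
    (h' : UnitalMover e R lV' lM') :
    UnitalMover e R (BraidedComeas.braidRight lV lV') (BraidedComeas.braidRight lM lM') where
  toMover := h.toMover.braidRight h'.toMover
  one t := by
    induction t with
    | zero => simp
    | add s t hs ht => simp only [map_add, TensorProduct.tmul_add, TensorProduct.add_tmul, hs, ht]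
    | tmul x y =>
      rw [braidRight_tmul, h.one, passRight_tmul, h'.one, TensorProduct.assoc_symm_tmul]

/-- The compatibility holds on `1`, is forced on generators by the two coactions, and passes to
products by functoriality. The target is any space with a product and a coaction, so the lemma
applies to `π`, to the coproduct and to characters alike. -/
theorem UnitalMover.natural {mB : B ⊗[k] B →ₗ[k] B} {βB : A →ₗ[k] A ⊗[k] B}
    {lVX : A ⊗[k] X →ₗ[k] X ⊗[k] A} {lMX : M₁ e R ⊗[k] X →ₗ[k] X ⊗[k] M₁ e R}
    {lVY : A ⊗[k] Y →ₗ[k] Y ⊗[k] A} {lBY : B ⊗[k] Y →ₗ[k] Y ⊗[k] B}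
    (hX : UnitalMover e R lVX lMX) (hY : Mover mB βB lVY lBY) (hinj : Function.Injective lVY)
    {π : M₁ e R →ₗ[k] B} (hπ : ∀ a b, π (a * b) = mB (π a ⊗ₜ π b))
    (hone : ∀ y, lBY (π 1 ⊗ₜ y) = y ⊗ₜ π 1)
    (hβ : βB = π.lTensor A ∘ₗ betaU e R) {f : X →ₗ[k] Y} (hf : NatR f lVX lVY)
    (a : M₁ e R) (x : X) : lBY (π a ⊗ₜ f x) = TensorProduct.map f π (lMX (a ⊗ₜ x)) := by
  induction a using M₁_induction generalizing x with
  | algebraMap r =>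
    simp only [Algebra.algebraMap_eq_smul_one, map_smul, ← TensorProduct.smul_tmul', hone, hX.one,
      TensorProduct.map_tmul]
  | gen i j =>
    exact mover_natural_gen hX.coact hY.coact hinj hβ hf e (fun j ↦ betaU_basis j) i j x
  | mul a b ha hb => exact mover_natural_mul hX.mul hY.mul hπ ha hb x
  | add a b ha hb => simp only [map_add, TensorProduct.add_tmul, ha, hb]

/-- Maps commuting with the braidings with `A` commute with the braidings with `M₁`. -/
theorem UnitalMover.natR {lVX : A ⊗[k] X →ₗ[k] X ⊗[k] A}
    {lMX : M₁ e R ⊗[k] X →ₗ[k] X ⊗[k] M₁ e R}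
    {lVY : A ⊗[k] Y →ₗ[k] Y ⊗[k] A} {lMY : M₁ e R ⊗[k] Y →ₗ[k] Y ⊗[k] M₁ e R}
    (hX : UnitalMover e R lVX lMX) (hY : UnitalMover e R lVY lMY)
    (hinj : Function.Injective lVY) {f : X →ₗ[k] Y} (hf : NatR f lVX lVY) : NatR f lMX lMY :=
  natR_of_apply fun a x ↦ hX.natural hY.toMover hinj (π := LinearMap.id) (fun _ _ ↦ rfl)
    (fun y ↦ hY.one y) (by simp) hf a x

theorem UnitalMover.inverse {lV : A ⊗[k] X ≃ₗ[k] X ⊗[k] A}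
    {l : M₁ e R ⊗[k] X →ₗ[k] X ⊗[k] M₁ e R} {h : X ⊗[k] M₁ e R →ₗ[k] M₁ e R ⊗[k] X}
    (hl : UnitalMover e R lV.toLinearMap l)
    (hcoact : NatR (betaU e R) lV.symm.toLinearMap (BraidedComeas.braidRight lV.symm.toLinearMap h))
    (hmul : NatR (LinearMap.mul' k (M₁ e R)) (BraidedComeas.braidRight h h) h)
    (hone : ∀ x, h (x ⊗ₜ 1) = 1 ⊗ₜ x) : h ∘ₗ l = LinearMap.id := by
  refine TensorProduct.ext' fun a x ↦ ?_
  change h (l (a ⊗ₜ x)) = a ⊗ₜ x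
  induction a using M₁_induction generalizing x with
  | algebraMap r =>
    simp only [Algebra.algebraMap_eq_smul_one, map_smul, ← TensorProduct.smul_tmul', hone, hl.one]
  | gen i j => exact mover_inverse_gen hl.coact hcoact e (fun j ↦ betaU_basis j) i j x
  | mul a b ha hb => exact mover_inverse_mul hl.mul hmul ha hb x
  | add a b ha hb => simp only [map_add, TensorProduct.add_tmul, ha, hb]

theorem braidRight_injective {Z : Type*} [AddCommGroup Z] [Module k Z]
    (a : Z ⊗[k] X ≃ₗ[k] X ⊗[k] Z) (b : Z ⊗[k] Y ≃ₗ[k] Y ⊗[k] Z) :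
    Function.Injective (braidRight a.toLinearMap b.toLinearMap) :=
  (braidLeftEquiv a.symm b.symm).symm.injective

theorem UnitalMover.one_symm {X : Type*} [AddCommGroup X] [Module k X]
    {lV : A ⊗[k] X →ₗ[k] X ⊗[k] A} {lM : M₁ e R ⊗[k] X ≃ₗ[k] X ⊗[k] M₁ e R}
    (h : UnitalMover e R lV lM.toLinearMap) (x : X) : lM.symm (x ⊗ₜ 1) = 1 ⊗ₜ x := by
  rw [LinearEquiv.symm_apply_eq]
  exact (h.one x).symm

theorem unitalMover_unit :
    UnitalMover e R (unitBraidRight k A) (unitBraidRight k (M₁ e R)) where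
  mul := by
    refine natL_of_apply fun t r ↦ ?_
    induction t with
    | zero => simp
    | add s t hs ht => simp only [map_add, TensorProduct.add_tmul, hs, ht]
    | tmul a b => simp [braidLeft_tmul, passLeft_tmul]
  coact := by
    refine natL_of_apply fun a r ↦ ?_
    simp only [LinearEquiv.coe_coe, TensorProduct.comm_tmul, LinearMap.lTensor_tmul]
    generalize betaU e R a = t
    induction t with
    | zero => simp
    | add s t hs ht => simp only [map_add, TensorProduct.add_tmul, TensorProduct.tmul_add, hs, ht]
    | tmul a b => simp [braidLeft_tmul, passLeft_tmul]
  one r := by simp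

/-- The unit is a map `k → B`, and `M₁` is braided trivially past `k`. Commuting with the braidings
of `A` therefore suffices. -/
theorem UnitalMover.apply_one {B : Type*} [Ring B] [Algebra k B] {lV : A ⊗[k] B →ₗ[k] B ⊗[k] A}
    {lM : M₁ e R ⊗[k] B →ₗ[k] B ⊗[k] M₁ e R} (h : UnitalMover e R lV lM)
    (hinj : Function.Injective lV) (hV : ∀ a, lV (a ⊗ₜ 1) = 1 ⊗ₜ a) (m : M₁ e R) :
    lM (m ⊗ₜ 1) = 1 ⊗ₜ m := by
  have hf : NatR (Algebra.linearMap k B) (unitBraidRight k A) lV := natR_of_apply fun a r ↦ by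
    simp [Algebra.algebraMap_eq_smul_one, hV, TensorProduct.smul_tmul']
  simpa using (unitalMover_unit.natR h hinj hf).apply m 1

end UnitalMovers

/-! ### Construction of the braidings of `M₁` -/

section Braidings

variable {k : Type u} [Field k] {ι : Type x} [Fintype ι] [DecidableEq ι]
  {A : Type v} [NonUnitalRing A] [Module k A]
  [IsScalarTower k A A] [SMulCommClass k A A] {e : Module.Basis ι k A}
  {R : Matrix (ι × ι) (ι × ι) k} {Ψ : A ⊗[k] A ≃ₗ[k] A ⊗[k] A}

theorem IsBraidingOf.symm (hR : IsUnit R) (h : IsBraidingOf e R Ψ) :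
    IsBraidingOf e (R⁻¹.submatrix Prod.swap Prod.swap) Ψ.symm := by
  intro i j
  rw [h.symm_apply hR, Finset.sum_comm]
  rfl

theorem isUnit_swap (hR : IsUnit R) : IsUnit (R⁻¹.submatrix Prod.swap Prod.swap) := by
  have h := Matrix.nonsing_inv_mul R ((Matrix.isUnit_iff_isUnit_det _).1 hR)
  refine IsUnit.of_mul_eq_one (R.submatrix Prod.swap Prod.swap) ?_
  change R⁻¹.submatrix (Equiv.prodComm ι ι) (Equiv.prodComm ι ι) *
    R.submatrix (Equiv.prodComm ι ι) (Equiv.prodComm ι ι) = 1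
  rw [Matrix.submatrix_mul_equiv, h]
  exact Matrix.submatrix_one_equiv (Equiv.prodComm ι ι)

/-- The matrix of `Ψ⁻¹` is `R₂₁⁻¹`, and the `t₂`-transpose of its inverse `R₂₁` is the full
transpose of `R^{t₂}` with legs exchanged. So for `Ψ⁻¹`, unlike `Ψ`, the existence of `R̃` is
directly what is needed. -/
theorem isUnit_transpose₂_swap (hR : IsBiinvertible R) :
    IsUnit (transpose₂ (R⁻¹.submatrix Prod.swap Prod.swap)⁻¹) := by
  have h₁ : (R⁻¹.submatrix Prod.swap Prod.swap)⁻¹ = R.submatrix Prod.swap Prod.swap := by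
    refine Matrix.inv_eq_left_inv ?_
    change R.submatrix (Equiv.prodComm ι ι) (Equiv.prodComm ι ι) *
      R⁻¹.submatrix (Equiv.prodComm ι ι) (Equiv.prodComm ι ι) = 1
    rw [Matrix.submatrix_mul_equiv,
      Matrix.mul_nonsing_inv R ((Matrix.isUnit_iff_isUnit_det _).1 hR.1)]
    exact Matrix.submatrix_one_equiv (Equiv.prodComm ι ι)
  have h₂ : transpose₂ (R.submatrix Prod.swap Prod.swap) =
      (transpose₂ R).transpose.submatrix (Equiv.prodComm ι ι) (Equiv.prodComm ι ι) := rfl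
  rw [h₁, h₂, Matrix.isUnit_submatrix_equiv, Matrix.isUnit_transpose]
  exact hR.2

/-- The braidings of `M₁` with `A` and with itself. -/
structure M₁Braidings (e : Module.Basis ι k A) (R : Matrix (ι × ι) (ι × ι) k)
    (Ψ : A ⊗[k] A ≃ₗ[k] A ⊗[k] A) where
  /-- The braiding of `M₁` past `A`. -/
  MA : M₁ e R ⊗[k] A ≃ₗ[k] A ⊗[k] M₁ e R
  /-- The braiding of `A` past `M₁`. -/
  AM : A ⊗[k] M₁ e R ≃ₗ[k] M₁ e R ⊗[k] A
  /-- The braiding of `M₁` with itself. -/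
  MM : M₁ e R ⊗[k] M₁ e R ≃ₗ[k] M₁ e R ⊗[k] M₁ e R
  mover_A : UnitalMover e R Ψ.toLinearMap MA.toLinearMap
  mover_A_symm : UnitalMover e R Ψ.symm.toLinearMap AM.symm.toLinearMap
  mover_M : UnitalMover e R AM.toLinearMap MM.toLinearMap
  mover_M_symm : UnitalMover e R MA.symm.toLinearMap MM.symm.toLinearMap
  MA_gen : ∀ i j h, MA (gen e R i j ⊗ₜ e h) =
    ∑ m, ∑ a, ∑ b, ∑ n, (R⁻¹ (i, m) (a, n) * R (b, n) (j, h)) • (e m ⊗ₜ gen e R a b)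

/-- To extend `N⁻¹` from `A` to `M₁`, its braid relation with `Ψ` and its functoriality are needed.
Both say that a map between tensor powers of `A` commutes with `N`, which the uniqueness principle
deduces from the same statement about `Φ`. -/
theorem UnitalMover.exists_mover (hR : IsBiinvertible R) (hΨR : IsBraidingOf e R Ψ)
    {Φ : A ⊗[k] A ≃ₗ[k] A ⊗[k] A} {N : M₁ e R ⊗[k] A ≃ₗ[k] A ⊗[k] M₁ e R}
    (hN : UnitalMover e R Φ.toLinearMap N.toLinearMap)
    (hΦ : BraidRelation Φ.toLinearMap Φ.toLinearMap Ψ.toLinearMap)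
    (hmul : NatR (LinearMap.mul' k A) (BraidedComeas.braidRight Φ.toLinearMap Φ.toLinearMap)
      Φ.toLinearMap) :
    ∃ l, UnitalMover e R N.symm.toLinearMap l := by
  have hAAB : BraidRelation Ψ.toLinearMap N.symm.toLinearMap N.symm.toLinearMap := by
    have h := (hN.braidRight hN).natR (hN.braidRight hN) (braidRight_injective _ _)
      (braidRelation_iff_natR.1 hΦ)
    exact (braidRelation_iff_natR.2 h).symm_left.symm_right
  have hmulN : NatL (LinearMap.mul' k A) (braidLeft N.symm.toLinearMap N.symm.toLinearMap)
      N.symm.toLinearMap :=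
    NatR.symm_braidLeft ((hN.braidRight hN).natR hN Φ.injective hmul)
  obtain ⟨l, h1, hm, -⟩ := exists_extension hR.1 hΨR N.symm hAAB hmulN
  exact ⟨l, hm, h1⟩

/-- The composite is the identity on generators because `β_U` is natural for both candidates, with
mutually inverse braidings on the `A` factor; functoriality does the rest. -/
theorem UnitalMover.inverse_movers {Φ : A ⊗[k] A ≃ₗ[k] A ⊗[k] A}
    {P N : M₁ e R ⊗[k] A ≃ₗ[k] A ⊗[k] M₁ e R}
    (hP : UnitalMover e R Φ.toLinearMap P.toLinearMap)
    (hN : UnitalMover e R Φ.symm.toLinearMap N.toLinearMap)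
    {lq lr : M₁ e R ⊗[k] M₁ e R →ₗ[k] M₁ e R ⊗[k] M₁ e R}
    (hq : UnitalMover e R N.symm.toLinearMap lq) (hr : UnitalMover e R P.symm.toLinearMap lr) :
    lq ∘ₗ lr = LinearMap.id := by
  have hβ : NatR (betaU e R) Φ.toLinearMap
      (BraidedComeas.braidRight Φ.toLinearMap N.symm.toLinearMap) :=
    NatL.inverse hN.coact Φ.symm_comp (braidRight_comp_braidLeft Φ.comp_symm N.symm_comp)
  refine hr.inverse ?_ ?_ (hq.apply_one N.symm.injective hN.one_symm)
  · exact hP.natR (hP.braidRight hq) (braidRight_injective Φ N.symm) hβ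
  · exact (hq.braidRight hq).natR hq N.symm.injective (NatL.symm_braidRight hN.mul)

/-- Naturality when `A` is braided past `M₁` is naturality for the inverse crossing, which restricts
to `Ψ⁻¹` on `A`. So `AM` is the inverse of the extension of `Ψ⁻¹`. The self-braiding of `M₁` extends
`AM`, and its inverse extends the inverse of `MA`. -/
theorem nonempty_braidings (hR : IsBiinvertible R) (hΨR : IsBraidingOf e R Ψ)
    (hΨ : IsBraidedAlgebra Ψ) : Nonempty (M₁Braidings e R Ψ) := by
  have hY := hΨ.braid
  have hΨ' : BraidRelation Ψ.symm.toLinearMap Ψ.toLinearMap Ψ.toLinearMap := hY.symm_left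
  have hΨ'' : BraidRelation Ψ.toLinearMap Ψ.symm.toLinearMap Ψ.symm.toLinearMap := hΨ'.symm_right
  have hΨ₃ : BraidRelation Ψ.symm.toLinearMap Ψ.symm.toLinearMap Ψ.toLinearMap := hY.symm_right.symm_left
  have hmul : NatL (LinearMap.mul' k A) (braidLeft Ψ.toLinearMap Ψ.toLinearMap) Ψ.toLinearMap :=
    hΨ.mul_natural.1
  have hmul' : NatR (LinearMap.mul' k A) (braidRight Ψ.toLinearMap Ψ.toLinearMap) Ψ.toLinearMap :=
    hΨ.mul_natural.2
  obtain ⟨lp, hp1, hpm, hpg⟩ := exists_extension hR.1 hΨR Ψ hY hmul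
  obtain ⟨ln, hn1, hnm, hng⟩ := exists_extension hR.1 hΨR Ψ.symm hΨ'' (NatR.symm_braidLeft hmul')
  have hpb := bijective_extension hR.1 (isUnit_transpose₂_inv hR hΨR hY) hΨR hp1 hpm.mul hpg
  have hnb := bijective_extension (isUnit_swap hR.1) (isUnit_transpose₂_swap hR)
    (hΨR.symm hR.1) hn1 hnm.mul hng
  have hpU : UnitalMover e R Ψ.toLinearMap lp := ⟨hpm, hp1⟩
  have hnU : UnitalMover e R Ψ.symm.toLinearMap ln := ⟨hnm, hn1⟩
  obtain ⟨MA, rfl⟩ : ∃ MA : M₁ e R ⊗[k] A ≃ₗ[k] A ⊗[k] M₁ e R, MA.toLinearMap = lp :=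
    ⟨LinearEquiv.ofBijective lp hpb, rfl⟩
  obtain ⟨NA, rfl⟩ : ∃ MA : M₁ e R ⊗[k] A ≃ₗ[k] A ⊗[k] M₁ e R, MA.toLinearMap = ln :=
    ⟨LinearEquiv.ofBijective ln hnb, rfl⟩
  obtain ⟨lq, hqU⟩ := hnU.exists_mover hR hΨR hΨ₃ (NatL.symm_braidRight hmul)
  obtain ⟨lr, hrU⟩ := hpU.exists_mover hR hΨR hY hmul'
  have hqr : lq ∘ₗ lr = LinearMap.id := hpU.inverse_movers hnU hqU hrU
  have hrq : lr ∘ₗ lq = LinearMap.id := hnU.inverse_movers (Φ := Ψ.symm) hpU hrU hqU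
  exact ⟨{
    MA := MA
    AM := NA.symm
    MM := LinearEquiv.ofLinearMap lq lr hqr hrq
    mover_A := hpU
    mover_A_symm := hnU
    mover_M := hqU
    mover_M_symm := hrU
    MA_gen := extension_apply hR.1 hΨR hpg }⟩

end Braidings

/-! ### Braidings of matrix elements are determined -/

section Coefficients

variable {k : Type u} [Field k] {ι : Type x} [Fintype ι] [DecidableEq ι]
  {V X B : Type*} [AddCommGroup V] [Module k V] [AddCommGroup X] [Module k X]
  [AddCommGroup B] [Module k B]

/-- A braiding compatible with a comeasuring map is determined on the matrix elements of the
latter. -/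
theorem apply_of_coact {e : Module.Basis ι k V} {βB : V →ₗ[k] V ⊗[k] B} {u : ι → ι → B}
    (hu : ∀ j, βB (e j) = ∑ a, e a ⊗ₜ u a j) {l : V ⊗[k] X ≃ₗ[k] X ⊗[k] V}
    {lB : B ⊗[k] X →ₗ[k] X ⊗[k] B} (h : NatL βB l.toLinearMap (braidLeft l.toLinearMap lB))
    (i j : ι) (x : X) : lB (u i j ⊗ₜ x) = ∑ a, ∑ b,
      (opMatrix' e l.symm.toLinearMap i a * opMatrix e l.toLinearMap b j) x ⊗ₜ u a b := by
  set Q := opMatrix e l.toLinearMap with hQ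
  set P := opMatrix' e l.symm.toLinearMap
  refine congrFun (sum_basis_tmul_injective e (y := fun i ↦ lB (u i j ⊗ₜ x))
    (y' := fun i ↦ ∑ a, ∑ b, (P i a * Q b j) x ⊗ₜ u a b)
    (passLeft_injective (B := B) l.injective ?_)) i
  have h₁ := h.apply (e j) x
  rw [hu, apply_basis_tmul] at h₁
  simp only [TensorProduct.sum_tmul, map_sum, braidLeft_tmul, LinearMap.lTensor_tmul, hu,
    TensorProduct.tmul_sum] at h₁
  have hQP (d b : ι) : ∑ a, Q d a * P a b = if d = b then 1 else 0 := by
    rw [← Matrix.mul_apply, opMatrix_mul_opMatrix' e l, Matrix.one_apply]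
  rw [map_sum, map_sum]
  refine h₁.trans ?_
  symm
  calc ∑ a, passLeft l.toLinearMap B (e a) (∑ b, ∑ c, (P a b * Q c j) x ⊗ₜ u b c)
      = ∑ c, ∑ b, ∑ d, ((∑ a, Q d a * P a b) * Q c j) x ⊗ₜ[k] (e d ⊗ₜ[k] u b c) := by
        simp only [map_sum, passLeft_tmul, apply_basis_tmul, TensorProduct.sum_tmul,
          TensorProduct.assoc_tmul, Finset.sum_mul, LinearMap.sum_apply, mul_assoc]
        rw [Finset.sum_congr rfl fun a _ ↦ Finset.sum_comm, Finset.sum_comm]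
        refine Finset.sum_congr rfl fun c _ ↦ ?_
        rw [Finset.sum_comm]
        refine Finset.sum_congr rfl fun b _ ↦ ?_
        rw [Finset.sum_comm]
        rfl
    _ = _ := by
      refine Finset.sum_congr rfl fun c _ ↦ Finset.sum_congr rfl fun b _ ↦ ?_
      rw [Finset.sum_eq_single b]
      · rw [hQP, if_pos rfl, one_mul]
      · intro d _ hd
        simp [hQP, hd]
      · simp

end Coefficients

/-! ### Multiplicative coactions and the defining relations -/

section Products

theorem sum_swap_ends {ι M : Type*} [Fintype ι] [AddCommMonoid M]
    (F : ι → ι → ι → ι → ι → ι → ι → M) :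
    ∑ f, ∑ a, ∑ b, ∑ c, ∑ p, ∑ d, ∑ l, F l a b c d p f =
      ∑ l, ∑ a, ∑ b, ∑ c, ∑ d, ∑ p, ∑ f, F l a b c d p f := by
  simp only [← Fintype.sum_prod_type']
  exact Fintype.sum_equiv ⟨fun q ↦ (q.2.2.2.2.2.2, q.2.1, q.2.2.1, q.2.2.2.1, q.2.2.2.2.2.1,
    q.2.2.2.2.1, q.1), fun q ↦ (q.2.2.2.2.2.2, q.2.1, q.2.2.1, q.2.2.2.1, q.2.2.2.2.2.1,
    q.2.2.2.2.1, q.1), fun _ ↦ rfl, fun _ ↦ rfl⟩ _ _ fun _ ↦ rfl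

variable {k : Type u} [Field k] {ι : Type x} [Fintype ι] [DecidableEq ι]
  {A : Type v} [NonUnitalRing A] [Module k A]
  [IsScalarTower k A A] [SMulCommClass k A A] {e : Module.Basis ι k A}
  {R : Matrix (ι × ι) (ι × ι) k} {Ψ : A ⊗[k] A ≃ₗ[k] A ⊗[k] A}
  {B : Type*} [AddCommGroup B] [Module k B]

/-- A comeasuring map is multiplicative if and only if its matrix elements satisfy the defining
relations of `M₁`. -/
theorem coact_mul_iff {mB : B ⊗[k] B →ₗ[k] B} {βB : A →ₗ[k] A ⊗[k] B} {u : ι → ι → B}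
    (hu : ∀ j, βB (e j) = ∑ a, e a ⊗ₜ u a j) {lB : B ⊗[k] A →ₗ[k] A ⊗[k] B}
    (hl : ∀ i j h, lB (u i j ⊗ₜ e h) =
      ∑ m, ∑ a, ∑ b, ∑ n, (R⁻¹ (i, m) (a, n) * R (b, n) (j, h)) • (e m ⊗ₜ u a b)) :
    βB ∘ₗ LinearMap.mul' k A = bmul (LinearMap.mul' k A) mB lB ∘ₗ TensorProduct.map βB βB ↔
      ∀ i j l, ∑ a, structConst e i j a • u l a = ∑ a, ∑ b, ∑ c, ∑ d, ∑ p, ∑ f,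
        (structConst e a b l * R⁻¹ (a, b) (c, d) * R (p, d) (i, f)) • mB (u c p ⊗ₜ u f j) := by
  have hmul (i j : ι) : e i * e j = ∑ c, structConst e i j c • e c := (e.sum_repr _).symm
  have h₁ (i j : ι) : βB (e i * e j) = ∑ l, e l ⊗ₜ ∑ a, structConst e i j a • u l a := by
    simp only [hmul, map_sum, map_smul, hu, TensorProduct.tmul_sum, TensorProduct.tmul_smul,
      Finset.smul_sum]
    rw [Finset.sum_comm]
  have h₂ (i j : ι) : bmul (LinearMap.mul' k A) mB lB (βB (e i) ⊗ₜ βB (e j)) =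
      ∑ l, e l ⊗ₜ ∑ a, ∑ b, ∑ c, ∑ d, ∑ p, ∑ f,
        (structConst e a b l * R⁻¹ (a, b) (c, d) * R (p, d) (i, f)) • mB (u c p ⊗ₜ u f j) := by
    simp only [hu, TensorProduct.sum_tmul, TensorProduct.tmul_sum, map_sum, bmul_tmul, hl,
      map_smul, sandwich_tmul, LinearMap.mul'_apply, hmul, TensorProduct.sum_tmul,
      TensorProduct.tmul_smul, ← TensorProduct.smul_tmul', Finset.smul_sum, smul_smul]
    refine (sum_swap_ends _).trans ?_
    simp only [mul_comm, mul_assoc]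
  constructor
  · intro h i j l
    have h₃ := LinearMap.congr_fun h (e i ⊗ₜ e j)
    simp only [LinearMap.comp_apply, LinearMap.mul'_apply, TensorProduct.map_tmul, h₁, h₂] at h₃
    exact congrFun (sum_basis_tmul_injective e h₃) l
  · intro h
    refine TensorProduct.ext (e.ext fun i ↦ e.ext fun j ↦ ?_)
    simp only [LinearMap.compr₂ₛₗ_apply, TensorProduct.mk_apply, LinearMap.comp_apply,
      LinearMap.mul'_apply, TensorProduct.map_tmul, h₁, h₂, h]

end Products

/-! ### The comeasuring by `M₁` -/

section Universal

variable {k : Type u} [Field k] {ι : Type x} [Fintype ι] [DecidableEq ι]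
  {A : Type v} [NonUnitalRing A] [Module k A]
  [IsScalarTower k A A] [SMulCommClass k A A] {e : Module.Basis ι k A}
  {R : Matrix (ι × ι) (ι × ι) k} {Ψ : A ⊗[k] A ≃ₗ[k] A ⊗[k] A}

/-- Functoriality when `Z` is braided past `B` is functoriality of the inverse braiding of `B` past
`Z`. Both halves thus become statements about movers. -/
theorem MulNatural.of_symm {B Z : Type*} [NonUnitalRing B] [Module k B]
    [IsScalarTower k B B] [SMulCommClass k B B] [AddCommGroup Z] [Module k Z]
    {a : B ⊗[k] Z ≃ₗ[k] Z ⊗[k] B} {b : Z ⊗[k] B ≃ₗ[k] B ⊗[k] Z}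
    (ha : NatL (LinearMap.mul' k B) (braidLeft a.toLinearMap a.toLinearMap) a.toLinearMap)
    (hb : NatL (LinearMap.mul' k B) (braidLeft b.symm.toLinearMap b.symm.toLinearMap)
      b.symm.toLinearMap) : MulNatural a.toLinearMap b.toLinearMap :=
  ⟨ha, hb.inverse (braidLeft_comp_braidRight b.symm_comp b.symm_comp) b.comp_symm⟩

theorem naturalWith_of_symm {V B Z : Type*} [AddCommGroup V] [Module k V]
    [AddCommGroup B] [Module k B] [AddCommGroup Z] [Module k Z] {β : V →ₗ[k] V ⊗[k] B}
    {a : V ⊗[k] Z ≃ₗ[k] Z ⊗[k] V} {b : B ⊗[k] Z ≃ₗ[k] Z ⊗[k] B}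
    {c : Z ⊗[k] V ≃ₗ[k] V ⊗[k] Z} {d : Z ⊗[k] B ≃ₗ[k] B ⊗[k] Z}
    (h : NatL β a.toLinearMap (braidLeft a.toLinearMap b.toLinearMap))
    (h' : NatL β c.symm.toLinearMap (braidLeft c.symm.toLinearMap d.symm.toLinearMap)) :
    NaturalWith β a.toLinearMap (braidLeft a.toLinearMap b.toLinearMap)
      c.toLinearMap (braidRight c.toLinearMap d.toLinearMap) :=
  ⟨h, h'.inverse c.symm_comp (braidRight_comp_braidLeft c.comp_symm d.comp_symm)⟩

/-- The universal comeasuring built from braidings of `M₁`. -/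
def M₁Braidings.comeasuring (D : M₁Braidings e R Ψ) (hΨ : IsBraidedAlgebra Ψ) :
    Comeasuring k Ψ (M₁ e R) :=
  have hY := hΨ.braid
  -- The last crossing of each relation is a map that already commutes with the braidings of `A`,
  -- and hence with those of `M₁`. When the first object is to be `A` and the second `M₁`, the
  -- relation is proved with the first crossing inverted, so that `M₁` comes first, and then turned
  -- around.
  have hABA : BraidRelation D.AM.toLinearMap Ψ.toLinearMap D.MA.toLinearMap :=
    BraidRelation.symm_left (a := D.AM.symm) <| braidRelation_iff_natR.2 <|
      (D.mover_A_symm.braidRight D.mover_A).natR (D.mover_A.braidRight D.mover_A_symm)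
        (braidRight_injective _ _) (braidRelation_iff_natR.1 hY.symm_left)
  have hAAB : BraidRelation Ψ.toLinearMap D.AM.toLinearMap D.AM.toLinearMap := by
    have hΨ₃ : BraidRelation Ψ.symm.toLinearMap Ψ.symm.toLinearMap Ψ.toLinearMap :=
      hY.symm_right.symm_left
    have h := (D.mover_A_symm.braidRight D.mover_A_symm).natR
      (D.mover_A_symm.braidRight D.mover_A_symm) (braidRight_injective _ _)
      (braidRelation_iff_natR.1 hΨ₃)
    exact (BraidRelation.symm_left (a := D.AM.symm)
      (braidRelation_iff_natR.2 h)).symm_right (c := D.AM.symm)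
  have hBAA := braidRelation_iff_natR.2 <|
    (D.mover_A.braidRight D.mover_A).natR (D.mover_A.braidRight D.mover_A)
      (braidRight_injective _ _) (braidRelation_iff_natR.1 hY)
  have hABB : BraidRelation D.AM.toLinearMap D.AM.toLinearMap D.MM.toLinearMap :=
    BraidRelation.symm_left (a := D.AM.symm) <| braidRelation_iff_natR.2 <|
      (D.mover_A_symm.braidRight D.mover_M).natR (D.mover_M.braidRight D.mover_A_symm)
        (braidRight_injective _ _) (braidRelation_iff_natR.1 hAAB.symm_left)
  { ΨBB := D.MM
    ΨAB := D.AM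
    ΨBA := D.MA
    β := betaU e R
    braid_AAB := hAAB
    braid_ABA := hABA
    braid_BAA := hBAA
    braid_ABB := hABB
    braid_BAB := braidRelation_iff_natR.2 <|
      (D.mover_A.braidRight D.mover_M).natR (D.mover_M.braidRight D.mover_A)
        (braidRight_injective _ _) (braidRelation_iff_natR.1 hAAB)
    braid_BBA := braidRelation_iff_natR.2 <|
      (D.mover_M.braidRight D.mover_A).natR (D.mover_A.braidRight D.mover_M)
        (braidRight_injective _ _) (braidRelation_iff_natR.1 hABA)
    braid_BBB := braidRelation_iff_natR.2 <|
      (D.mover_M.braidRight D.mover_M).natR (D.mover_M.braidRight D.mover_M)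
        (braidRight_injective _ _) (braidRelation_iff_natR.1 hABB)
    mul_natural_AB := by
      refine ⟨?_, ?_⟩
      · exact NatR.inverse ((D.mover_A_symm.braidRight D.mover_A_symm).natR D.mover_A_symm
          Ψ.symm.injective (NatL.symm_braidRight hΨ.mul_natural.1))
          (braidRight_comp_braidLeft D.AM.symm_comp D.AM.symm_comp) D.AM.comp_symm
      · exact (D.mover_A.braidRight D.mover_A).natR D.mover_A Ψ.injective hΨ.mul_natural.2
    mul_natural_BA := .of_symm D.mover_A.mul D.mover_A_symm.mul
    mul_natural_BB := .of_symm D.mover_M.mul D.mover_M_symm.mul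
    β_natural_A := naturalWith_of_symm D.mover_A.coact D.mover_A_symm.coact
    β_natural_B := naturalWith_of_symm D.mover_M.coact D.mover_M_symm.coact
    β_mul := (coact_mul_iff (fun j ↦ betaU_basis j) D.MA_gen).2 fun i j l ↦
      isSolution_gen e R i j l }

theorem unitNatural_of_apply {B Z : Type*} [Ring B] [Algebra k B] [AddCommGroup Z] [Module k Z]
    {a : B ⊗[k] Z →ₗ[k] Z ⊗[k] B} {b : Z ⊗[k] B →ₗ[k] B ⊗[k] Z}
    (ha : ∀ z, a (1 ⊗ₜ z) = z ⊗ₜ 1) (hb : ∀ z, b (z ⊗ₜ 1) = 1 ⊗ₜ z) : UnitNatural a b := by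
  refine ⟨natL_of_apply fun r z ↦ ?_, natR_of_apply fun r z ↦ ?_⟩
  · simp [Algebra.algebraMap_eq_smul_one, ← TensorProduct.smul_tmul', ha]
  · simp [Algebra.algebraMap_eq_smul_one, hb, TensorProduct.smul_tmul']

theorem M₁Braidings.unit_natural_A (D : M₁Braidings e R Ψ) :
    UnitNatural D.MA.toLinearMap D.AM.toLinearMap :=
  unitNatural_of_apply D.mover_A.one D.mover_A_symm.one_symm

theorem M₁Braidings.unit_natural_M (D : M₁Braidings e R Ψ) :
    UnitNatural D.MM.toLinearMap D.MM.toLinearMap :=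
  unitNatural_of_apply D.mover_M.one D.mover_M_symm.one_symm

theorem M₁Braidings.isUnital (D : M₁Braidings e R Ψ) (hΨ : IsBraidedAlgebra Ψ) :
    (D.comeasuring hΨ).IsUnital :=
  ⟨D.unit_natural_A, D.unit_natural_M⟩

end Universal

/-! ### Explicit formulas for the braidings -/

section Components

theorem sum_perm₄ {ι M : Type*} [Fintype ι] [AddCommMonoid M]
    (F : ι → ι → ι → ι → M) :
    ∑ n, ∑ a, ∑ m, ∑ b, F n a m b =
      ∑ a, ∑ b, ∑ m, ∑ n, F n a m b := by
  simp only [← Fintype.sum_prod_type']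
  exact Fintype.sum_equiv ⟨fun q ↦ (q.2.1, q.2.2.2, q.2.2.1, q.1),
    fun q ↦ (q.2.2.2, q.1, q.2.2.1, q.2.1),
    fun _ ↦ rfl, fun _ ↦ rfl⟩ _ _ fun _ ↦ rfl


theorem sum_perm₅ {ι M : Type*} [Fintype ι] [AddCommMonoid M]
    (F : ι → ι → ι → ι → ι → M) :
    ∑ h, ∑ a, ∑ b, ∑ c, ∑ d, F h a b c d =
      ∑ d, ∑ h, ∑ a, ∑ c, ∑ b, F h a b c d := by
  simp only [← Fintype.sum_prod_type']
  exact Fintype.sum_equiv ⟨fun q ↦ (q.2.2.2.2, q.1, q.2.1, q.2.2.2.1, q.2.2.1),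
    fun q ↦ (q.2.1, q.2.2.1, q.2.2.2.2, q.2.2.2.1, q.1),
    fun _ ↦ rfl, fun _ ↦ rfl⟩ _ _ fun _ ↦ rfl

theorem sum_perm₅' {ι M : Type*} [Fintype ι] [AddCommMonoid M]
    (F : ι → ι → ι → ι → ι → M) :
    ∑ m, ∑ a, ∑ c, ∑ d, ∑ h, F m a c d h =
      ∑ h, ∑ a, ∑ m, ∑ c, ∑ d, F m a c d h := by
  simp only [← Fintype.sum_prod_type']
  exact Fintype.sum_equiv ⟨fun q ↦ (q.2.2.2.2, q.2.1, q.1, q.2.2.1, q.2.2.2.1),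
    fun q ↦ (q.2.2.1, q.2.1, q.2.2.2.1, q.2.2.2.2, q.1),
    fun _ ↦ rfl, fun _ ↦ rfl⟩ _ _ fun _ ↦ rfl

theorem sum_perm₈ {ι M : Type*} [Fintype ι] [AddCommMonoid M]
    (F : ι → ι → ι → ι → ι → ι → ι → ι → M) :
    ∑ c, ∑ d, ∑ a, ∑ m, ∑ r, ∑ n, ∑ s, ∑ b, F c d a m r n s b =
      ∑ m, ∑ n, ∑ r, ∑ s, ∑ a, ∑ b, ∑ c, ∑ d, F c d a m r n s b := by
  simp only [← Fintype.sum_prod_type']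
  exact Fintype.sum_equiv ⟨fun q ↦ (q.2.2.2.1, q.2.2.2.2.2.1, q.2.2.2.2.1, q.2.2.2.2.2.2.1, q.2.2.1, q.2.2.2.2.2.2.2, q.1, q.2.1),
    fun q ↦ (q.2.2.2.2.2.2.1, q.2.2.2.2.2.2.2, q.2.2.2.2.1, q.1, q.2.2.1, q.2.1, q.2.2.2.1, q.2.2.2.2.2.1),
    fun _ ↦ rfl, fun _ ↦ rfl⟩ _ _ fun _ ↦ rfl


variable {k : Type u} [Field k] {ι : Type x} [Fintype ι] [DecidableEq ι]
  {A : Type v} [NonUnitalRing A] [Module k A]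
  [IsScalarTower k A A] [SMulCommClass k A A] {e : Module.Basis ι k A}
  {R : Matrix (ι × ι) (ι × ι) k} {Ψ : A ⊗[k] A ≃ₗ[k] A ⊗[k] A}
  {B : Type w} [NonUnitalRing B] [Module k B] [IsScalarTower k B B] [SMulCommClass k B B]
  {S : Comeasuring k Ψ B} {u : ι → ι → B}

theorem Comeasuring.ΨBA_apply (hR : IsUnit R) (hΨR : IsBraidingOf e R Ψ)
    (hu : ∀ j, S.β (e j) = ∑ a, e a ⊗ₜ u a j) (i j h : ι) : S.ΨBA (u i j ⊗ₜ e h) =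
      ∑ m, ∑ a, ∑ b, ∑ n, (R⁻¹ (i, m) (a, n) * R (b, n) (j, h)) • (e m ⊗ₜ u a b) :=
  extension_apply hR hΨR (apply_of_coact hu S.β_natural_A.1) i j h

theorem Comeasuring.relation (hR : IsUnit R) (hΨR : IsBraidingOf e R Ψ)
    (hu : ∀ j, S.β (e j) = ∑ a, e a ⊗ₜ u a j) (i j l : ι) :
    ∑ a, structConst e i j a • u l a = ∑ a, ∑ b, ∑ c, ∑ d, ∑ p, ∑ f,
      (structConst e a b l * R⁻¹ (a, b) (c, d) * R (p, d) (i, f)) • (u c p * u f j) :=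
  (coact_mul_iff hu (S.ΨBA_apply hR hΨR hu)).1 S.β_mul i j l

/-- Naturality of `β` with `A` on the left, read in coordinates, gives the braiding only after
contraction with `R^{t₂}`. Solving for it is where `R̃` enters. -/
theorem Comeasuring.sum_ΨAB_apply (hΨR : IsBraidingOf e R Ψ)
    (hu : ∀ j, S.β (e j) = ∑ a, e a ⊗ₜ u a j) (h j d : ι) :
    ∑ c, ∑ a, R (c, d) (h, a) • S.ΨAB (e c ⊗ₜ u a j) =
      ∑ m, ∑ p, R (m, p) (h, j) • (u d p ⊗ₜ e m) := by
  refine congrFun (sum_basis_tmul_injective e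
    (y := fun d ↦ ∑ c, ∑ a, R (c, d) (h, a) • S.ΨAB (e c ⊗ₜ u a j))
    (y' := fun d ↦ ∑ m, ∑ p, R (m, p) (h, j) • (u d p ⊗ₜ e m)) ?_) d
  have h₁ := congrArg (TensorProduct.assoc k A B A) (NatR.apply S.β_natural_A.2 (e h) (e j))
  rw [hu] at h₁
  simp only [LinearEquiv.coe_coe, TensorProduct.tmul_sum, map_sum, braidRight_tmul, hΨR _ _,
    map_smul, passRight_tmul, LinearEquiv.apply_symm_apply, LinearMap.rTensor_tmul, hu,
    TensorProduct.sum_tmul, TensorProduct.assoc_tmul, Finset.smul_sum] at h₁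
  simp only [TensorProduct.tmul_sum, TensorProduct.tmul_smul]
  exact (sum_rev₃ _).trans (h₁.trans (sum_rot₃ fun d m p ↦ R (m, p) (h, j) • (e d ⊗ₜ[k] (u d p ⊗ₜ[k] e m))).symm)

/-- These are the coefficients of naturality of `β` when `u i j` is braided past `e l`. -/
theorem Comeasuring.compact (hR : IsUnit R) (hΨR : IsBraidingOf e R Ψ)
    (hu : ∀ j, S.β (e j) = ∑ a, e a ⊗ₜ u a j) (i j h l : ι) :
    ∑ a, ∑ b, ∑ c, ∑ d, (R⁻¹ (i, h) (a, b) * R (c, b) (j, d)) • S.ΨBB (u a c ⊗ₜ u d l) =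
      ∑ a, ∑ b, ∑ c, ∑ d, (R⁻¹ (i, b) (a, d) * R (c, d) (j, l)) • (u h b ⊗ₜ u a c) := by
  refine congrFun (sum_basis_tmul_injective e
    (y := fun h ↦ ∑ a, ∑ b, ∑ c, ∑ d,
      (R⁻¹ (i, h) (a, b) * R (c, b) (j, d)) • S.ΨBB (u a c ⊗ₜ u d l))
    (y' := fun h ↦ ∑ a, ∑ b, ∑ c, ∑ d,
      (R⁻¹ (i, b) (a, d) * R (c, d) (j, l)) • (u h b ⊗ₜ u a c)) ?_) h
  have h₁ := congrArg (TensorProduct.assoc k A B B) (NatR.apply S.β_natural_B.2 (u i j) (e l))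
  rw [hu] at h₁
  simp only [LinearEquiv.coe_coe, TensorProduct.tmul_sum, map_sum, braidRight_tmul,
    S.ΨBA_apply hR hΨR hu,
    map_smul, passRight_tmul, LinearEquiv.apply_symm_apply, LinearMap.rTensor_tmul, hu,
    TensorProduct.sum_tmul, TensorProduct.assoc_tmul, Finset.smul_sum] at h₁
  simp only [TensorProduct.tmul_sum, TensorProduct.tmul_smul]
  refine Eq.trans ?_ (h₁.trans ?_)
  · exact sum_perm₅ fun h a b c d ↦ (R⁻¹ (i, h) (a, b) * R (c, b) (j, d)) •
      e h ⊗ₜ[k] S.ΨBB (u a c ⊗ₜ[k] u d l)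
  · exact sum_perm₅' fun m a c d h ↦ (R⁻¹ (i, m) (a, d) * R (c, d) (j, l)) •
      e h ⊗ₜ[k] (u h m ⊗ₜ[k] u a c)

theorem sum_secondInverse (hR : IsUnit (transpose₂ R)) {N : Type*} [AddCommGroup N] [Module k N]
    (X : ι → ι → N) (i j : ι) : ∑ c, ∑ d, secondInverse R (c, j) (i, d) •
      ∑ a, ∑ b, R (a, d) (c, b) • X a b = X i j := by
  have := sum_smul_sum_of_mul_eq_one (A := (transpose₂ R)⁻¹.transpose)
    (B := (transpose₂ R).transpose) (by
      rw [← Matrix.transpose_mul, Matrix.mul_nonsing_inv _ ((Matrix.isUnit_iff_isUnit_det _).1 hR),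
        Matrix.transpose_one]) (fun p ↦ X p.1 p.2) (i, j)
  simp only [Fintype.sum_prod_type] at this
  exact this

theorem sum_mul_inv (hR : IsUnit R) {N : Type*} [AddCommGroup N] [Module k N]
    (X : ι → ι → N) (i j : ι) : ∑ c, ∑ d, R (i, j) (c, d) •
      ∑ a, ∑ b, R⁻¹ (c, d) (a, b) • X a b = X i j := by
  have := sum_smul_sum_of_mul_eq_one (Matrix.mul_nonsing_inv _
    ((Matrix.isUnit_iff_isUnit_det _).1 hR)) (fun p ↦ X p.1 p.2) (i, j)
  simpa [Fintype.sum_prod_type] using this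

theorem Comeasuring.ΨAB_apply (hR : IsBiinvertible R) (hΨR : IsBraidingOf e R Ψ)
    (hu : ∀ j, S.β (e j) = ∑ a, e a ⊗ₜ u a j) (i j h : ι) : S.ΨAB (e h ⊗ₜ u i j) =
      ∑ a, ∑ b, ∑ m, ∑ n, (secondInverse R (n, i) (h, a) * R (m, b) (n, j)) •
        (u a b ⊗ₜ e m) := by
  rw [← sum_secondInverse hR.2 (fun h i ↦ S.ΨAB (e h ⊗ₜ u i j))]
  simp only [S.sum_ΨAB_apply hΨR hu, Finset.smul_sum, smul_smul]
  exact sum_perm₄ fun n a m b ↦ (secondInverse R (n, i) (h, a) * R (m, b) (n, j)) •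
    (u a b ⊗ₜ[k] e m)

theorem Comeasuring.ΨBB_apply (hR : IsBiinvertible R) (hΨR : IsBraidingOf e R Ψ)
    (hu : ∀ j, S.β (e j) = ∑ a, e a ⊗ₜ u a j) (i j h l : ι) : S.ΨBB (u i j ⊗ₜ u h l) =
      ∑ m, ∑ n, ∑ r, ∑ s, ∑ a, ∑ b, ∑ c, ∑ d,
        (R (i, d) (a, m) * R⁻¹ (a, n) (r, b) * R (s, b) (c, l) * secondInverse R (c, h) (j, d)) •
          (u m n ⊗ₜ u r s) := by
  rw [← sum_secondInverse hR.2 (fun j h ↦ S.ΨBB (u i j ⊗ₜ u h l))]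
  have h₁ (c d : ι) : ∑ a, ∑ b, R (a, d) (c, b) • S.ΨBB (u i a ⊗ₜ u b l) =
      ∑ a, ∑ m, R (i, d) (a, m) • ∑ r, ∑ n, ∑ s, ∑ b,
        (R⁻¹ (a, n) (r, b) * R (s, b) (c, l)) • (u m n ⊗ₜ u r s) := by
    simp only [← S.compact hR.1 hΨR hu]
    -- The compact form carries two matrices in front of the braiding. Here `R` removes the factor
    -- `R⁻¹`; the factor `R` left over is removed by `R̃`.
    rw [← sum_mul_inv hR.1 (fun i d ↦ ∑ a, ∑ b, R (a, d) (c, b) • S.ΨBB (u i a ⊗ₜ u b l))]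
    simp only [Finset.smul_sum, smul_smul]
  simp only [h₁, Finset.smul_sum, smul_smul]
  refine (sum_perm₈ fun c d a m r n s b ↦ (secondInverse R (c, h) (j, d) *
    (R (i, d) (a, m) * (R⁻¹ (a, n) (r, b) * R (s, b) (c, l)))) •
      u m n ⊗ₜ[k] u r s).trans ?_
  have hc (x y z w : k) : x * (y * (z * w)) = y * z * w * x := by ring
  simp only [hc]

end Components

/-! ### The coproduct as a product of two solutions -/

section Coproduct

variable {k : Type u} [Field k] {ι : Type x} [Fintype ι] [DecidableEq ι]
  {A : Type v} [NonUnitalRing A] [Module k A]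
  [IsScalarTower k A A] [SMulCommClass k A A] {e : Module.Basis ι k A}
  {R : Matrix (ι × ι) (ι × ι) k} {Ψ : A ⊗[k] A ≃ₗ[k] A ⊗[k] A}
  {X : Type*} [AddCommGroup X] [Module k X]

theorem M₁_linearMap_ext {B : Type*} [AddCommGroup B] [Module k B] {mB : B ⊗[k] B →ₗ[k] B}
    {f g : M₁ e R →ₗ[k] B} (hone : f 1 = g 1) (hf : ∀ a b, f (a * b) = mB (f a ⊗ₜ f b))
    (hg : ∀ a b, g (a * b) = mB (g a ⊗ₜ g b)) (h : ∀ i j, f (gen e R i j) = g (gen e R i j)) :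
    f = g := by
  refine LinearMap.ext fun a ↦ ?_
  induction a using M₁_induction with
  | algebraMap r => simp [Algebra.algebraMap_eq_smul_one, hone]
  | gen i j => exact h i j
  | mul a b ha hb => rw [hf, hg, ha, hb]
  | add a b ha hb => rw [map_add, map_add, ha, hb]

/-- The relations reduce to `C = C R⁻¹ R`. This solution gives the counit. -/
theorem isSolution_one {W : Type*} [Ring W] [Algebra k W] (hR : IsUnit R) :
    IsSolution e R (1 : Matrix ι ι W) := by
  rw [isSolution_iff, leg₁_one, leg₂_one, mul_one, mul_one, map_inv_mul_map hR, Matrix.one_mul,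
    Matrix.mul_one]

/-- The relations have no constant term. This solution gives the character that splits off the unit.
-/
theorem isSolution_zero {W : Type*} [Ring W] [Algebra k W] :
    IsSolution e R (0 : Matrix ι ι W) := by
  intro i j l
  simp

theorem UnitNatural.apply_left {B Z : Type*} [Ring B] [Algebra k B] [AddCommGroup Z] [Module k Z]
    {a : B ⊗[k] Z →ₗ[k] Z ⊗[k] B} {b : Z ⊗[k] B →ₗ[k] B ⊗[k] Z} (h : UnitNatural a b) (z : Z) :
    a (1 ⊗ₜ z) = z ⊗ₜ 1 := by
  simpa using NatL.apply h.1 1 z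

theorem UnitNatural.apply_right {B Z : Type*} [Ring B] [Algebra k B] [AddCommGroup Z]
    [Module k Z] {a : B ⊗[k] Z →ₗ[k] Z ⊗[k] B} {b : Z ⊗[k] B →ₗ[k] B ⊗[k] Z}
    (h : UnitNatural a b) (z : Z) : b (z ⊗ₜ 1) = 1 ⊗ₜ z := by
  simpa using NatR.apply h.2 z 1

variable {B : Type w} [Ring B] [Algebra k B] (S : Comeasuring k Ψ B)

/-- The product of the braided tensor square of `B`. -/
abbrev Comeasuring.squareMul : (B ⊗[k] B) ⊗[k] (B ⊗[k] B) →ₗ[k] B ⊗[k] B :=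
  bmul (LinearMap.mul' k B) (LinearMap.mul' k B) S.ΨBB.toLinearMap

theorem Comeasuring.squareMul_assoc (s t r : B ⊗[k] B) :
    S.squareMul (S.squareMul (s ⊗ₜ t) ⊗ₜ r) = S.squareMul (s ⊗ₜ S.squareMul (t ⊗ₜ r)) :=
  bmul_assoc (fun a b c ↦ mul_assoc a b c) (fun a b c ↦ mul_assoc a b c)
    S.mul_natural_BB.1 S.mul_natural_BB.2 s t r

variable {S} (hS : S.IsUnital)

theorem Comeasuring.IsUnital.squareMul_right (hS : S.IsUnital) (a b c : B) :
    S.squareMul ((a ⊗ₜ b) ⊗ₜ (1 ⊗ₜ c)) = a ⊗ₜ (b * c) := by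
  rw [Comeasuring.squareMul, bmul_tmul, hS.unit_B.apply_right]
  simp

theorem Comeasuring.IsUnital.squareMul_left (hS : S.IsUnital) (a b c : B) :
    S.squareMul ((a ⊗ₜ 1) ⊗ₜ (b ⊗ₜ c)) = (a * b) ⊗ₜ c := by
  rw [Comeasuring.squareMul, bmul_tmul, hS.unit_B.apply_left]
  simp

/-- Left multiplication by the first factor of the braided tensor square. -/
def Comeasuring.IsUnital.lmulLeft : B →ₐ[k] Module.End k (B ⊗[k] B) :=
  AlgHom.ofLinearMap (TensorProduct.curry S.squareMul ∘ₗ (TensorProduct.mk k B B).flip 1)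
    (TensorProduct.ext' fun a b ↦ by simp [hS.squareMul_left])
    (fun a b ↦ TensorProduct.ext' fun c d ↦ by simp [hS.squareMul_left, mul_assoc])

/-- Left multiplication by the second factor of the braided tensor square. -/
def Comeasuring.IsUnital.lmulRight : B →ₐ[k] Module.End k (B ⊗[k] B) :=
  AlgHom.ofLinearMap (TensorProduct.curry S.squareMul ∘ₗ TensorProduct.mk k B B 1)
    (TensorProduct.ext' fun a b ↦ by simp [hS.squareMul_left])
    (fun a b ↦ LinearMap.ext fun t ↦ by
      simp [← S.squareMul_assoc, hS.squareMul_right])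

theorem Comeasuring.IsUnital.lmulLeft_apply (a : B) (t : B ⊗[k] B) :
    hS.lmulLeft a t = S.squareMul ((a ⊗ₜ 1) ⊗ₜ t) := rfl

theorem Comeasuring.IsUnital.lmulRight_apply (a : B) (t : B ⊗[k] B) :
    hS.lmulRight a t = S.squareMul ((1 ⊗ₜ a) ⊗ₜ t) := rfl

theorem Comeasuring.IsUnital.lmulLeft_mul_lmulRight (a b : B) :
    hS.lmulLeft a * hS.lmulRight b = TensorProduct.curry S.squareMul (a ⊗ₜ b) := by
  refine LinearMap.ext fun t ↦ ?_
  rw [Module.End.mul_apply, hS.lmulLeft_apply, hS.lmulRight_apply, ← S.squareMul_assoc,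
    hS.squareMul_left, mul_one]
  rfl

/-- In the braided square, a second-factor element times a first-factor element is their braiding.
This makes the cross relations between the two copies of `u` a statement about `ΨBB`. -/
theorem Comeasuring.IsUnital.lmulRight_mul_lmulLeft (a b : B) :
    hS.lmulRight a * hS.lmulLeft b = TensorProduct.curry S.squareMul (S.ΨBB (a ⊗ₜ b)) := by
  have h : S.squareMul ((1 ⊗ₜ a) ⊗ₜ (b ⊗ₜ 1)) = S.ΨBB (a ⊗ₜ b) := by
    rw [Comeasuring.squareMul, bmul_tmul, LinearEquiv.coe_coe]
    generalize S.ΨBB (a ⊗ₜ b) = t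
    induction t with
    | zero => simp
    | add s t hs ht => simp only [map_add, hs, ht]
    | tmul x y => simp
  refine LinearMap.ext fun t ↦ ?_
  rw [Module.End.mul_apply, hS.lmulLeft_apply, hS.lmulRight_apply, ← S.squareMul_assoc, h]
  rfl

theorem Comeasuring.isSolution (hR : IsUnit R) (hΨR : IsBraidingOf e R Ψ) {u : ι → ι → B}
    (hu : ∀ j, S.β (e j) = ∑ a, e a ⊗ₜ u a j) : IsSolution e R (Matrix.of u) :=
  fun i j l ↦ S.relation hR hΨR hu i j l

variable (hR : IsUnit R) (hΨR : IsBraidingOf e R Ψ) {u : ι → ι → B}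
  (hu : ∀ j, S.β (e j) = ∑ a, e a ⊗ₜ u a j)

/-- The cross relations demanded by `IsSolution.mul` are the compact form of the braiding of the
matrix elements. -/
theorem Comeasuring.IsUnital.isSolution_comul (hS : S.IsUnital) (hR : IsUnit R)
    (hΨR : IsBraidingOf e R Ψ)
    {u : ι → ι → B} (hu : ∀ j, S.β (e j) = ∑ a, e a ⊗ₜ u a j) :
    IsSolution e R ((Matrix.of u).map hS.lmulLeft * (Matrix.of u).map hS.lmulRight) := by
  have hsol := Comeasuring.isSolution hR hΨR hu
  refine (hsol.map _).mul hR (hsol.map _) ?_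
  ext1 ⟨i, h⟩ ⟨j, l⟩
  rw [inv_leg₁_map_leg₂_apply, leg₂_inv_leg₁_map_apply]
  simp only [Matrix.map_apply, Matrix.of_apply, hS.lmulLeft_mul_lmulRight,
    hS.lmulRight_mul_lmulLeft, ← map_smul, ← map_sum]
  congr 1
  simpa only [map_sum, map_smul] using S.compact hR hΨR hu i j h l

/-- The coproduct `u^i_j ↦ u^i_a ⊗ u^a_j` defined by a unital comeasuring. -/
def Comeasuring.IsUnital.comul : M₁ e R →ₗ[k] B ⊗[k] B :=
  LinearMap.applyₗ (1 ⊗ₜ 1) ∘ₗ (liftM₁ (hS.isSolution_comul hR hΨR hu)).toLinearMap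

theorem Comeasuring.IsUnital.comul_one : hS.comul hR hΨR hu 1 = 1 ⊗ₜ 1 := by
  simp [Comeasuring.IsUnital.comul]

theorem Comeasuring.IsUnital.lift_gen (i j : ι) :
    liftM₁ (hS.isSolution_comul hR hΨR hu) (gen e R i j) =
      TensorProduct.curry S.squareMul (∑ a, u i a ⊗ₜ u a j) := by
  simp [Matrix.mul_apply, hS.lmulLeft_mul_lmulRight]

theorem Comeasuring.IsUnital.comul_gen (i j : ι) :
    hS.comul hR hΨR hu (gen e R i j) = ∑ a, u i a ⊗ₜ u a j := by
  rw [Comeasuring.IsUnital.comul, LinearMap.comp_apply, AlgHom.toLinearMap_apply,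
    hS.lift_gen hR hΨR hu]
  simp [hS.squareMul_right]

/-- The lifted representation acts by left multiplication by its value at `1 ⊗ 1`, that is, by the
coproduct. Multiplicativity of the representation therefore becomes multiplicativity of the
coproduct. -/
theorem Comeasuring.IsUnital.lift_eq (a : M₁ e R) :
    liftM₁ (hS.isSolution_comul hR hΨR hu) a =
      TensorProduct.curry S.squareMul (hS.comul hR hΨR hu a) := by
  induction a using M₁_induction with
  | algebraMap r =>
    rw [Algebra.algebraMap_eq_smul_one, map_smul, map_smul, map_smul, map_one,
      hS.comul_one hR hΨR hu]
    congr 1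
    exact (map_one hS.lmulLeft).symm
  | gen i j => rw [hS.lift_gen hR hΨR hu, hS.comul_gen hR hΨR hu]
  | mul a b ha hb =>
    have h : hS.comul hR hΨR hu (a * b) =
        S.squareMul (hS.comul hR hΨR hu a ⊗ₜ hS.comul hR hΨR hu b) := by
      refine Eq.trans ?_ (LinearMap.congr_fun ha (hS.comul hR hΨR hu b))
      simp [Comeasuring.IsUnital.comul]
    rw [map_mul, ha, hb, h]
    refine LinearMap.ext fun t ↦ ?_
    exact (S.squareMul_assoc _ _ _).symm
  | add a b ha hb => rw [map_add, map_add, map_add, ha, hb]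

theorem Comeasuring.IsUnital.comul_mul (a b : M₁ e R) : hS.comul hR hΨR hu (a * b) =
    S.squareMul (hS.comul hR hΨR hu a ⊗ₜ hS.comul hR hΨR hu b) := by
  refine Eq.trans ?_ (LinearMap.congr_fun (hS.lift_eq hR hΨR hu a) (hS.comul hR hΨR hu b))
  simp [Comeasuring.IsUnital.comul]

end Coproduct

/-! ### Naturality of the coproduct and of characters -/

section Coalgebra

variable {k : Type u} [Field k] {ι : Type x} [Fintype ι] [DecidableEq ι]
  {A : Type v} [NonUnitalRing A] [Module k A]
  [IsScalarTower k A A] [SMulCommClass k A A] {e : Module.Basis ι k A}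
  {R : Matrix (ι × ι) (ι × ι) k} {Ψ : A ⊗[k] A ≃ₗ[k] A ⊗[k] A}
  {X : Type*} [AddCommGroup X] [Module k X]
  (D : M₁Braidings e R Ψ) (hΨ : IsBraidedAlgebra Ψ) (hR : IsUnit R) (hΨR : IsBraidingOf e R Ψ)

/-- The product of the braided tensor square of `M₁`. -/
abbrev M₁Braidings.squareMul : (M₁ e R ⊗[k] M₁ e R) ⊗[k] (M₁ e R ⊗[k] M₁ e R) →ₗ[k]
    M₁ e R ⊗[k] M₁ e R :=
  bmul (LinearMap.mul' k (M₁ e R)) (LinearMap.mul' k (M₁ e R)) D.MM.toLinearMap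

/-- The coproduct of `M₁`. -/
def M₁Braidings.comul : M₁ e R →ₗ[k] M₁ e R ⊗[k] M₁ e R :=
  (D.isUnital hΨ).comul hR hΨR fun j ↦ betaU_basis j

theorem M₁Braidings.comul_one : D.comul hΨ hR hΨR 1 = 1 ⊗ₜ 1 :=
  (D.isUnital hΨ).comul_one hR hΨR fun j ↦ betaU_basis j

theorem M₁Braidings.comul_gen (i j : ι) :
    D.comul hΨ hR hΨR (gen e R i j) = ∑ a, gen e R i a ⊗ₜ gen e R a j :=
  (D.isUnital hΨ).comul_gen hR hΨR (fun j ↦ betaU_basis j) i j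

theorem M₁Braidings.comul_mul (a b : M₁ e R) : D.comul hΨ hR hΨR (a * b) =
    D.squareMul (D.comul hΨ hR hΨR a ⊗ₜ D.comul hΨ hR hΨR b) :=
  (D.isUnital hΨ).comul_mul hR hΨR (fun j ↦ betaU_basis j) a b

theorem M₁Braidings.coaction_coassoc :
    (TensorProduct.assoc k A (M₁ e R) (M₁ e R)).toLinearMap ∘ₗ (betaU e R).rTensor _ ∘ₗ
      betaU e R = (D.comul hΨ hR hΨR).lTensor A ∘ₗ betaU e R := by
  refine e.ext fun j ↦ ?_
  simp only [LinearMap.comp_apply, betaU_basis, map_sum, LinearMap.rTensor_tmul,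
    LinearMap.lTensor_tmul, D.comul_gen, TensorProduct.tmul_sum, TensorProduct.sum_tmul,
    LinearEquiv.coe_coe, TensorProduct.assoc_tmul]
  rw [Finset.sum_comm]

/-- The coproduct commutes with the braidings past objects compatible with `M₁`. -/
theorem M₁Braidings.natL_comul {lV : A ⊗[k] X →ₗ[k] X ⊗[k] A}
    {lM : M₁ e R ⊗[k] X →ₗ[k] X ⊗[k] M₁ e R} (h : UnitalMover e R lV lM)
    (hinj : Function.Injective lV) (hb : BraidRelation D.MM.toLinearMap lM lM) :
    NatL (D.comul hΨ hR hΨR) lM (braidLeft lM lM) := by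
  have hY : Mover D.squareMul ((D.comul hΨ hR hΨR).lTensor A ∘ₗ betaU e R) lV
      (braidLeft lM lM) := by
    refine ⟨NatL.bmul h.mul h.mul hb, ?_⟩
    -- Coassociativity replaces the coaction through the coproduct by `β_U` applied twice, and each
    -- `β_U` slides past `X`.
    rw [← D.coaction_coassoc hΨ hR hΨR]
    exact (natL_assoc lV lM lM).comp ((NatL.map h.coact (natL_id lM)).comp h.coact)
  refine natL_of_apply fun a x ↦ ?_
  exact h.natural hY hinj (π := D.comul hΨ hR hΨR) (D.comul_mul hΨ hR hΨR)
    (fun y ↦ by simp [D.comul_one, braidLeft_tmul, h.one, passLeft_tmul]) rfl (f := LinearMap.id)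
    (natR_id lV) a x

/-- A character commutes with the braidings past `X` if it does so on the comeasuring. -/
theorem UnitalMover.natL_character {lV : A ⊗[k] X →ₗ[k] X ⊗[k] A}
    {lM : M₁ e R ⊗[k] X →ₗ[k] X ⊗[k] M₁ e R} (h : UnitalMover e R lV lM)
    (hinj : Function.Injective lV) (χ : M₁ e R →ₐ[k] k)
    (hχ : NatL (χ.toLinearMap.lTensor A ∘ₗ betaU e R) lV (braidLeft lV (unitBraidLeft k X))) :
    NatL χ.toLinearMap lM (unitBraidLeft k X) := by
  have hY : Mover (LinearMap.mul' k k) (χ.toLinearMap.lTensor A ∘ₗ betaU e R) lV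
      (unitBraidLeft k X) := by
    refine ⟨natL_of_apply fun t x ↦ ?_, hχ⟩
    induction t with
    | zero => simp
    | add s t hs ht => simp only [map_add, TensorProduct.add_tmul, hs, ht]
    | tmul a b => simp [braidLeft_tmul, passLeft_tmul]
  refine natL_of_apply fun a x ↦ ?_
  exact h.natural hY hinj (π := χ.toLinearMap) (fun a b ↦ by simp)
    (fun y ↦ by simp) rfl (f := LinearMap.id) (natR_id lV) a x

/-- The counit of `M₁`. -/
def counitM₁ (hR : IsUnit R) : M₁ e R →ₐ[k] k := liftM₁ (isSolution_one hR)

theorem counitM₁_gen (i j : ι) : counitM₁ (e := e) hR (gen e R i j) = if i = j then 1 else 0 := by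
  simp [counitM₁, Matrix.one_apply]

theorem coaction_counit : (counitM₁ (e := e) hR).toLinearMap.lTensor A ∘ₗ betaU e R =
    (TensorProduct.rid k A).symm.toLinearMap := by
  refine e.ext fun j ↦ ?_
  simp only [LinearMap.comp_apply, betaU_basis, map_sum, LinearMap.lTensor_tmul,
    AlgHom.toLinearMap_apply, counitM₁_gen]
  rw [Finset.sum_eq_single j] <;> simp +contextual

theorem UnitalMover.natL_counit {lV : A ⊗[k] X →ₗ[k] X ⊗[k] A}
    {lM : M₁ e R ⊗[k] X →ₗ[k] X ⊗[k] M₁ e R} (h : UnitalMover e R lV lM)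
    (hinj : Function.Injective lV) :
    NatL (counitM₁ (e := e) hR).toLinearMap lM (unitBraidLeft k X) := by
  refine h.natL_character hinj _ ?_
  rw [coaction_counit]
  refine natL_of_apply fun a x ↦ ?_
  simp only [LinearEquiv.coe_coe, TensorProduct.rid_symm_apply, braidLeft_tmul,
    TensorProduct.comm_tmul, passLeft_tmul]
  generalize lV (a ⊗ₜ x) = t
  induction t with
  | zero => simp
  | add s t hs ht => simp only [map_add, TensorProduct.add_tmul, hs, ht]
  | tmul x a => simp

end Coalgebra

/-! ### The braided bialgebra -/

section Bialgebra

variable {k : Type u} [Field k] {ι : Type x} [Fintype ι] [DecidableEq ι]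
  {A : Type v} [NonUnitalRing A] [Module k A]
  [IsScalarTower k A A] [SMulCommClass k A A] {e : Module.Basis ι k A}
  {R : Matrix (ι × ι) (ι × ι) k} {Ψ : A ⊗[k] A ≃ₗ[k] A ⊗[k] A}
  (D : M₁Braidings e R Ψ) (hΨ : IsBraidedAlgebra Ψ) (hR : IsUnit R) (hΨR : IsBraidingOf e R Ψ)

theorem M₁Braidings.comul_natural_A : NaturalWith (D.comul hΨ hR hΨR)
    D.MA.toLinearMap (braidLeft D.MA.toLinearMap D.MA.toLinearMap)
    D.AM.toLinearMap (braidRight D.AM.toLinearMap D.AM.toLinearMap) := by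
  refine ⟨D.natL_comul hΨ hR hΨR D.mover_A Ψ.injective (D.comeasuring hΨ).braid_BBA, ?_⟩
  have h₁ : BraidRelation D.AM.symm.toLinearMap D.MM.toLinearMap D.AM.toLinearMap :=
    BraidRelation.symm_left (a := D.AM) (D.comeasuring hΨ).braid_ABB
  have h := D.natL_comul hΨ hR hΨR D.mover_A_symm Ψ.symm.injective
    (BraidRelation.symm_right (c := D.AM) h₁)
  exact h.inverse D.AM.symm_comp (braidRight_comp_braidLeft D.AM.comp_symm D.AM.comp_symm)

theorem M₁Braidings.comul_natural_M : NaturalWith (D.comul hΨ hR hΨR)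
    D.MM.toLinearMap (braidLeft D.MM.toLinearMap D.MM.toLinearMap)
    D.MM.toLinearMap (braidRight D.MM.toLinearMap D.MM.toLinearMap) :=
  ⟨D.natL_comul hΨ hR hΨR D.mover_M D.AM.injective (D.comeasuring hΨ).braid_BBB,
    D.mover_M.natR (D.mover_M.braidRight D.mover_M) (braidRight_injective _ _)
      (D.comul_natural_A hΨ hR hΨR).2⟩

theorem M₁Braidings.character_natural_A {χ : M₁ e R →ₐ[k] k}
    (h : NatL χ.toLinearMap D.MA.toLinearMap (unitBraidLeft k A))
    (h' : NatL χ.toLinearMap D.AM.symm.toLinearMap (unitBraidLeft k A)) :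
    NaturalWith χ.toLinearMap D.MA.toLinearMap (unitBraidLeft k A) D.AM.toLinearMap
      (unitBraidRight k A) :=
  ⟨h, h'.inverse D.AM.symm_comp (TensorProduct.ext' fun r a ↦ by simp)⟩

theorem M₁Braidings.character_natural_M {χ : M₁ e R →ₐ[k] k}
    (h : NatL χ.toLinearMap D.MM.toLinearMap (unitBraidLeft k (M₁ e R)))
    (h' : NatR χ.toLinearMap D.AM.toLinearMap (unitBraidRight k A)) :
    NaturalWith χ.toLinearMap D.MM.toLinearMap (unitBraidLeft k (M₁ e R)) D.MM.toLinearMap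
      (unitBraidRight k (M₁ e R)) :=
  ⟨h, D.mover_M.natR unitalMover_unit (TensorProduct.comm k A k).injective h'⟩

theorem M₁Braidings.counit_natural_A : NaturalWith (counitM₁ (e := e) hR).toLinearMap
    D.MA.toLinearMap (unitBraidLeft k A) D.AM.toLinearMap (unitBraidRight k A) :=
  D.character_natural_A (D.mover_A.natL_counit hR Ψ.injective)
    (D.mover_A_symm.natL_counit hR Ψ.symm.injective)

theorem M₁Braidings.counit_natural_M : NaturalWith (counitM₁ (e := e) hR).toLinearMap
    D.MM.toLinearMap (unitBraidLeft k (M₁ e R)) D.MM.toLinearMap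
    (unitBraidRight k (M₁ e R)) :=
  D.character_natural_M (D.mover_M.natL_counit hR D.AM.injective) (D.counit_natural_A hR).2

theorem M₁Braidings.comul_comp_mul : D.comul hΨ hR hΨR ∘ₗ LinearMap.mul' k (M₁ e R) =
    D.squareMul ∘ₗ TensorProduct.map (D.comul hΨ hR hΨR) (D.comul hΨ hR hΨR) :=
  TensorProduct.ext' fun a b ↦ D.comul_mul hΨ hR hΨR a b

/-- Both sides are multiplicative into the threefold braided product, because the coproduct is
multiplicative and commutes with the braidings. It remains to compare them on generators. -/
theorem M₁Braidings.coassoc :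
    (TensorProduct.assoc k (M₁ e R) (M₁ e R) (M₁ e R)).toLinearMap ∘ₗ
      (D.comul hΨ hR hΨR).rTensor (M₁ e R) ∘ₗ D.comul hΨ hR hΨR =
      (D.comul hΨ hR hΨR).lTensor (M₁ e R) ∘ₗ D.comul hΨ hR hΨR := by
  have hid : LinearMap.id ∘ₗ LinearMap.mul' k (M₁ e R) =
      LinearMap.mul' k (M₁ e R) ∘ₗ TensorProduct.map LinearMap.id LinearMap.id := by
    rw [TensorProduct.map_id]; rfl
  have h₁ := map_bmul (D.comul_comp_mul hΨ hR hΨR) hid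
    (Ψ' := braidRight D.MM.toLinearMap D.MM.toLinearMap) (D.comul_natural_M hΨ hR hΨR).2
  have h₂ := map_bmul hid (D.comul_comp_mul hΨ hR hΨR)
    (Ψ' := braidLeft D.MM.toLinearMap D.MM.toLinearMap) (D.comul_natural_M hΨ hR hΨR).1
  have h₃ := assoc_bmul (LinearMap.mul' k (M₁ e R)) (LinearMap.mul' k (M₁ e R))
    (LinearMap.mul' k (M₁ e R)) D.MM.toLinearMap D.MM.toLinearMap D.MM.toLinearMap
  refine M₁_linearMap_ext (mB := bmul (LinearMap.mul' k (M₁ e R)) D.squareMul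
    (braidLeft D.MM.toLinearMap D.MM.toLinearMap)) ?_ (fun a b ↦ ?_) (fun a b ↦ ?_) fun i j ↦ ?_
  · simp [D.comul_one]
  · rw [LinearMap.comp_apply, LinearMap.comp_apply, D.comul_mul]
    have h₄ := LinearMap.congr_fun h₁ (D.comul hΨ hR hΨR a ⊗ₜ D.comul hΨ hR hΨR b)
    have h₅ := LinearMap.congr_fun h₃ ((D.comul hΨ hR hΨR).rTensor (M₁ e R)
      (D.comul hΨ hR hΨR a) ⊗ₜ (D.comul hΨ hR hΨR).rTensor (M₁ e R) (D.comul hΨ hR hΨR b))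
    exact (congrArg (TensorProduct.assoc k (M₁ e R) (M₁ e R) (M₁ e R)) h₄).trans h₅
  · rw [LinearMap.comp_apply, D.comul_mul]
    exact LinearMap.congr_fun h₂ (D.comul hΨ hR hΨR a ⊗ₜ D.comul hΨ hR hΨR b)
  · simp only [LinearMap.comp_apply, D.comul_gen, map_sum, LinearMap.rTensor_tmul,
      LinearMap.lTensor_tmul, TensorProduct.sum_tmul, TensorProduct.tmul_sum,
      LinearEquiv.coe_coe, TensorProduct.assoc_tmul]
    rw [Finset.sum_comm]

theorem M₁Braidings.rTensor_counit_comul :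
    (counitM₁ (e := e) hR).toLinearMap.rTensor (M₁ e R) ∘ₗ D.comul hΨ hR hΨR =
      TensorProduct.mk k k (M₁ e R) 1 := by
  have hid : LinearMap.id ∘ₗ LinearMap.mul' k (M₁ e R) =
      LinearMap.mul' k (M₁ e R) ∘ₗ TensorProduct.map LinearMap.id LinearMap.id := by
    rw [TensorProduct.map_id]; rfl
  have hε : (counitM₁ (e := e) hR).toLinearMap ∘ₗ LinearMap.mul' k (M₁ e R) =
      LinearMap.mul' k k ∘ₗ TensorProduct.map (counitM₁ (e := e) hR).toLinearMap
        (counitM₁ (e := e) hR).toLinearMap := TensorProduct.ext' fun a b ↦ by simp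
  have h₁ := map_bmul hε hid (Ψ' := unitBraidRight k (M₁ e R)) (D.counit_natural_M hR).2
  refine M₁_linearMap_ext (mB := bmul (LinearMap.mul' k k) (LinearMap.mul' k (M₁ e R))
    (unitBraidRight k (M₁ e R))) ?_ (fun a b ↦ ?_) (fun a b ↦ ?_) fun i j ↦ ?_
  · simp [D.comul_one]
  · rw [LinearMap.comp_apply, D.comul_mul]
    exact LinearMap.congr_fun h₁ (D.comul hΨ hR hΨR a ⊗ₜ D.comul hΨ hR hΨR b)
  · simp [bmul_tmul]
  · simp only [LinearMap.comp_apply, D.comul_gen, map_sum, LinearMap.rTensor_tmul,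
      AlgHom.toLinearMap_apply, counitM₁_gen]
    rw [Finset.sum_eq_single i] <;> simp +contextual [eq_comm]

theorem M₁Braidings.lTensor_counit_comul :
    (counitM₁ (e := e) hR).toLinearMap.lTensor (M₁ e R) ∘ₗ D.comul hΨ hR hΨR =
      (TensorProduct.mk k (M₁ e R) k).flip 1 := by
  have hid : LinearMap.id ∘ₗ LinearMap.mul' k (M₁ e R) =
      LinearMap.mul' k (M₁ e R) ∘ₗ TensorProduct.map LinearMap.id LinearMap.id := by
    rw [TensorProduct.map_id]; rfl
  have hε : (counitM₁ (e := e) hR).toLinearMap ∘ₗ LinearMap.mul' k (M₁ e R) =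
      LinearMap.mul' k k ∘ₗ TensorProduct.map (counitM₁ (e := e) hR).toLinearMap
        (counitM₁ (e := e) hR).toLinearMap := TensorProduct.ext' fun a b ↦ by simp
  have h₁ := map_bmul hid hε (Ψ' := unitBraidLeft k (M₁ e R)) (D.counit_natural_M hR).1
  refine M₁_linearMap_ext (mB := bmul (LinearMap.mul' k (M₁ e R)) (LinearMap.mul' k k)
    (unitBraidLeft k (M₁ e R))) ?_ (fun a b ↦ ?_) (fun a b ↦ ?_) fun i j ↦ ?_
  · simp [D.comul_one]
  · rw [LinearMap.comp_apply, D.comul_mul]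
    exact LinearMap.congr_fun h₁ (D.comul hΨ hR hΨR a ⊗ₜ D.comul hΨ hR hΨR b)
  · simp [bmul_tmul]
  · simp only [LinearMap.comp_apply, D.comul_gen, map_sum, LinearMap.lTensor_tmul,
      AlgHom.toLinearMap_apply, counitM₁_gen]
    rw [Finset.sum_eq_single j] <;> simp +contextual

/-- The matrix coalgebra structure of `M₁`. -/
@[reducible]
def M₁Braidings.coalgebra : Coalgebra k (M₁ e R) where
  comul := D.comul hΨ hR hΨR
  counit := (counitM₁ (e := e) hR).toLinearMap
  coassoc := D.coassoc hΨ hR hΨR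
  rTensor_counit_comp_comul := D.rTensor_counit_comul hΨ hR hΨR
  lTensor_counit_comp_comul := D.lTensor_counit_comul hΨ hR hΨR

theorem M₁Braidings.isBraidedBialgebra :
    letI := D.coalgebra hΨ hR hΨR
    IsBraidedBialgebra D.MM :=
  letI := D.coalgebra hΨ hR hΨR
  { braid := (D.comeasuring hΨ).braid_BBB
    mul_natural := (D.comeasuring hΨ).mul_natural_BB
    unit_natural := (D.isUnital hΨ).unit_B
    comul_natural := D.comul_natural_M hΨ hR hΨR
    counit_natural := D.counit_natural_M hR
    comul_mul := D.comul_comp_mul hΨ hR hΨR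
    comul_one := D.comul_one hΨ hR hΨR
    counit_mul := fun a b ↦ map_mul (counitM₁ (e := e) hR) a b
    counit_one := map_one (counitM₁ (e := e) hR) }

theorem M₁Braidings.isRightCoaction :
    letI := D.coalgebra hΨ hR hΨR
    IsRightCoaction (betaU e R) :=
  letI := D.coalgebra hΨ hR hΨR
  { coassoc := D.coaction_coassoc hΨ hR hΨR
    counit := by
      refine LinearMap.ext fun a ↦ ?_
      have := LinearMap.congr_fun (coaction_counit (e := e) hR) a
      exact (congrArg (TensorProduct.rid k A) this).trans (by simp) }

end Bialgebra

/-! ### Maps that intertwine braidings -/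

section Compatibility

variable {k : Type u} [Field k]
  {X Y Z V W X' Y' Z' V' W' : Type*} [AddCommGroup X] [Module k X] [AddCommGroup Y] [Module k Y]
  [AddCommGroup Z] [Module k Z] [AddCommGroup V] [Module k V] [AddCommGroup W] [Module k W]
  [AddCommGroup X'] [Module k X'] [AddCommGroup Y'] [Module k Y']
  [AddCommGroup Z'] [Module k Z'] [AddCommGroup V'] [Module k V'] [AddCommGroup W'] [Module k W']

/-- Two maps intertwine two braidings. -/
def Compat (f : X' →ₗ[k] X) (g : Y' →ₗ[k] Y) (l' : X' ⊗[k] Y' →ₗ[k] Y' ⊗[k] X')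
    (l : X ⊗[k] Y →ₗ[k] Y ⊗[k] X) : Prop :=
  l ∘ₗ TensorProduct.map f g = TensorProduct.map g f ∘ₗ l'

theorem Compat.apply {f : X' →ₗ[k] X} {g : Y' →ₗ[k] Y} {l' : X' ⊗[k] Y' →ₗ[k] Y' ⊗[k] X'}
    {l : X ⊗[k] Y →ₗ[k] Y ⊗[k] X} (h : Compat f g l' l) (x : X') (y : Y') :
    l (f x ⊗ₜ g y) = TensorProduct.map g f (l' (x ⊗ₜ y)) :=
  LinearMap.congr_fun h (x ⊗ₜ y)

theorem compat_id (l : X ⊗[k] Y →ₗ[k] Y ⊗[k] X) : Compat LinearMap.id LinearMap.id l l := by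
  simp [Compat]

theorem Compat.braidLeft {f : X' →ₗ[k] X} {g : Y' →ₗ[k] Y} {h : Z' →ₗ[k] Z}
    {a' : X' ⊗[k] Z' →ₗ[k] Z' ⊗[k] X'} {a : X ⊗[k] Z →ₗ[k] Z ⊗[k] X}
    {b' : Y' ⊗[k] Z' →ₗ[k] Z' ⊗[k] Y'} {b : Y ⊗[k] Z →ₗ[k] Z ⊗[k] Y}
    (ha : Compat f h a' a) (hb : Compat g h b' b) :
    Compat (TensorProduct.map f g) h (braidLeft a' b') (braidLeft a b) := by
  refine TensorProduct.ext_threefold fun x y z ↦ ?_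
  simp only [LinearMap.comp_apply, TensorProduct.map_tmul, braidLeft_tmul, hb.apply]
  generalize b' (y ⊗ₜ z) = t
  induction t with
  | zero => simp
  | add s t hs ht => simp only [map_add, hs, ht]
  | tmul z y =>
    simp only [TensorProduct.map_tmul, passLeft_tmul, ha.apply]
    generalize a' (x ⊗ₜ z) = t
    induction t with
    | zero => simp
    | add s t hs ht => simp only [map_add, TensorProduct.add_tmul, hs, ht]
    | tmul z x => simp

theorem Compat.braidRight {f : X' →ₗ[k] X} {g : Y' →ₗ[k] Y} {h : Z' →ₗ[k] Z}
    {a' : X' ⊗[k] Y' →ₗ[k] Y' ⊗[k] X'} {a : X ⊗[k] Y →ₗ[k] Y ⊗[k] X}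
    {b' : X' ⊗[k] Z' →ₗ[k] Z' ⊗[k] X'} {b : X ⊗[k] Z →ₗ[k] Z ⊗[k] X}
    (ha : Compat f g a' a) (hb : Compat f h b' b) :
    Compat f (TensorProduct.map g h) (braidRight a' b') (braidRight a b) := by
  refine TensorProduct.ext (LinearMap.ext fun x ↦ TensorProduct.ext' fun y z ↦ ?_)
  simp only [LinearMap.compr₂ₛₗ_apply, TensorProduct.mk_apply, LinearMap.comp_apply,
    TensorProduct.map_tmul, braidRight_tmul, ha.apply]
  generalize a' (x ⊗ₜ y) = t
  induction t with
  | zero => simp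
  | add s t hs ht => simp only [map_add, hs, ht]
  | tmul y x =>
    simp only [TensorProduct.map_tmul, passRight_tmul, hb.apply]
    generalize b' (x ⊗ₜ z) = t
    induction t with
    | zero => simp
    | add s t hs ht => simp only [map_add, TensorProduct.tmul_add, hs, ht]
    | tmul z x => simp

/-- Tensor products of injective maps over a field are injective, so an identity may be checked
after inclusion in the larger spaces, where it is known. -/
theorem NatL.restrict {φ : V →ₗ[k] W} {φ' : V' →ₗ[k] W'} {f : V' →ₗ[k] V} {g : W' →ₗ[k] W}
    {h : Z' →ₗ[k] Z} {a' : V' ⊗[k] Z' →ₗ[k] Z' ⊗[k] V'} {a : V ⊗[k] Z →ₗ[k] Z ⊗[k] V}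
    {b' : W' ⊗[k] Z' →ₗ[k] Z' ⊗[k] W'} {b : W ⊗[k] Z →ₗ[k] Z ⊗[k] W} (hφ : NatL φ a b)
    (ha : Compat f h a' a) (hb : Compat g h b' b) (hφ' : φ ∘ₗ f = g ∘ₗ φ')
    (hg : Function.Injective g) (hh : Function.Injective h) : NatL φ' a' b' := by
  have hφ'' (v) : φ (f v) = g (φ' v) := LinearMap.congr_fun hφ' v
  refine natL_of_apply fun v z ↦ TensorProduct.map_injective_of_flat_flat _ _ hh hg ?_
  rw [← hb.apply, ← hφ'', hφ.apply, ha.apply]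
  generalize a' (v ⊗ₜ z) = t
  induction t with
  | zero => simp
  | add s t hs ht => simp only [map_add, hs, ht]
  | tmul z v => simp [hφ'']

theorem NatR.restrict {φ : V →ₗ[k] W} {φ' : V' →ₗ[k] W'} {f : V' →ₗ[k] V} {g : W' →ₗ[k] W}
    {h : Z' →ₗ[k] Z} {a' : Z' ⊗[k] V' →ₗ[k] V' ⊗[k] Z'} {a : Z ⊗[k] V →ₗ[k] V ⊗[k] Z}
    {b' : Z' ⊗[k] W' →ₗ[k] W' ⊗[k] Z'} {b : Z ⊗[k] W →ₗ[k] W ⊗[k] Z} (hφ : NatR φ a b)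
    (ha : Compat h f a' a) (hb : Compat h g b' b) (hφ' : φ ∘ₗ f = g ∘ₗ φ')
    (hg : Function.Injective g) (hh : Function.Injective h) : NatR φ' a' b' := by
  have hφ'' (v) : φ (f v) = g (φ' v) := LinearMap.congr_fun hφ' v
  refine natR_of_apply fun z v ↦ TensorProduct.map_injective_of_flat_flat _ _ hg hh ?_
  rw [← hb.apply, ← hφ'', hφ.apply, ha.apply]
  generalize a' (z ⊗ₜ v) = t
  induction t with
  | zero => simp
  | add s t hs ht => simp only [map_add, hs, ht]
  | tmul z v => simp [hφ'']

theorem BraidRelation.restrict {f : X' →ₗ[k] X} {g : Y' →ₗ[k] Y} {h : Z' →ₗ[k] Z}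
    {a' : X' ⊗[k] Y' →ₗ[k] Y' ⊗[k] X'} {a : X ⊗[k] Y →ₗ[k] Y ⊗[k] X}
    {b' : X' ⊗[k] Z' →ₗ[k] Z' ⊗[k] X'} {b : X ⊗[k] Z →ₗ[k] Z ⊗[k] X}
    {c' : Y' ⊗[k] Z' →ₗ[k] Z' ⊗[k] Y'} {c : Y ⊗[k] Z →ₗ[k] Z ⊗[k] Y}
    (H : BraidRelation a b c) (ha : Compat f g a' a) (hb : Compat f h b' b) (hc : Compat g h c' c)
    (hf : Function.Injective f) (hg : Function.Injective g) (hh : Function.Injective h) :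
    BraidRelation a' b' c' :=
  NatL.restrict H (hb.braidLeft hc) (hc.braidLeft hb) ha
    (TensorProduct.map_injective_of_flat_flat _ _ hg hf) hh

/-- The restriction of a braiding to retracts. -/
def restrictBraiding (l : X ⊗[k] Y ≃ₗ[k] Y ⊗[k] X) {f : X' →ₗ[k] X} {p : X →ₗ[k] X'}
    {g : Y' →ₗ[k] Y} {q : Y →ₗ[k] Y'} (hf : p ∘ₗ f = LinearMap.id) (hg : q ∘ₗ g = LinearMap.id)
    (h : Compat (f ∘ₗ p) (g ∘ₗ q) l.toLinearMap l.toLinearMap) : X' ⊗[k] Y' ≃ₗ[k] Y' ⊗[k] X' :=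
  have h' (t) : l (TensorProduct.map f g (TensorProduct.map p q t)) =
      TensorProduct.map g f (TensorProduct.map q p (l t)) := by
    have := LinearMap.congr_fun h t
    rwa [TensorProduct.map_comp, TensorProduct.map_comp] at this
  have h₁ (t) : TensorProduct.map p q (TensorProduct.map f g t) = t := by
    rw [← LinearMap.comp_apply, ← TensorProduct.map_comp, hf, hg, TensorProduct.map_id,
      LinearMap.id_apply]
  have h₂ (t) : TensorProduct.map q p (TensorProduct.map g f t) = t := by
    rw [← LinearMap.comp_apply, ← TensorProduct.map_comp, hf, hg, TensorProduct.map_id,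
      LinearMap.id_apply]
  LinearEquiv.ofLinearMap (TensorProduct.map q p ∘ₗ l.toLinearMap ∘ₗ TensorProduct.map f g)
    (TensorProduct.map p q ∘ₗ l.symm.toLinearMap ∘ₗ TensorProduct.map g f)
    (LinearMap.ext fun t ↦ by
      simp only [LinearMap.comp_apply, LinearEquiv.coe_coe, h', LinearEquiv.apply_symm_apply, h₂,
        LinearMap.id_apply])
    (LinearMap.ext fun t ↦ by
      simp only [LinearMap.comp_apply, LinearEquiv.coe_coe, ← h', LinearEquiv.symm_apply_apply, h₁,
        LinearMap.id_apply])

theorem compat_restrictBraiding (l : X ⊗[k] Y ≃ₗ[k] Y ⊗[k] X) {f : X' →ₗ[k] X} {p : X →ₗ[k] X'}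
    {g : Y' →ₗ[k] Y} {q : Y →ₗ[k] Y'} (hf : p ∘ₗ f = LinearMap.id) (hg : q ∘ₗ g = LinearMap.id)
    (h : Compat (f ∘ₗ p) (g ∘ₗ q) l.toLinearMap l.toLinearMap) :
    Compat f g (restrictBraiding l hf hg h).toLinearMap l.toLinearMap := by
  refine LinearMap.ext fun t ↦ ?_
  have := LinearMap.congr_fun h (TensorProduct.map f g t)
  rw [LinearMap.comp_apply, ← LinearMap.comp_apply (TensorProduct.map _ _),
    ← TensorProduct.map_comp, LinearMap.comp_assoc, hf, LinearMap.comp_assoc, hg] at this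
  refine this.trans ?_
  rw [TensorProduct.map_comp]
  rfl

end Compatibility

/-! ### Restricting a comeasuring to a braided retract -/

section Restriction

variable {k : Type u} [Field k] {A : Type v} [NonUnitalRing A] [Module k A]
  [IsScalarTower k A A] [SMulCommClass k A A] {Ψ : A ⊗[k] A ≃ₗ[k] A ⊗[k] A}
  {B : Type*} [NonUnitalRing B] [Module k B] [IsScalarTower k B B] [SMulCommClass k B B]
  {N : Type*} [NonUnitalRing N] [Module k N] [IsScalarTower k N N] [SMulCommClass k N N]

/-- The restriction of a comeasuring to a subalgebra which contains its matrix elements and is a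
braided retract. -/
def Comeasuring.restrict (S : Comeasuring k Ψ B) {i : N →ₗ[k] B} {p : B →ₗ[k] N}
    (hpi : p ∘ₗ i = LinearMap.id) (hi : i ∘ₗ LinearMap.mul' k N =
      LinearMap.mul' k B ∘ₗ TensorProduct.map i i)
    (hBB : Compat (i ∘ₗ p) (i ∘ₗ p) S.ΨBB.toLinearMap S.ΨBB.toLinearMap)
    (hAB : Compat (LinearMap.id ∘ₗ LinearMap.id) (i ∘ₗ p) S.ΨAB.toLinearMap S.ΨAB.toLinearMap)
    (hBA : Compat (i ∘ₗ p) (LinearMap.id ∘ₗ LinearMap.id) S.ΨBA.toLinearMap S.ΨBA.toLinearMap)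
    (hβ : i.lTensor A ∘ₗ p.lTensor A ∘ₗ S.β = S.β) : Comeasuring k Ψ N :=
  have hinj : Function.Injective i := Function.LeftInverse.injective (LinearMap.congr_fun hpi)
  have hid : Function.Injective (LinearMap.id : A →ₗ[k] A) := Function.injective_id
  have cBB := compat_restrictBraiding S.ΨBB hpi hpi hBB
  have cAB := compat_restrictBraiding S.ΨAB (LinearMap.id_comp _) hpi hAB
  have cBA := compat_restrictBraiding S.ΨBA hpi (LinearMap.id_comp _) hBA
  have cAA := compat_id Ψ.toLinearMap
  have hAN : Function.Injective (TensorProduct.map (LinearMap.id : A →ₗ[k] A) i) :=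
    TensorProduct.map_injective_of_flat_flat _ _ hid hinj
  have hmA : LinearMap.mul' k A ∘ₗ TensorProduct.map LinearMap.id LinearMap.id =
      LinearMap.id ∘ₗ LinearMap.mul' k A := by rw [TensorProduct.map_id]; rfl
  have hβ' : S.β ∘ₗ LinearMap.id = TensorProduct.map LinearMap.id i ∘ₗ p.lTensor A ∘ₗ S.β :=
    hβ.symm
  { ΨBB := restrictBraiding S.ΨBB hpi hpi hBB
    ΨAB := restrictBraiding S.ΨAB (LinearMap.id_comp _) hpi hAB
    ΨBA := restrictBraiding S.ΨBA hpi (LinearMap.id_comp _) hBA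
    β := p.lTensor A ∘ₗ S.β
    braid_AAB := S.braid_AAB.restrict cAA cAB cAB hid hid hinj
    braid_ABA := S.braid_ABA.restrict cAB cAA cBA hid hinj hid
    braid_BAA := S.braid_BAA.restrict cBA cBA cAA hinj hid hid
    braid_ABB := S.braid_ABB.restrict cAB cAB cBB hid hinj hinj
    braid_BAB := S.braid_BAB.restrict cBA cBB cAB hinj hid hinj
    braid_BBA := S.braid_BBA.restrict cBB cBA cBA hinj hinj hid
    braid_BBB := S.braid_BBB.restrict cBB cBB cBB hinj hinj hinj
    mul_natural_AB :=
      ⟨NatL.restrict S.mul_natural_AB.1 (cAB.braidLeft cAB) cAB hmA hid hinj,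
        NatR.restrict S.mul_natural_AB.2 (cBA.braidRight cBA) cBA hmA hid hinj⟩
    mul_natural_BA :=
      ⟨NatL.restrict S.mul_natural_BA.1 (cBA.braidLeft cBA) cBA hi.symm hinj hid,
        NatR.restrict S.mul_natural_BA.2 (cAB.braidRight cAB) cAB hi.symm hinj hid⟩
    mul_natural_BB :=
      ⟨NatL.restrict S.mul_natural_BB.1 (cBB.braidLeft cBB) cBB hi.symm hinj hinj,
        NatR.restrict S.mul_natural_BB.2 (cBB.braidRight cBB) cBB hi.symm hinj hinj⟩
    β_natural_A :=
      ⟨NatL.restrict S.β_natural_A.1 cAA (cAA.braidLeft cBA) hβ' hAN hid,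
        NatR.restrict S.β_natural_A.2 cAA (cAA.braidRight cAB) hβ' hAN hid⟩
    β_natural_B :=
      ⟨NatL.restrict S.β_natural_B.1 cAB (cAB.braidLeft cBB) hβ' hAN hinj,
        NatR.restrict S.β_natural_B.2 cBA (cBA.braidRight cBB) hβ' hAN hinj⟩
    β_mul := by
      have h := map_bmul (f := LinearMap.id) hmA.symm hi cBA
      refine LinearMap.ext fun t ↦ hAN ?_
      have h₁ := LinearMap.congr_fun S.β_mul t
      have h₂ := LinearMap.congr_fun h (TensorProduct.map (p.lTensor A ∘ₗ S.β)
        (p.lTensor A ∘ₗ S.β) t)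
      have h₃ : TensorProduct.map (TensorProduct.map LinearMap.id i)
          (TensorProduct.map LinearMap.id i) (TensorProduct.map (p.lTensor A ∘ₗ S.β)
          (p.lTensor A ∘ₗ S.β) t) = TensorProduct.map S.β S.β t := by
        rw [← LinearMap.comp_apply, ← TensorProduct.map_comp]
        exact congrArg (fun f ↦ TensorProduct.map f f t) hβ
      refine (LinearMap.congr_fun hβ (LinearMap.mul' k A t)).trans (h₁.trans (Eq.trans ?_ h₂.symm))
      rw [LinearMap.comp_apply, LinearMap.comp_apply, h₃]
      rfl }

theorem Comeasuring.intertwines_restrict (S : Comeasuring k Ψ B) {i : N →ₗ[k] B}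
    {p : B →ₗ[k] N} (hpi : p ∘ₗ i = LinearMap.id) (hi : i ∘ₗ LinearMap.mul' k N =
      LinearMap.mul' k B ∘ₗ TensorProduct.map i i)
    (hBB : Compat (i ∘ₗ p) (i ∘ₗ p) S.ΨBB.toLinearMap S.ΨBB.toLinearMap)
    (hAB : Compat (LinearMap.id ∘ₗ LinearMap.id) (i ∘ₗ p) S.ΨAB.toLinearMap S.ΨAB.toLinearMap)
    (hBA : Compat (i ∘ₗ p) (LinearMap.id ∘ₗ LinearMap.id) S.ΨBA.toLinearMap S.ΨBA.toLinearMap)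
    (hβ : i.lTensor A ∘ₗ p.lTensor A ∘ₗ S.β = S.β) :
    Intertwines (S.restrict hpi hi hBB hAB hBA hβ) S i :=
  hβ.symm

theorem Comeasuring.isBraidedMap_restrict (S : Comeasuring k Ψ B) {i : N →ₗ[k] B}
    {p : B →ₗ[k] N} (hpi : p ∘ₗ i = LinearMap.id) (hi : i ∘ₗ LinearMap.mul' k N =
      LinearMap.mul' k B ∘ₗ TensorProduct.map i i)
    (hBB : Compat (i ∘ₗ p) (i ∘ₗ p) S.ΨBB.toLinearMap S.ΨBB.toLinearMap)
    (hAB : Compat (LinearMap.id ∘ₗ LinearMap.id) (i ∘ₗ p) S.ΨAB.toLinearMap S.ΨAB.toLinearMap)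
    (hBA : Compat (i ∘ₗ p) (LinearMap.id ∘ₗ LinearMap.id) S.ΨBA.toLinearMap S.ΨBA.toLinearMap)
    (hβ : i.lTensor A ∘ₗ p.lTensor A ∘ₗ S.β = S.β) :
    IsBraidedMap (S.restrict hpi hi hBB hAB hBA hβ) S i where
  map_BB := compat_restrictBraiding S.ΨBB hpi hpi hBB
  map_AB := compat_restrictBraiding S.ΨAB (LinearMap.id_comp _) hpi hAB
  map_BA := compat_restrictBraiding S.ΨBA hpi (LinearMap.id_comp _) hBA

end Restriction

/-! ### The augmentation and the nonunital part -/

section Augmentation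

theorem natL_id_sub {k M Z : Type*} [Field k] [AddCommGroup M] [Module k M] [AddCommGroup Z]
    [Module k Z]
    {l : M ⊗[k] Z →ₗ[k] Z ⊗[k] M} {f : M →ₗ[k] k} {g : k →ₗ[k] M}
    (hf : NatL f l (unitBraidLeft k Z)) (hg : NatL g (unitBraidLeft k Z) l) :
    NatL (LinearMap.id - g ∘ₗ f) l l := by
  have h : NatL (g ∘ₗ f) l l := hg.comp hf
  unfold NatL at *
  rw [LinearMap.rTensor_sub, LinearMap.lTensor_sub, LinearMap.comp_sub, LinearMap.sub_comp, h]
  simp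

theorem natR_id_sub {k M Z : Type*} [Field k] [AddCommGroup M] [Module k M] [AddCommGroup Z]
    [Module k Z]
    {l : Z ⊗[k] M →ₗ[k] M ⊗[k] Z} {f : M →ₗ[k] k} {g : k →ₗ[k] M}
    (hf : NatR f l (unitBraidRight k Z)) (hg : NatR g (unitBraidRight k Z) l) :
    NatR (LinearMap.id - g ∘ₗ f) l l := by
  unfold NatR at *
  rw [LinearMap.rTensor_sub, LinearMap.lTensor_sub, LinearMap.comp_sub, LinearMap.sub_comp,
    LinearMap.lTensor_comp, ← LinearMap.comp_assoc, hg, LinearMap.comp_assoc, hf,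
    LinearMap.rTensor_comp, LinearMap.comp_assoc]
  simp

variable {k : Type u} [Field k] {ι : Type x} [Fintype ι] [DecidableEq ι]
  {A : Type v} [NonUnitalRing A] [Module k A]
  [IsScalarTower k A A] [SMulCommClass k A A] {e : Module.Basis ι k A}
  {R : Matrix (ι × ι) (ι × ι) k} {Ψ : A ⊗[k] A ≃ₗ[k] A ⊗[k] A}

variable (e R) in
/-- The character of `M₁` which kills the generators. -/
def augmentation : M₁ e R →ₐ[k] k := liftM₁ isSolution_zero

@[simp]
theorem augmentation_gen (i j : ι) : augmentation e R (gen e R i j) = 0 := by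
  simp [augmentation]

theorem gen_mem (i j : ι) : gen e R i j ∈ MPlus e R :=
  NonUnitalAlgebra.subset_adjoin k ⟨(i, j), rfl⟩

theorem augmentation_eq_zero {a : M₁ e R} (ha : a ∈ MPlus e R) : augmentation e R a = 0 := by
  induction ha using NonUnitalAlgebra.adjoin_induction with
  | mem x hx => obtain ⟨p, rfl⟩ := hx; exact augmentation_gen p.1 p.2
  | add x y _ _ hx hy => rw [map_add, hx, hy, add_zero]
  | zero => exact map_zero _
  | mul x y _ _ hx hy => rw [map_mul, hx, zero_mul]
  | smul r x _ hx => rw [map_smul, hx, smul_zero]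

theorem sub_augmentation_mem (a : M₁ e R) : a - augmentation e R a • 1 ∈ MPlus e R := by
  induction a using M₁_induction with
  | algebraMap r =>
    rw [AlgHom.commutes, Algebra.algebraMap_eq_smul_one, Algebra.algebraMap_self, RingHom.id_apply,
      sub_self]
    exact zero_mem _
  | gen i j =>
    rw [augmentation_gen, zero_smul, sub_zero]
    exact gen_mem i j
  | mul a b ha hb =>
    -- Expand the product of `a = a₀ + ε(a)` and `b = b₀ + ε(b)`, where `ε` is the augmentation and
    -- `a₀`, `b₀` lie in `MPlus`.
    have h : a * b - augmentation e R (a * b) • 1 =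
        (a - augmentation e R a • 1) * (b - augmentation e R b • 1) +
          augmentation e R b • (a - augmentation e R a • 1) +
          augmentation e R a • (b - augmentation e R b • 1) := by
      simp only [map_mul, sub_mul, mul_sub, smul_mul_assoc, mul_smul_comm, one_mul, mul_one,
        smul_sub, smul_smul, mul_comm (augmentation e R b)]
      abel
    rw [h]
    exact add_mem (add_mem (mul_mem ha hb) (SMulMemClass.smul_mem _ ha))
      (SMulMemClass.smul_mem _ hb)
  | add a b ha hb =>
    rw [map_add, add_smul, add_sub_add_comm]
    exact add_mem ha hb

theorem isCompl_MPlus : IsCompl (Submodule.span k {(1 : M₁ e R)}) (MPlus e R).toSubmodule := by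
  constructor
  · rw [Submodule.disjoint_def]
    intro x hx hx'
    obtain ⟨r, rfl⟩ := Submodule.mem_span_singleton.1 hx
    have := augmentation_eq_zero hx'
    rw [map_smul, map_one, smul_eq_mul, mul_one] at this
    rw [this, zero_smul]
  · rw [codisjoint_iff, eq_top_iff]
    rintro x -
    exact Submodule.mem_sup.2 ⟨_, Submodule.smul_mem _ (augmentation e R x)
      (Submodule.mem_span_singleton_self 1), _, sub_augmentation_mem x, by abel⟩

variable (e R) in
/-- The inclusion of the nonunital algebra generated by the `u^i_j`. -/
abbrev inclMPlus : MPlus e R →ₗ[k] M₁ e R := (MPlus e R).toSubmodule.subtype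

variable (e R) in
/-- The projection onto the nonunital algebra generated by the `u^i_j`. -/
def projMPlus : M₁ e R →ₗ[k] MPlus e R :=
  LinearMap.codRestrict (MPlus e R).toSubmodule
    (LinearMap.id - Algebra.linearMap k (M₁ e R) ∘ₗ (augmentation e R).toLinearMap) fun a ↦ by
      simpa [Algebra.algebraMap_eq_smul_one] using sub_augmentation_mem a

theorem inclMPlus_comp_projMPlus : inclMPlus e R ∘ₗ projMPlus e R =
    LinearMap.id - Algebra.linearMap k (M₁ e R) ∘ₗ (augmentation e R).toLinearMap := rfl

theorem projMPlus_comp_inclMPlus : projMPlus e R ∘ₗ inclMPlus e R = LinearMap.id := by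
  refine LinearMap.ext fun a ↦ Subtype.ext ?_
  change (a : M₁ e R) - algebraMap k (M₁ e R) (augmentation e R a) = a
  rw [augmentation_eq_zero a.2, map_zero, sub_zero]

theorem inclMPlus_projMPlus_gen (i j : ι) :
    inclMPlus e R (projMPlus e R (gen e R i j)) = gen e R i j := by
  change gen e R i j - algebraMap k (M₁ e R) (augmentation e R (gen e R i j)) = _
  rw [augmentation_gen, map_zero, sub_zero]

theorem projMPlus_gen (i j : ι) : projMPlus e R (gen e R i j) = ⟨gen e R i j, gen_mem i j⟩ :=
  Subtype.ext (inclMPlus_projMPlus_gen i j)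

theorem augmentation_betaU : (augmentation e R).toLinearMap.lTensor A ∘ₗ betaU e R = 0 := by
  refine e.ext fun j ↦ ?_
  simp

variable (D : M₁Braidings e R Ψ) (hΨ : IsBraidedAlgebra Ψ)

/-- The augmentation kills every matrix element, so its composite with the coaction is zero and the
condition on a character holds trivially. -/
theorem UnitalMover.natL_augmentation {X : Type*} [AddCommGroup X] [Module k X]
    {lV : A ⊗[k] X →ₗ[k] X ⊗[k] A}
    {lM : M₁ e R ⊗[k] X →ₗ[k] X ⊗[k] M₁ e R} (h : UnitalMover e R lV lM)
    (hinj : Function.Injective lV) :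
    NatL (augmentation e R).toLinearMap lM (unitBraidLeft k X) := by
  refine h.natL_character hinj _ ?_
  rw [augmentation_betaU]
  simp [NatL]

theorem M₁Braidings.augmentation_natural_A : NaturalWith (augmentation e R).toLinearMap
    D.MA.toLinearMap (unitBraidLeft k A) D.AM.toLinearMap (unitBraidRight k A) :=
  D.character_natural_A (D.mover_A.natL_augmentation Ψ.injective)
    (D.mover_A_symm.natL_augmentation Ψ.symm.injective)

theorem M₁Braidings.augmentation_natural_M : NaturalWith (augmentation e R).toLinearMap
    D.MM.toLinearMap (unitBraidLeft k (M₁ e R)) D.MM.toLinearMap (unitBraidRight k (M₁ e R)) :=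
  D.character_natural_M (D.mover_M.natL_augmentation D.AM.injective) D.augmentation_natural_A.2

theorem M₁Braidings.compat_proj_BA : Compat (inclMPlus e R ∘ₗ projMPlus e R)
    (LinearMap.id ∘ₗ LinearMap.id) D.MA.toLinearMap D.MA.toLinearMap := by
  rw [inclMPlus_comp_projMPlus]
  exact natL_id_sub D.augmentation_natural_A.1 D.unit_natural_A.1

theorem M₁Braidings.compat_proj_AB : Compat (LinearMap.id ∘ₗ LinearMap.id)
    (inclMPlus e R ∘ₗ projMPlus e R) D.AM.toLinearMap D.AM.toLinearMap := by
  rw [inclMPlus_comp_projMPlus]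
  exact natR_id_sub D.augmentation_natural_A.2 D.unit_natural_A.2

theorem M₁Braidings.compat_proj_BB : Compat (inclMPlus e R ∘ₗ projMPlus e R)
    (inclMPlus e R ∘ₗ projMPlus e R) D.MM.toLinearMap D.MM.toLinearMap := by
  have h₁ := natL_id_sub D.augmentation_natural_M.1 D.unit_natural_M.1
  have h₂ := natR_id_sub D.augmentation_natural_M.2 D.unit_natural_M.2
  rw [← inclMPlus_comp_projMPlus] at h₁ h₂
  refine TensorProduct.ext' fun a b ↦ ?_
  have h₃ := NatL.apply h₁ a ((inclMPlus e R ∘ₗ projMPlus e R) b)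
  have h₄ := NatR.apply h₂ a b
  rw [h₄] at h₃
  refine h₃.trans ?_
  rw [← LinearMap.comp_apply, LinearMap.lTensor_comp_rTensor]
  rfl

/-- The comeasuring by the nonunital algebra generated by the `u^i_j`. -/
def M₁Braidings.comeasuringMPlus : Comeasuring k Ψ (MPlus e R) :=
  (D.comeasuring hΨ).restrict (i := inclMPlus e R) (p := projMPlus e R) projMPlus_comp_inclMPlus
    (TensorProduct.ext' fun _ _ ↦ rfl) D.compat_proj_BB D.compat_proj_AB
    D.compat_proj_BA (e.ext fun j ↦ by
      change (inclMPlus e R).lTensor A ((projMPlus e R).lTensor A (betaU e R (e j))) =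
        betaU e R (e j)
      simp only [betaU_basis, map_sum, LinearMap.lTensor_tmul, inclMPlus_projMPlus_gen])

theorem M₁Braidings.comeasuringMPlus_β (j : ι) : (D.comeasuringMPlus hΨ).β (e j) =
    ∑ a, e a ⊗ₜ (⟨gen e R a j, gen_mem a j⟩ : MPlus e R) := by
  change (projMPlus e R).lTensor A (betaU e R (e j)) = _
  simp only [betaU_basis, map_sum, LinearMap.lTensor_tmul, projMPlus_gen]

theorem M₁Braidings.intertwines_incl :
    Intertwines (D.comeasuringMPlus hΨ) (D.comeasuring hΨ) (inclMPlus e R) :=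
  Comeasuring.intertwines_restrict _ _ _ _ _ _ _

theorem M₁Braidings.isBraidedMap_incl :
    IsBraidedMap (D.comeasuringMPlus hΨ) (D.comeasuring hΨ) (inclMPlus e R) :=
  Comeasuring.isBraidedMap_restrict _ _ _ _ _ _ _

end Augmentation

/-! ### Maps between comeasurings respect braidings -/

section Movers

variable {k : Type u} [Field k] {A : Type v} [NonUnitalRing A] [Module k A]
  [IsScalarTower k A A] [SMulCommClass k A A] {Ψ : A ⊗[k] A ≃ₗ[k] A ⊗[k] A}
  {B : Type*} [NonUnitalRing B] [Module k B] [IsScalarTower k B B] [SMulCommClass k B B]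

theorem Comeasuring.mover_A (S : Comeasuring k Ψ B) :
    Mover (LinearMap.mul' k B) S.β Ψ.toLinearMap S.ΨBA.toLinearMap :=
  ⟨S.mul_natural_BA.1, S.β_natural_A.1⟩

theorem Comeasuring.mover_A_symm (S : Comeasuring k Ψ B) :
    Mover (LinearMap.mul' k B) S.β Ψ.symm.toLinearMap S.ΨAB.symm.toLinearMap :=
  ⟨NatR.symm_braidLeft S.mul_natural_BA.2, NatR.inverse S.β_natural_A.2 Ψ.comp_symm
    (braidLeft_comp_braidRight Ψ.symm_comp S.ΨAB.symm_comp)⟩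

theorem Comeasuring.mover_B (S : Comeasuring k Ψ B) :
    Mover (LinearMap.mul' k B) S.β S.ΨAB.toLinearMap S.ΨBB.toLinearMap :=
  ⟨S.mul_natural_BB.1, S.β_natural_B.1⟩

/-- To check that a map is compatible with the braidings one can use the inverse braidings. -/
theorem isBraidedMap_of_symm {C : Type*} [NonUnitalRing C] [Module k C] [IsScalarTower k C C]
    [SMulCommClass k C C] {S : Comeasuring k Ψ B} {T : Comeasuring k Ψ C} {f : B →ₗ[k] C}
    (hBA : ∀ b a, T.ΨBA (f b ⊗ₜ a) = f.lTensor A (S.ΨBA (b ⊗ₜ a)))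
    (hAB : ∀ b a, T.ΨAB.symm (f b ⊗ₜ a) = f.lTensor A (S.ΨAB.symm (b ⊗ₜ a)))
    (hBB : NatR f S.ΨAB.toLinearMap T.ΨAB.toLinearMap → ∀ b b',
      T.ΨBB (f b ⊗ₜ f b') = TensorProduct.map f f (S.ΨBB (b ⊗ₜ b'))) : IsBraidedMap S T f := by
  have h : NatL f S.ΨAB.symm.toLinearMap T.ΨAB.symm.toLinearMap := natL_of_apply hAB
  have h' : NatR f S.ΨAB.toLinearMap T.ΨAB.toLinearMap := h.inverse S.ΨAB.symm_comp T.ΨAB.comp_symm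
  exact ⟨TensorProduct.ext' (hBB h'), h', TensorProduct.ext' hBA⟩

/-- The matrix elements of a comeasuring. -/
def Comeasuring.coeff {ι : Type*} (e : Module.Basis ι k A) (S : Comeasuring k Ψ B) (i j : ι) : B :=
  TensorProduct.lid k B ((e.coord i).rTensor B (S.β (e j)))

theorem Comeasuring.β_basis {ι : Type*} [Fintype ι] (e : Module.Basis ι k A)
    (S : Comeasuring k Ψ B) (j : ι) : S.β (e j) = ∑ a, e a ⊗ₜ S.coeff e a j := by
  unfold Comeasuring.coeff
  generalize S.β (e j) = t
  induction t with
  | zero => simp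
  | add s t hs ht =>
    simp only [map_add, TensorProduct.tmul_add, Finset.sum_add_distrib, ← hs, ← ht]
  | tmul v x =>
    simp only [LinearMap.rTensor_tmul, TensorProduct.lid_tmul,
      ← TensorProduct.smul_tmul, ← TensorProduct.sum_tmul, Module.Basis.coord_apply,
      e.sum_repr]

theorem intertwines_iff {ι : Type*} [Fintype ι] (e : Module.Basis ι k A) {C : Type*}
    [NonUnitalRing C] [Module k C] [IsScalarTower k C C] [SMulCommClass k C C]
    {S : Comeasuring k Ψ B} {T : Comeasuring k Ψ C} {f : B →ₗ[k] C} {u : ι → ι → B}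
    (hu : ∀ j, S.β (e j) = ∑ a, e a ⊗ₜ u a j) :
    Intertwines S T f ↔ ∀ i j, f (u i j) = T.coeff e i j := by
  constructor
  · intro h i j
    have h₁ := LinearMap.congr_fun h (e j)
    rw [T.β_basis e, LinearMap.comp_apply, hu] at h₁
    simp only [map_sum, LinearMap.lTensor_tmul] at h₁
    exact (congrFun (sum_basis_tmul_injective e h₁) i).symm
  · intro h
    refine e.ext fun j ↦ ?_
    rw [T.β_basis e, LinearMap.comp_apply, hu]
    simp only [map_sum, LinearMap.lTensor_tmul, h]

/-- A map which intertwines comeasurings and is multiplicative commutes with the braidings if its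
source is generated by the matrix elements. -/
theorem mover_natural_adjoin {ι : Type*} [Fintype ι] {e : Module.Basis ι k A}
    {N : Type*} [NonUnitalRing N] [Module k N] [IsScalarTower k N N] [SMulCommClass k N N]
    {S : Comeasuring k Ψ N} {T : Comeasuring k Ψ B} {u : ι → ι → N}
    (hu : ∀ j, S.β (e j) = ∑ a, e a ⊗ₜ u a j)
    (hgen : NonUnitalAlgebra.adjoin k (Set.range fun q : ι × ι ↦ u q.1 q.2) = ⊤)
    {X Y : Type*} [AddCommGroup X] [Module k X] [AddCommGroup Y] [Module k Y]
    {lVX : A ⊗[k] X →ₗ[k] X ⊗[k] A} {lMX : N ⊗[k] X →ₗ[k] X ⊗[k] N}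
    {lVY : A ⊗[k] Y →ₗ[k] Y ⊗[k] A} {lBY : B ⊗[k] Y →ₗ[k] Y ⊗[k] B}
    (hX : Mover (LinearMap.mul' k N) S.β lVX lMX)
    (hY : Mover (LinearMap.mul' k B) T.β lVY lBY) (hinj : Function.Injective lVY)
    {π : N →ₗ[k] B} (hmul : ∀ a b, π (a * b) = π a * π b) (hπ : Intertwines S T π)
    {f : X →ₗ[k] Y} (hf : NatR f lVX lVY) (a : N) (x : X) :
    lBY (π a ⊗ₜ f x) = TensorProduct.map f π (lMX (a ⊗ₜ x)) := by
  have ha : a ∈ NonUnitalAlgebra.adjoin k (Set.range fun q : ι × ι ↦ u q.1 q.2) :=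
    hgen ▸ NonUnitalAlgebra.mem_top
  induction ha using NonUnitalAlgebra.adjoin_induction generalizing x with
  | mem y hy =>
    obtain ⟨q, rfl⟩ := hy
    exact mover_natural_gen hX.coact hY.coact hinj hπ hf e hu q.1 q.2 x
  | zero => simp
  | mul a b _ _ ha hb =>
    exact mover_natural_mul hX.mul hY.mul (fun a b ↦ hmul a b) ha hb x
  | add a b _ _ ha hb => simp only [map_add, TensorProduct.add_tmul, ha, hb]
  | smul r a _ ha => simp only [map_smul, ← TensorProduct.smul_tmul', ha]

/-- The braidings with `A` come first: compatibility with `ΨAB` is the hypothesis under which the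
same principle applies to `ΨBB`. -/
theorem Intertwines.isBraidedMap {ι : Type*} [Fintype ι] {e : Module.Basis ι k A}
    {N : Type*} [NonUnitalRing N] [Module k N] [IsScalarTower k N N] [SMulCommClass k N N]
    {S : Comeasuring k Ψ N} {T : Comeasuring k Ψ B} {u : ι → ι → N}
    (hu : ∀ j, S.β (e j) = ∑ a, e a ⊗ₜ u a j)
    (hgen : NonUnitalAlgebra.adjoin k (Set.range fun q : ι × ι ↦ u q.1 q.2) = ⊤)
    {π : N →ₙₐ[k] B} (hπ : Intertwines S T (π : N →ₗ[k] B)) :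
    IsBraidedMap S T (π : N →ₗ[k] B) := by
  have hmul (a b : N) := map_mul π a b
  refine isBraidedMap_of_symm (fun b a ↦ ?_) (fun b a ↦ ?_) (fun h b b' ↦ ?_)
  · exact mover_natural_adjoin hu hgen S.mover_A T.mover_A Ψ.injective hmul hπ (natR_id _) b a
  · exact mover_natural_adjoin hu hgen S.mover_A_symm T.mover_A_symm Ψ.symm.injective
      hmul hπ (natR_id _) b a
  · exact mover_natural_adjoin hu hgen S.mover_B T.mover_B T.ΨAB.injective hmul hπ h b b'

end Movers

/-! ### Universality among unital comeasurings -/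

section Unital

variable {k : Type u} [Field k] {ι : Type x} [Fintype ι] [DecidableEq ι]
  {A : Type v} [NonUnitalRing A] [Module k A]
  [IsScalarTower k A A] [SMulCommClass k A A] {e : Module.Basis ι k A}
  {R : Matrix (ι × ι) (ι × ι) k} {Ψ : A ⊗[k] A ≃ₗ[k] A ⊗[k] A}
  (D : M₁Braidings e R Ψ) (hΨ : IsBraidedAlgebra Ψ)

theorem M₁Braidings.isBraidedMap_algHom {B : Type w} [Ring B] [Algebra k B]
    {T : Comeasuring k Ψ B} (hT : T.IsUnital) (π : M₁ e R →ₐ[k] B)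
    (hπ : Intertwines (D.comeasuring hΨ) T π.toLinearMap) :
    IsBraidedMap (D.comeasuring hΨ) T π.toLinearMap := by
  have hmul (a b : M₁ e R) : π.toLinearMap (a * b) =
      LinearMap.mul' k B (π.toLinearMap a ⊗ₜ π.toLinearMap b) := by simp
  have hβ : T.β = π.toLinearMap.lTensor A ∘ₗ betaU e R := hπ
  have hone : π.toLinearMap 1 = 1 := map_one π
  refine isBraidedMap_of_symm (fun b a ↦ ?_) (fun b a ↦ ?_) (fun h b b' ↦ ?_)
  · exact D.mover_A.natural T.mover_A Ψ.injective hmul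
      (fun y ↦ by rw [hone]; exact hT.unit_A.apply_left y) hβ (natR_id _) b a
  · exact D.mover_A_symm.natural T.mover_A_symm Ψ.symm.injective hmul
      (fun y ↦ by
        rw [hone, LinearEquiv.coe_coe, LinearEquiv.symm_apply_eq]
        exact (hT.unit_A.apply_right y).symm) hβ (natR_id _) b a
  · exact D.mover_M.natural T.mover_B T.ΨAB.injective hmul
      (fun y ↦ by rw [hone]; exact hT.unit_B.apply_left y) hβ h b b'

theorem M₁Braidings.isUnitalUniversal (hR : IsUnit R) (hΨR : IsBraidingOf e R Ψ) :
    (D.comeasuring hΨ).IsUnitalUniversal.{u, v, w} := by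
  refine ⟨D.isUnital hΨ, fun B _ _ T hT ↦ ?_⟩
  have hsol := Comeasuring.isSolution hR hΨR (T.β_basis e)
  have hu (j : ι) : (D.comeasuring hΨ).β (e j) = ∑ a, e a ⊗ₜ gen e R a j := betaU_basis j
  have hπ : Intertwines (D.comeasuring hΨ) T (liftM₁ hsol).toLinearMap :=
    (intertwines_iff e hu).2 fun i j ↦ liftM₁_gen hsol i j
  refine ⟨liftM₁ hsol, hπ, D.isBraidedMap_algHom hΨ hT _ hπ, fun π' h ↦ ?_⟩
  refine M₁_algHom_ext fun i j ↦ ?_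
  exact ((intertwines_iff e hu).1 h i j).trans ((intertwines_iff e hu).1 hπ i j).symm

end Unital

/-! ### Universality among all comeasurings -/

section Nonunital

variable {k : Type u} [Field k] {ι : Type x} [Fintype ι] [DecidableEq ι]
  {A : Type v} [NonUnitalRing A] [Module k A]
  [IsScalarTower k A A] [SMulCommClass k A A] {e : Module.Basis ι k A}
  {R : Matrix (ι × ι) (ι × ι) k} {Ψ : A ⊗[k] A ≃ₗ[k] A ⊗[k] A}
  (D : M₁Braidings e R Ψ) (hΨ : IsBraidedAlgebra Ψ)
  {B : Type w} [NonUnitalRing B] [Module k B] [IsScalarTower k B B] [SMulCommClass k B B]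
  {T : Comeasuring k Ψ B}

theorem MPlus_induction {p : MPlus e R → Prop} (gen : ∀ i j, p ⟨gen e R i j, gen_mem i j⟩)
    (zero : p 0) (mul : ∀ a b, p a → p b → p (a * b)) (add : ∀ a b, p a → p b → p (a + b))
    (smul : ∀ (r : k) a, p a → p (r • a)) (a : MPlus e R) : p a := by
  obtain ⟨a, ha⟩ := a
  induction ha using NonUnitalAlgebra.adjoin_induction with
  | mem x hx => obtain ⟨q, rfl⟩ := hx; exact gen q.1 q.2
  | add x y hx hy h h' => exact add ⟨x, hx⟩ ⟨y, hy⟩ h h'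
  | zero => exact zero
  | mul x y hx hy h h' => exact mul ⟨x, hx⟩ ⟨y, hy⟩ h h'
  | smul r x hx h => exact smul r ⟨x, hx⟩ h

theorem adjoin_gen_MPlus : NonUnitalAlgebra.adjoin k (Set.range fun q : ι × ι ↦
    (⟨gen e R q.1 q.2, gen_mem q.1 q.2⟩ : MPlus e R)) = ⊤ := by
  rw [eq_top_iff]
  rintro a -
  induction a using MPlus_induction with
  | gen i j => exact NonUnitalAlgebra.subset_adjoin k ⟨(i, j), rfl⟩
  | zero => exact zero_mem _
  | mul a b ha hb => exact mul_mem ha hb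
  | add a b ha hb => exact add_mem ha hb
  | smul r a ha => exact SMulMemClass.smul_mem r ha

/-- Maps out of `M₁` need a unital target, so `B` is embedded in its unitization. -/
theorem Comeasuring.isSolution_unitization (hR : IsUnit R) (hΨR : IsBraidingOf e R Ψ) :
    IsSolution e R (Matrix.of fun i j ↦ (Unitization.inr (T.coeff e i j) : Unitization k B)) := by
  intro i j l
  have h := congrArg (Unitization.inrHom k k B) (T.relation hR hΨR (T.β_basis e) i j l)
  simpa using h

/-- The algebra map on `M⁺` defined by a comeasuring. -/
def Comeasuring.liftMPlus (T : Comeasuring k Ψ B) (hR : IsUnit R) (hΨR : IsBraidingOf e R Ψ) :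
    MPlus e R →ₙₐ[k] B :=
  let φ := liftM₁ (T.isSolution_unitization hR hΨR)
  -- The scalar part of the lift kills the generators, so it is the augmentation and vanishes on
  -- `MPlus`. The lift thus lands in `B` there.
  have hφ : (Unitization.fstHom k B).comp φ = augmentation e R :=
    M₁_algHom_ext fun i j ↦ by simp [φ]
  have h (a : MPlus e R) : (φ a).fst = 0 := by
    rw [← augmentation_eq_zero a.2, ← hφ]
    rfl
  { toFun := fun a ↦ (φ a).snd
    map_smul' := fun r a ↦ by simp
    map_zero' := by simp
    map_add' := fun a b ↦ by simp
    map_mul' := fun a b ↦ by simp [h] }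

theorem Comeasuring.liftMPlus_gen (hR : IsUnit R) (hΨR : IsBraidingOf e R Ψ) (i j : ι) :
    T.liftMPlus hR hΨR ⟨gen e R i j, gen_mem i j⟩ = T.coeff e i j := by
  change (liftM₁ (T.isSolution_unitization hR hΨR) (gen e R i j)).snd = _
  rw [liftM₁_gen]
  rfl

theorem M₁Braidings.isUniversal (hR : IsUnit R) (hΨR : IsBraidingOf e R Ψ) :
    (D.comeasuringMPlus hΨ).IsUniversal.{u, v, w} := by
  intro B _ _ _ _ T
  have hS := D.comeasuringMPlus_β hΨ
  have hπ : Intertwines (D.comeasuringMPlus hΨ) T (T.liftMPlus hR hΨR : MPlus e R →ₗ[k] B) :=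
    (intertwines_iff e hS).2 fun i j ↦ T.liftMPlus_gen hR hΨR i j
  refine ⟨T.liftMPlus hR hΨR, hπ, Intertwines.isBraidedMap hS adjoin_gen_MPlus hπ, fun π' h ↦ ?_⟩
  refine NonUnitalAlgHom.ext fun a ↦ ?_
  induction a using MPlus_induction with
  | gen i j => exact ((intertwines_iff e hS).1 h i j).trans ((intertwines_iff e hS).1 hπ i j).symm
  | zero => rw [map_zero, map_zero]
  | mul a b ha hb => rw [map_mul, map_mul, ha, hb]
  | add a b ha hb => rw [map_add, map_add, ha, hb]
  | smul r a ha => rw [map_smul, map_smul, ha]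

end Nonunital

end BraidedComeas

end

theorem proposition4p6 {k : Type u} [Field k] {A : Type v} [NonUnitalRing A]
    [Module k A] [IsScalarTower k A A] [SMulCommClass k A A]
    {ι : Type x} [Fintype ι] [DecidableEq ι] (e : Module.Basis ι k A)
    (R : Matrix (ι × ι) (ι × ι) k) (hR : BraidedComeas.IsBiinvertible R)
    (Ψ : A ⊗[k] A ≃ₗ[k] A ⊗[k] A) (hΨR : BraidedComeas.IsBraidingOf e R Ψ)
    (hΨ : BraidedComeas.IsBraidedAlgebra Ψ) :
    ∃ (S : BraidedComeas.Comeasuring k Ψ (BraidedComeas.M₁ e R))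
      (S' : BraidedComeas.Comeasuring k Ψ (BraidedComeas.MPlus e R))
      (_ : Coalgebra k (BraidedComeas.M₁ e R)),
      -- universal properties: with unit, and in the nonunital version, of which the former is
      -- the extension by a unit
      S.IsUnitalUniversal.{u, v, w} ∧
      S'.IsUniversal.{u, v, w} ∧
      BraidedComeas.Intertwines S' S (BraidedComeas.MPlus e R).toSubmodule.subtype ∧
      BraidedComeas.IsBraidedMap S' S (BraidedComeas.MPlus e R).toSubmodule.subtype ∧
      IsCompl (Submodule.span k {(1 : BraidedComeas.M₁ e R)})
        (BraidedComeas.MPlus e R).toSubmodule ∧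
      -- braided group structure, with coproduct and counit morphisms also relative to `A`
      BraidedComeas.IsBraidedBialgebra S.ΨBB ∧
      BraidedComeas.NaturalWith (Coalgebra.comul (R := k) (A := BraidedComeas.M₁ e R))
        S.ΨBA.toLinearMap (BraidedComeas.braidLeft S.ΨBA.toLinearMap S.ΨBA.toLinearMap)
        S.ΨAB.toLinearMap (BraidedComeas.braidRight S.ΨAB.toLinearMap S.ΨAB.toLinearMap) ∧
      BraidedComeas.NaturalWith (Coalgebra.counit (R := k) (A := BraidedComeas.M₁ e R))
        S.ΨBA.toLinearMap (BraidedComeas.unitBraidLeft k A)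
        S.ΨAB.toLinearMap (BraidedComeas.unitBraidRight k A) ∧
      -- braided coaction
      BraidedComeas.IsRightCoaction S.β ∧
      (∀ j, S.β (e j) = ∑ a, e a ⊗ₜ[k] BraidedComeas.gen e R a j) ∧
      -- matrix coalgebra
      (∀ i j, Coalgebra.comul (R := k) (BraidedComeas.gen e R i j) =
        ∑ a, BraidedComeas.gen e R i a ⊗ₜ[k] BraidedComeas.gen e R a j) ∧
      (∀ i j, Coalgebra.counit (R := k) (BraidedComeas.gen e R i j) = if i = j then 1 else 0) ∧
      -- braiding of the generators, in components and in compact form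
      (∀ i j h l, S.ΨBB (BraidedComeas.gen e R i j ⊗ₜ[k] BraidedComeas.gen e R h l) =
        ∑ m, ∑ n, ∑ r, ∑ s, ∑ a, ∑ b, ∑ c, ∑ d,
          (R (i, d) (a, m) * R⁻¹ (a, n) (r, b) * R (s, b) (c, l) *
            BraidedComeas.secondInverse R (c, h) (j, d)) •
            (BraidedComeas.gen e R m n ⊗ₜ[k] BraidedComeas.gen e R r s)) ∧
      (∀ i j h l,
        S.ΨBB (∑ a, ∑ b, ∑ c, ∑ d, (R⁻¹ (i, h) (a, b) * R (c, b) (j, d)) •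
          (BraidedComeas.gen e R a c ⊗ₜ[k] BraidedComeas.gen e R d l)) =
        ∑ a, ∑ b, ∑ c, ∑ d, (R⁻¹ (i, b) (a, d) * R (c, d) (j, l)) •
          (BraidedComeas.gen e R h b ⊗ₜ[k] BraidedComeas.gen e R a c)) ∧
      -- braidings with `A`
      (∀ i j h, S.ΨBA (BraidedComeas.gen e R i j ⊗ₜ[k] e h) =
        ∑ m, ∑ a, ∑ b, ∑ n, (R⁻¹ (i, m) (a, n) * R (b, n) (j, h)) •
          (e m ⊗ₜ[k] BraidedComeas.gen e R a b)) ∧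
      (∀ i j h, S.ΨAB (e h ⊗ₜ[k] BraidedComeas.gen e R i j) =
        ∑ a, ∑ b, ∑ m, ∑ n,
          (BraidedComeas.secondInverse R (n, i) (h, a) * R (m, b) (n, j)) •
          (BraidedComeas.gen e R a b ⊗ₜ[k] e m)) := by
  obtain ⟨D⟩ := BraidedComeas.nonempty_braidings hR hΨR hΨ
  have hu : ∀ j, (D.comeasuring hΨ).β (e j) = ∑ a, e a ⊗ₜ[k] BraidedComeas.gen e R a j :=
    fun j ↦ BraidedComeas.betaU_basis j
  refine ⟨D.comeasuring hΨ, D.comeasuringMPlus hΨ, D.coalgebra hΨ hR.1 hΨR,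
    D.isUnitalUniversal hΨ hR.1 hΨR, D.isUniversal hΨ hR.1 hΨR, D.intertwines_incl hΨ,
    D.isBraidedMap_incl hΨ, BraidedComeas.isCompl_MPlus, D.isBraidedBialgebra hΨ hR.1 hΨR,
    D.comul_natural_A hΨ hR.1 hΨR, D.counit_natural_A hR.1, D.isRightCoaction hΨ hR.1 hΨR,
    hu, D.comul_gen hΨ hR.1 hΨR, BraidedComeas.counitM₁_gen hR.1,
    (D.comeasuring hΨ).ΨBB_apply hR hΨR hu, fun i j h l ↦ ?_,
    (D.comeasuring hΨ).ΨBA_apply hR.1 hΨR hu, (D.comeasuring hΨ).ΨAB_apply hR hΨR hu⟩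
  simpa only [map_sum, map_smul] using (D.comeasuring hΨ).compact hR.1 hΨR hu i j h l
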